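/- Let $N\ge 2$ and let $\Omega\subset\mathbb R^N$ be a bounded domain (open, connected, nonempty) with piecewise $C^1$ boundary, i.e. $\mathcal H^{N-1}(\partial\Omega)<\infty$ and, for $\mathcal H^{N-1}$-almost every $x\in\partial\Omega$, there is a $C^1$ function $\rho$ near $x$ with $\rho(x)=0$, $\nabla\rho(x)\neq0$ and $\Omega=\{\rho<0\}$ near $x$. For $u\in BV(\Omega)$ put $$E(u)=\int_\Omega|\nabla u|+\int_{\partial\Omega}|u|\,d\mathcal H^{N-1}\in[0,\infty],$$ where $\int_\Omega|\nabla u|$ is the total variation of $u$ in $\Omega$ and the boundary integral is that of the trace $x\mapsto\lim_{r\to0^+}|\Omega\cap B(x,r)|^{-1}\int_{\Omega\cap B(x,r)}u$ of $u$ on $\partial\Omega$. For $n\ge1$ let $$\lambda_n=\inf_{u\in W^{1,1}_0(\Omega)}\Big\{\int_\Omega|\nabla u|+n\Big(\int_\Omega|u|-1\Big)^2\Big\},\qquad \lambda_1^\ast=\inf_{u\in BV(\Omega),\ \|u\|_{L^1(\Omega)}=1}E(u),$$ so that $\lambda_1^\ast$ is the (relaxed) first eigenvalue of $-\Delta_1$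 on $\Omega$. For every $n\ge1$ let $u_n\in BV(\Omega)$ be a minimizer over $BV(\Omega)$ of the relaxed penalized functional $$u\mapsto E(u)+n\Big(\int_\Omega|u|-1\Big)^2 .$$ Then there are a subsequence $(u_{n_k})_k$ and a function $u\in BV(\Omega)$, $u\not\equiv0$, such that $u_{n_k}\to u$ tightly in $BV(\overline\Omega)$, that is, $u_{n_k}\to u$ in $L^1(\Omega)$ and $E(u_{n_k})\to E(u)$; moreover $\|u\|_{L^1(\Omega)}=1$ and $E(u)=\lambda_1^\ast$, i.e. $u$ attains the infimum defining $\lambda_1^\ast$. If $u_n\ge0$ a.e. in $\Omega$ for every $n\ge1$, then $u\ge0$ a.e. in $\Omega$. Finally, whether or not such minimizers are given, $\lambda_1^\ast<\infty$ and $$\lim_{n\to\infty}\lambda_n=\lambda_1^\ast .$$ -/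

import Mathlib

open MeasureTheory Filter Topology Set
open scoped ENNReal

noncomputable section

namespace BVEigen

variable {N : ℕ}

/-- `x` is a boundary point near which `Ω` lies on one side of a `C¹` hypersurface:
near `x`, `Ω = {ρ < 0}` for some `C¹` function `ρ` with `ρ x = 0` and nonzero differential. -/
def IsC1BoundaryPoint (Ω : Set (EuclideanSpace ℝ (Fin N))) (x : EuclideanSpace ℝ (Fin N)) : Prop :=
  ∃ ρ : EuclideanSpace ℝ (Fin N) → ℝ,
    ContDiffAt ℝ 1 ρ x ∧ ρ x = 0 ∧ fderiv ℝ ρ x ≠ 0 ∧ ∀ᶠ y in 𝓝 x, (y ∈ Ω ↔ ρ y < 0)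

/-- The surface measure on `∂Ω`: the `(N-1)`-dimensional Hausdorff measure, normalized so that it
is Lebesgue measure on hyperplanes, restricted to the boundary. -/
def surfaceMeasure (Ω : Set (EuclideanSpace ℝ (Fin N))) : Measure (EuclideanSpace ℝ (Fin N)) :=
  (Measure.euclideanHausdorffMeasure (N - 1)).restrict (frontier Ω)

/-- Bounded domain with piecewise `C¹` boundary: the boundary has finite area and is a `C¹`
hypersurface with `Ω` on one side of it, outside a set of zero area (edges, corners, ...).
The set of `C¹` boundary points is automatically relatively open in the boundary. -/
structure IsPiecewiseC1Domain (Ω : Set (EuclideanSpace ℝ (Fin N))) : Prop where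
  isOpen : IsOpen Ω
  isConnected : IsConnected Ω
  isBounded : Bornology.IsBounded Ω
  finite_area : surfaceMeasure Ω univ < ⊤
  ae_c1 : ∀ᵐ x ∂(surfaceMeasure Ω), IsC1BoundaryPoint Ω x

/-- The divergence of a vector field on `ℝᴺ`. -/
def divergence (φ : EuclideanSpace ℝ (Fin N) → EuclideanSpace ℝ (Fin N))
    (x : EuclideanSpace ℝ (Fin N)) : ℝ :=
  ∑ i : Fin N, (fderiv ℝ φ x (EuclideanSpace.single i 1)) i

/-- Vector fields in `C¹_c(Ω; ℝᴺ)` with `|φ| ≤ 1`. -/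
structure IsTestField (Ω : Set (EuclideanSpace ℝ (Fin N)))
    (φ : EuclideanSpace ℝ (Fin N) → EuclideanSpace ℝ (Fin N)) : Prop where
  contDiff : ContDiff ℝ 1 φ
  hasCompactSupport : HasCompactSupport φ
  tsupport_subset : tsupport φ ⊆ Ω
  norm_le_one : ∀ x, ‖φ x‖ ≤ 1

/-- The total variation `∫_Ω |∇u|`, i.e. `sup {∫_Ω u div φ : φ ∈ C¹_c(Ω; ℝᴺ), |φ| ≤ 1}`. -/
def totalVariation (Ω : Set (EuclideanSpace ℝ (Fin N))) (u : EuclideanSpace ℝ (Fin N) → ℝ) :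
    ℝ≥0∞ :=
  ⨆ (φ : EuclideanSpace ℝ (Fin N) → EuclideanSpace ℝ (Fin N)) (_ : IsTestField Ω φ),
    ENNReal.ofReal (∫ x in Ω, u x * divergence φ x)

/-- `u ∈ BV(Ω)`; only the restriction of `u` to `Ω`, up to null sets, matters. -/
def MemBV (Ω : Set (EuclideanSpace ℝ (Fin N))) (u : EuclideanSpace ℝ (Fin N) → ℝ) : Prop :=
  IntegrableOn u Ω ∧ totalVariation Ω u < ⊤

/-- The boundary trace on `∂Ω` of a function on `Ω`: the limit, as `r → 0⁺`, of the mean values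
of `u` over `Ω ∩ B(x, r)`. (For `u ∈ BV(Ω)` the limit exists at almost every boundary point for
the surface measure.) -/
def trace (Ω : Set (EuclideanSpace ℝ (Fin N))) (u : EuclideanSpace ℝ (Fin N) → ℝ)
    (x : EuclideanSpace ℝ (Fin N)) : ℝ :=
  limUnder (𝓝[>] (0 : ℝ)) (fun r => ⨍ y in Ω ∩ Metric.ball x r, u y)

/-- The functional `∫_Ω |∇u| + ∫_{∂Ω} |u|`. -/
def relaxedEnergy (Ω : Set (EuclideanSpace ℝ (Fin N))) (u : EuclideanSpace ℝ (Fin N) → ℝ) :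
    ℝ≥0∞ :=
  totalVariation Ω u + ∫⁻ x, ‖trace Ω u x‖ₑ ∂(surfaceMeasure Ω)

/-- The penalization `n (∫_Ω |u| - 1)²`. -/
def penalty (Ω : Set (EuclideanSpace ℝ (Fin N))) (n : ℕ) (u : EuclideanSpace ℝ (Fin N) → ℝ) :
    ℝ≥0∞ :=
  ENNReal.ofReal (n * ((∫ x in Ω, |u x|) - 1) ^ 2)

/-- `u` is a minimizer over `BV(Ω)` of the relaxed penalized functional
`∫_Ω |∇u| + ∫_{∂Ω} |u| + n (∫_Ω |u| - 1)²`. -/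
def IsPenalizedMinimizer (Ω : Set (EuclideanSpace ℝ (Fin N))) (n : ℕ)
    (u : EuclideanSpace ℝ (Fin N) → ℝ) : Prop :=
  MemBV Ω u ∧ ∀ v : EuclideanSpace ℝ (Fin N) → ℝ, MemBV Ω v →
    relaxedEnergy Ω u + penalty Ω n u ≤ relaxedEnergy Ω v + penalty Ω n v

/-- Functions in `C^∞_c(Ω)`. -/
structure IsTestFunction (Ω : Set (EuclideanSpace ℝ (Fin N)))
    (ψ : EuclideanSpace ℝ (Fin N) → ℝ) : Prop where
  contDiff : ContDiff ℝ ((⊤ : ℕ∞) : WithTop ℕ∞) ψ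
  hasCompactSupport : HasCompactSupport ψ
  tsupport_subset : tsupport ψ ⊆ Ω

/-- `u ∈ W^{1,1}_0(Ω)` with weak gradient `G`: `u` lies in `W^{1,1}(Ω)`, its weak gradient is `G`,
and `u` is a limit of functions of `C^∞_c(Ω)` in the norm of `W^{1,1}(Ω)`. -/
structure MemW110 (Ω : Set (EuclideanSpace ℝ (Fin N))) (u : EuclideanSpace ℝ (Fin N) → ℝ)
    (G : EuclideanSpace ℝ (Fin N) → EuclideanSpace ℝ (Fin N)) : Prop where
  integrable : IntegrableOn u Ω
  integrable_grad : IntegrableOn G Ω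
  weak_grad : ∀ ψ : EuclideanSpace ℝ (Fin N) → ℝ, IsTestFunction Ω ψ →
    ∫ x in Ω, u x • gradient ψ x = -∫ x in Ω, ψ x • G x
  approx : ∃ ψ : ℕ → EuclideanSpace ℝ (Fin N) → ℝ, (∀ k, IsTestFunction Ω (ψ k)) ∧
    Tendsto (fun k => ∫⁻ x in Ω, ‖ψ k x - u x‖ₑ) atTop (𝓝 0) ∧
    Tendsto (fun k => ∫⁻ x in Ω, ‖gradient (ψ k) x - G x‖ₑ) atTop (𝓝 0)

/-- `λ_n = inf {∫_Ω |∇u| + n (∫_Ω |u| - 1)² : u ∈ W^{1,1}_0(Ω)}`. -/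
def penalizedInf (Ω : Set (EuclideanSpace ℝ (Fin N))) (n : ℕ) : ℝ≥0∞ :=
  ⨅ (u : EuclideanSpace ℝ (Fin N) → ℝ) (G : EuclideanSpace ℝ (Fin N) → EuclideanSpace ℝ (Fin N))
    (_ : MemW110 Ω u G), (∫⁻ x in Ω, ‖G x‖ₑ) + penalty Ω n u

/-- `λ₁ = inf {∫_Ω |∇u| + ∫_{∂Ω} |u| : u ∈ BV(Ω), ‖u‖₁ = 1}`. -/
def firstEigenvalue (Ω : Set (EuclideanSpace ℝ (Fin N))) : ℝ≥0∞ :=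
  ⨅ (u : EuclideanSpace ℝ (Fin N) → ℝ) (_ : MemBV Ω u) (_ : ∫ x in Ω, |u x| = 1),
    relaxedEnergy Ω u

/-- Tight convergence in `BV(Ω̄)`: convergence in `L¹(Ω)` together with convergence of the total
masses on the closure of `Ω` of the gradients of the extensions by zero, a boundary jump counting
with the absolute value of the trace: `∫_Ω |∇v_k| + ∫_{∂Ω} |v_k| → ∫_Ω |∇v| + ∫_{∂Ω} |v|`. -/
def TightTendsto (Ω : Set (EuclideanSpace ℝ (Fin N))) (v : ℕ → EuclideanSpace ℝ (Fin N) → ℝ)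
    (w : EuclideanSpace ℝ (Fin N) → ℝ) : Prop :=
  Tendsto (fun k => ∫⁻ x in Ω, ‖v k x - w x‖ₑ) atTop (𝓝 0) ∧
    Tendsto (fun k => relaxedEnergy Ω (v k)) atTop (𝓝 (relaxedEnergy Ω w))

end BVEigen

end

noncomputable section

namespace BVEigen

variable {N : ℕ}

open Metric Function
open scoped NNReal Convolution

local notation "𝔼" => EuclideanSpace ℝ (Fin N)

/-! ### Divergence and integration by parts -/

/-! Write Λ for `firstEigenvalue Ω` and E for `relaxedEnergy Ω`. Competitors of unit mass pay no
penalty, so a penalized minimizer satisfies E(u_n) + n(‖u_n‖₁ - 1)² ≤ Λ; hence E(u_n) ≤ Λ and ‖u_n‖₁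
→ 1. Homogeneity gives Λ‖u‖₁ ≤ E(u) on all of BV (`firstEigenvalue_mul_le`). If a subsequence
converges in L¹ to v and E is lower semicontinuous, then ‖v‖₁ = 1 and E(v) ≤ Λ, so E(v) = Λ, and the
squeeze Λ‖u_n‖₁ ≤ E(u_n) ≤ Λ gives convergence of the energies. What has to be built is the
compactness and the semicontinuity, and both are reduced to test functions.

Strict approximation (`exists_isTestFunction_approx`): a BV function u of finite energy is L¹-close
to test functions whose gradient mass is at most E(u) + δ. One truncates u by a smooth bounded
contraction, cuts off near the singular boundary points, multiplies by a function of the distance to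
the complement with slope about 1/h, and mollifies. The singular points cost little, since a compact
set of zero area is covered by balls with Σ r^(N-1) small. The slope costs 1/h times the mass of |u|
in a boundary layer of width h, which asymptotically does not exceed the boundary integral of the
trace (`eventually_lintegral_layer_lt`).

Semicontinuity (`relaxedEnergy_le_of_tendsto`): if test functions ψ_n → v in L¹ have gradient mass
at most a, then E(v) ≤ a. A test field sees only the gradient in its own compact support. In a thin
strip along the boundary, ψ_n starts from 0, so the mean of |ψ_n| over heights below h is paid for
by the gradient in that strip. The two regions are disjoint, so the costs add up; n → ∞ and then h →
0 turn the strip averages into the trace integral.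

Both facts need traces. Near a C¹ boundary point, Ω is flattened by a measure-preserving shear
(`GraphChart`) along a graph of small Lipschitz constant ε. BV functions have bounded variation on
almost every vertical line, hence vertical limits, and Lebesgue differentiation of a maximal
deviation upgrades these to limits of averages over Ω ∩ B(x, r)
(`ae_tendsto_ball_of_vertical_limit`). Surface measure and chart measure agree up to (1 + ε)^(N-1),
and ε → 0 at the end.

Compactness (`exists_subseq_tendsto_of_bounded`) is the Kolmogorov–Riesz argument for test
functions: mollification is uniformly close in L¹, and mollified families are precompact by
Arzelà–Ascoli.

For λ_n, strict approximation gives λ_n ≤ Λ, while Λ‖u‖₁ ≤ ∫|∇u| on W^{1,1}_0 and completing the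
square give λ_n ≥ Λ - Λ²/(4n). -/

lemma continuous_divergence {φ : 𝔼 → 𝔼} (hφ : ContDiff ℝ 1 φ) : Continuous (divergence φ) := by
  unfold divergence
  have := hφ.continuous_fderiv (by norm_num)
  fun_prop

lemma divergence_eq_zero_of_notMem_tsupport {φ : 𝔼 → 𝔼} {x : 𝔼} (hx : x ∉ tsupport φ) :
    divergence φ x = 0 := by
  have : fderiv ℝ φ x = 0 := by
    by_contra h
    exact hx (support_fderiv_subset ℝ h)
  simp [divergence, this]

lemma tsupport_divergence_subset (φ : 𝔼 → 𝔼) : tsupport (divergence φ) ⊆ tsupport φ :=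
  closure_minimal (fun x hx => by
    by_contra h
    exact hx (divergence_eq_zero_of_notMem_tsupport h)) (isClosed_tsupport φ)

lemma divergence_smul {χ : 𝔼 → ℝ} {φ : 𝔼 → 𝔼} {x : 𝔼} (hχ : DifferentiableAt ℝ χ x)
    (hφ : DifferentiableAt ℝ φ x) :
    divergence (fun y => χ y • φ y) x = χ x * divergence φ x + fderiv ℝ χ x (φ x) := by
  have h1 : φ x = ∑ i, φ x i • EuclideanSpace.single i (1 : ℝ) := by
    ext j
    simp [Finset.sum_apply, Pi.single_apply]
  have h2 : fderiv ℝ χ x (φ x) =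
      ∑ i, φ x i * fderiv ℝ χ x (EuclideanSpace.single i (1 : ℝ)) := by
    conv_lhs => rw [h1]
    simp only [map_sum, map_smul, smul_eq_mul]
  rw [h2]
  simp only [divergence, fderiv_fun_smul hχ hφ, Finset.mul_sum, ← Finset.sum_add_distrib]
  refine Finset.sum_congr rfl fun i _ => ?_
  simp [mul_comm]

lemma divergence_comp_add_right (φ : 𝔼 → 𝔼) (t x : 𝔼) :
    divergence (fun y => φ (y + t)) x = divergence φ (x + t) := by
  simp [divergence, fderiv_comp_add_right]

lemma integral_divergence_eq_zero {φ : 𝔼 → 𝔼} (hφ : ContDiff ℝ 1 φ) (hc : HasCompactSupport φ) :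
    ∫ x, divergence φ x = 0 := by
  unfold divergence
  have hcont := hφ.continuous_fderiv (by norm_num)
  have hcs := hc.fderiv (𝕜 := ℝ)
  rw [integral_finsetSum]
  · refine Finset.sum_eq_zero fun i _ => ?_
    have hint : Integrable fun x => fderiv ℝ φ x (EuclideanSpace.single i 1) := by
      refine Continuous.integrable_of_hasCompactSupport (by fun_prop) ?_
      exact hcs.comp_left (g := fun L : 𝔼 →L[ℝ] 𝔼 => L (EuclideanSpace.single i 1)) rfl
    -- Integration by parts against the constant function 1, whose derivative vanishes.
    have h := integral_smul_fderiv_eq_neg_fderiv_smul_of_integrable (𝕜 := ℝ) (μ := volume)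
      (f := fun _ : 𝔼 => (1 : ℝ)) (g := φ) (v := EuclideanSpace.single i 1)
      (by simp) (by simpa using hint)
      (by simpa using hφ.continuous.integrable_of_hasCompactSupport hc)
      (fun _ _ => differentiableAt_const _)
      (fun x _ => (hφ.differentiable (by norm_num)) x)
    simp only [one_smul, fderiv_fun_const, Pi.zero_apply, zero_apply, zero_smul,
      integral_zero, neg_zero] at h
    have h3 := ContinuousLinearMap.integral_comp_comm (EuclideanSpace.proj i : 𝔼 →L[ℝ] ℝ) hint
    rw [h] at h3
    simpa using h3
  · intro i _
    refine Continuous.integrable_of_hasCompactSupport (by fun_prop) ?_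
    exact hcs.comp_left (g := fun L : 𝔼 →L[ℝ] 𝔼 => (L (EuclideanSpace.single i 1)) i) rfl

lemma hasCompactSupport_divergence {φ : 𝔼 → 𝔼} (hc : HasCompactSupport φ) :
    HasCompactSupport (divergence φ) :=
  hc.mono' ((subset_tsupport _).trans (tsupport_divergence_subset φ))

lemma integrable_divergence {φ : 𝔼 → 𝔼} (hφ : ContDiff ℝ 1 φ) (hc : HasCompactSupport φ) :
    Integrable (divergence φ) :=
  (continuous_divergence hφ).integrable_of_hasCompactSupport (hasCompactSupport_divergence hc)

lemma hasCompactSupport_smul_field (w : 𝔼 → ℝ) {φ : 𝔼 → 𝔼} (hc : HasCompactSupport φ) :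
    HasCompactSupport fun x => w x • φ x :=
  hc.mono fun x hx h0 => hx (by simp only [h0, smul_zero])

lemma integral_mul_divergence {w : 𝔼 → ℝ} {φ : 𝔼 → 𝔼} (hw : ContDiff ℝ 1 w)
    (hφ : ContDiff ℝ 1 φ) (hc : HasCompactSupport φ) :
    ∫ x, w x * divergence φ x = - ∫ x, fderiv ℝ w x (φ x) := by
  have h := integral_divergence_eq_zero (φ := fun x => w x • φ x) (hw.smul hφ)
    (hasCompactSupport_smul_field w hc)
  have hwc := hw.continuous_fderiv (by norm_num)
  have hφc := hφ.continuous
  have hdc := continuous_divergence hφ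
  rw [integral_congr_ae (g := fun x => w x * divergence φ x + fderiv ℝ w x (φ x))
    (Eventually.of_forall fun x => divergence_smul (hw.differentiable (by norm_num) x)
      (hφ.differentiable (by norm_num) x)), integral_add] at h
  · linarith
  · exact (hw.continuous.mul hdc).integrable_of_hasCompactSupport
      (hasCompactSupport_divergence hc).mul_left
  · refine Continuous.integrable_of_hasCompactSupport (by fun_prop) ?_
    refine hc.mono' fun x hx => subset_tsupport _ ?_
    intro h0
    simp [h0] at hx

/-! ### Test fields and the total variation of smooth functions -/

lemma setIntegral_mul_divergence_eq {Ω : Set 𝔼} {φ : 𝔼 → 𝔼} (hφ : tsupport φ ⊆ Ω) (u : 𝔼 → ℝ) :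
    ∫ x in Ω, u x * divergence φ x = ∫ x, u x * divergence φ x := by
  refine setIntegral_eq_integral_of_forall_compl_eq_zero fun x hx => ?_
  rw [divergence_eq_zero_of_notMem_tsupport fun h => hx (hφ h), mul_zero]

lemma IsTestField.integrableOn_mul {Ω : Set 𝔼} {φ : 𝔼 → 𝔼} (h : IsTestField Ω φ) {u : 𝔼 → ℝ}
    (hu : IntegrableOn u Ω) : IntegrableOn (fun x => u x * divergence φ x) Ω := by
  obtain ⟨C, hC⟩ := (continuous_divergence h.contDiff).bounded_above_of_compact_support
    (hasCompactSupport_divergence h.hasCompactSupport)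
  exact hu.mul_bdd (c := C) (continuous_divergence h.contDiff).aestronglyMeasurable
    (Eventually.of_forall hC)

lemma IsTestField.le_totalVariation {Ω : Set 𝔼} {φ : 𝔼 → 𝔼} (h : IsTestField Ω φ) (u : 𝔼 → ℝ) :
    ENNReal.ofReal (∫ x in Ω, u x * divergence φ x) ≤ totalVariation Ω u :=
  le_iSup₂ (f := fun (φ : 𝔼 → 𝔼) (_ : IsTestField Ω φ) =>
    ENNReal.ofReal (∫ x in Ω, u x * divergence φ x)) φ h

lemma IsTestField.le_toReal_totalVariation {Ω : Set 𝔼} {φ : 𝔼 → 𝔼} (h : IsTestField Ω φ)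
    {u : 𝔼 → ℝ} (hT : totalVariation Ω u ≠ ⊤) :
    ∫ x in Ω, u x * divergence φ x ≤ (totalVariation Ω u).toReal :=
  (ENNReal.ofReal_le_iff_le_toReal hT).1 (h.le_totalVariation u)

lemma totalVariation_congr_ae {Ω : Set 𝔼} {u v : 𝔼 → ℝ} (h : u =ᵐ[volume.restrict Ω] v) :
    totalVariation Ω u = totalVariation Ω v := by
  unfold totalVariation
  refine iSup_congr fun φ => iSup_congr fun _ => ?_
  congr 1
  refine integral_congr_ae ?_
  filter_upwards [h] with x hx
  rw [hx]

/-- The bound is over the support of φ instead of all of Ω: in the semicontinuity proof this leaves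
a boundary layer, disjoint from that support, free to pay for the trace. -/
lemma IsTestField.ofReal_le_lintegral_fderiv {Ω : Set 𝔼} {φ : 𝔼 → 𝔼} (h : IsTestField Ω φ)
    {w : 𝔼 → ℝ} (hw : ContDiff ℝ 1 w) :
    ENNReal.ofReal (∫ x in Ω, w x * divergence φ x) ≤ ∫⁻ x in tsupport φ, ‖fderiv ℝ w x‖ₑ := by
  rw [setIntegral_mul_divergence_eq h.tsupport_subset,
    integral_mul_divergence hw h.contDiff h.hasCompactSupport]
  have h0 : ∀ x ∉ tsupport φ, fderiv ℝ w x (φ x) = 0 := fun x hx => by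
    rw [image_eq_zero_of_notMem_tsupport hx, map_zero]
  rw [← setIntegral_eq_integral_of_forall_compl_eq_zero h0]
  calc ENNReal.ofReal (-∫ x in tsupport φ, fderiv ℝ w x (φ x))
      ≤ ‖∫ x in tsupport φ, fderiv ℝ w x (φ x)‖ₑ := by
        rw [Real.enorm_eq_ofReal_abs]
        exact ENNReal.ofReal_le_ofReal (neg_le_abs _)
    _ ≤ ∫⁻ x in tsupport φ, ‖fderiv ℝ w x (φ x)‖ₑ := enorm_integral_le_lintegral_enorm _
    _ ≤ ∫⁻ x in tsupport φ, ‖fderiv ℝ w x‖ₑ := by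
        refine lintegral_mono fun x => ?_
        rw [enorm_le_iff_norm_le]
        calc ‖fderiv ℝ w x (φ x)‖ ≤ ‖fderiv ℝ w x‖ * ‖φ x‖ := ContinuousLinearMap.le_opNorm _ _
          _ ≤ ‖fderiv ℝ w x‖ := mul_le_of_le_one_right (norm_nonneg _) (h.norm_le_one x)

lemma totalVariation_le_lintegral_fderiv (Ω : Set 𝔼) {w : 𝔼 → ℝ} (hw : ContDiff ℝ 1 w) :
    totalVariation Ω w ≤ ∫⁻ x in Ω, ‖fderiv ℝ w x‖ₑ :=
  iSup₂_le fun _ hφ => (hφ.ofReal_le_lintegral_fderiv hw).trans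
    (lintegral_mono_set hφ.tsupport_subset)

lemma exists_contDiff_cutoff {C U : Set 𝔼} (hC : IsCompact C) (hU : IsOpen U) (hCU : C ⊆ U) :
    ∃ χ : 𝔼 → ℝ, ContDiff ℝ ((⊤ : ℕ∞) : WithTop ℕ∞) χ ∧ HasCompactSupport χ ∧ tsupport χ ⊆ U ∧
      (∀ x ∈ C, χ x = 1) ∧ ∀ x, χ x ∈ Icc (0 : ℝ) 1 := by
  obtain ⟨K, hK, hCK, hKU⟩ := exists_compact_between hC hU hCU
  obtain ⟨f, h1, h0, h01⟩ := exists_contMDiffMap_one_nhds_of_subset_interior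
    (modelWithCornersSelf ℝ 𝔼) (n := (⊤ : ℕ∞)) hC.isClosed hCK
  have hts : tsupport f ⊆ K := closure_minimal (fun x hx => by
    by_contra h
    exact hx (h0 x h)) hK.isClosed
  exact ⟨f, f.contMDiff.contDiff, hK.of_isClosed_subset (isClosed_tsupport _) hts,
    hts.trans hKU, fun x hx => h1.self_of_nhdsSet x hx, h01⟩

/-- The optimal field -∇w/|∇w| is not admissible where the gradient vanishes, so it is regularized
to -χ∇w/√(|∇w|² + δ²), with χ a cutoff equal to 1 on C. This loses at most δ pointwise on C. Second
derivatives of w are needed for the field to be C¹. -/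
lemma lintegral_fderiv_le_totalVariation {U C : Set 𝔼} (hU : IsOpen U) (hC : IsCompact C)
    (hCU : C ⊆ U) {w : 𝔼 → ℝ} (hw : ContDiff ℝ 2 w) :
    ∫⁻ x in C, ‖fderiv ℝ w x‖ₑ ≤ totalVariation U w := by
  obtain ⟨χ, hχ, hχc, hχU, hχ1, hχ01⟩ := exists_contDiff_cutoff hC hU hCU
  have hgrad : ∀ x v, fderiv ℝ w x v = inner ℝ (gradient w x) v := fun x v => by
    simp [gradient]
  have hnorm : ∀ x, ‖gradient w x‖ = ‖fderiv ℝ w x‖ := fun x => by simp [gradient]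
  have hG : ContDiff ℝ 1 (gradient w) := by
    unfold gradient
    exact (InnerProductSpace.toDual ℝ 𝔼).symm.contDiff.comp (hw.fderiv_right (by norm_num))
  have hGc := hG.continuous
  have hχcont := hχ.continuous
  have key : ∀ δ : ℝ, 0 < δ → ∫⁻ x in C, ‖fderiv ℝ w x‖ₑ
      ≤ totalVariation U w + ENNReal.ofReal δ * volume C := by
    intro δ hδ
    set q : 𝔼 → ℝ := fun x => Real.sqrt (‖gradient w x‖ ^ 2 + δ ^ 2) with hq
    have hqpos : ∀ x, 0 < q x := fun x => Real.sqrt_pos.2 (by positivity)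
    have hqge : ∀ x, ‖gradient w x‖ ≤ q x := fun x =>
      Real.le_sqrt_of_sq_le (by nlinarith [sq_nonneg δ])
    have hqd : ContDiff ℝ 1 q :=
      ((hG.norm_sq ℝ).add contDiff_const).sqrt fun x => by positivity
    set φ : 𝔼 → 𝔼 := fun x => (-(χ x / q x)) • gradient w x with hφdef
    have hφc : HasCompactSupport φ := by
      refine hχc.mono fun x hx h0 => hx ?_
      rw [hφdef]
      simp only [h0, zero_div, neg_zero, zero_smul]
    have hφs : tsupport φ ⊆ U := by
      refine Subset.trans (closure_mono ?_) hχU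
      intro x hx h0
      exact hx (by rw [hφdef]; simp only [h0, zero_div, neg_zero, zero_smul])
    have hφ : IsTestField U φ := by
      refine ⟨?_, hφc, hφs, fun x => ?_⟩
      · exact ((((hχ.of_le (by exact_mod_cast le_top)).div hqd fun x => (hqpos x).ne')).neg).smul hG
      · rw [hφdef]
        simp only [norm_smul, norm_neg, norm_div, Real.norm_eq_abs, abs_of_pos (hqpos x),
          abs_of_nonneg (hχ01 x).1]
        rw [div_mul_eq_mul_div, div_le_one (hqpos x)]
        calc χ x * ‖gradient w x‖ ≤ 1 * q x := by
              gcongr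
              · exact (hχ01 x).2
              · exact hqge x
          _ = q x := one_mul _
    have h1 := hφ.le_totalVariation w
    rw [setIntegral_mul_divergence_eq hφs, integral_mul_divergence (hw.of_le (by norm_num))
      hφ.contDiff hφc, ← integral_neg] at h1
    have h2 : ∀ x, -(fderiv ℝ w x (φ x)) = χ x * (‖gradient w x‖ ^ 2 / q x) := by
      intro x
      rw [hgrad, hφdef]
      simp only [inner_smul_right, real_inner_self_eq_norm_sq]
      ring
    simp only [h2] at h1
    have hqcont := hqd.continuous
    have hnn : ∀ x, 0 ≤ χ x * (‖gradient w x‖ ^ 2 / q x) := fun x =>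
      mul_nonneg (hχ01 x).1 (div_nonneg (by positivity) (hqpos x).le)
    rw [ofReal_integral_eq_lintegral_ofReal] at h1
    · calc ∫⁻ x in C, ‖fderiv ℝ w x‖ₑ
          ≤ ∫⁻ x in C, (ENNReal.ofReal (χ x * (‖gradient w x‖ ^ 2 / q x)) + ENNReal.ofReal δ) := by
            refine setLIntegral_mono' hC.measurableSet fun x hx => ?_
            rw [hχ1 x hx, one_mul, ← ENNReal.ofReal_add (div_nonneg (by positivity) (hqpos x).le)
              hδ.le, ← ofReal_norm, ← hnorm]
            refine ENNReal.ofReal_le_ofReal ?_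
            -- What remains is (|∇w| - δ) q ≤ |∇w|². It is trivial if |∇w| ≤ δ, and otherwise
            -- follows from q ≤ |∇w| + δ.
            rw [← sub_le_iff_le_add, le_div_iff₀ (hqpos x)]
            have h3 : q x ≤ ‖gradient w x‖ + δ := by
              refine Real.sqrt_le_iff.2 ⟨by positivity, ?_⟩
              nlinarith [norm_nonneg (gradient w x)]
            have h4 := hqge x
            by_cases h5 : ‖gradient w x‖ ≤ δ
            · nlinarith [hqpos x, sq_nonneg ‖gradient w x‖]
            · nlinarith [hqpos x, sq_nonneg δ]
        _ = (∫⁻ x in C, ENNReal.ofReal (χ x * (‖gradient w x‖ ^ 2 / q x)))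
              + ENNReal.ofReal δ * volume C := by
            rw [lintegral_add_right _ measurable_const]
            simp
        _ ≤ _ := by
            gcongr
            exact (setLIntegral_le_lintegral _ _).trans h1
    · refine Continuous.integrable_of_hasCompactSupport ?_ ?_
      · exact hχcont.mul ((hGc.norm.pow 2).div hqcont fun x => (hqpos x).ne')
      · exact hχc.mul_right
    · exact Eventually.of_forall hnn
  have hlim : Tendsto (fun n : ℕ => totalVariation U w +
      ENNReal.ofReal (1 / ((n : ℝ) + 1)) * volume C) atTop (𝓝 (totalVariation U w)) := by
    have h1 : Tendsto (fun n : ℕ => ENNReal.ofReal (1 / ((n : ℝ) + 1))) atTop (𝓝 0) := by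
      simpa using ENNReal.tendsto_ofReal tendsto_one_div_add_atTop_nhds_zero_nat
    have h2 := ENNReal.Tendsto.mul_const (b := volume C) h1 (Or.inr hC.measure_lt_top.ne)
    simpa using h2.const_add (totalVariation U w)
  exact ge_of_tendsto' hlim fun n => key _ (by positivity)

/-! ### Mollification -/

/-- A smooth bump around the origin of radius `1 / (k + 1)`. -/
def bump (N k : ℕ) : ContDiffBump (0 : EuclideanSpace ℝ (Fin N)) where
  rIn := 1 / (k + 1) / 2
  rOut := 1 / (k + 1)
  rIn_pos := by positivity
  rIn_lt_rOut := half_lt_self (by positivity)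

/-- The mollification of `u` at scale `1 / (k + 1)`. -/
def mollify (k : ℕ) (u : 𝔼 → ℝ) : 𝔼 → ℝ :=
  (bump N k).normed volume ⋆[ContinuousLinearMap.lsmul ℝ ℝ, volume] u

lemma bump_rOut (k : ℕ) : (bump N k).rOut = 1 / ((k : ℝ) + 1) := rfl

lemma tendsto_bump_rOut : Tendsto (fun k => (bump N k).rOut) atTop (𝓝 0) :=
  tendsto_one_div_add_atTop_nhds_zero_nat

lemma mollify_apply (k : ℕ) (u : 𝔼 → ℝ) (x : 𝔼) :
    mollify k u x = ∫ t, (bump N k).normed volume t * u (x - t) := by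
  simp [mollify, convolution_def]

lemma contDiff_mollify (k : ℕ) {u : 𝔼 → ℝ} (hu : LocallyIntegrable u) :
    ContDiff ℝ ((⊤ : ℕ∞) : WithTop ℕ∞) (mollify k u) :=
  (bump N k).hasCompactSupport_normed.contDiff_convolution_left _ (bump N k).contDiff_normed hu

lemma ae_tendsto_mollify {u : 𝔼 → ℝ} (hu : LocallyIntegrable u) :
    ∀ᵐ x, Tendsto (fun k => mollify k u x) atTop (𝓝 (u x)) := by
  refine ContDiffBump.ae_convolution_tendsto_right_of_locallyIntegrable (K := 2)
    tendsto_bump_rOut (Eventually.of_forall fun k => ?_) hu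
  simp only [bump]
  linarith

lemma abs_mollify_le (k : ℕ) {u : 𝔼 → ℝ} {M : ℝ} (hM : ∀ x, |u x| ≤ M) (x : 𝔼) :
    |mollify k u x| ≤ M := by
  rw [mollify_apply, ← Real.norm_eq_abs]
  refine (norm_integral_le_of_norm_le (g := fun t => (bump N k).normed volume t * M)
    ((bump N k).integrable_normed.mul_const M) (Eventually.of_forall fun t => ?_)).trans ?_
  · rw [norm_mul, Real.norm_of_nonneg ((bump N k).nonneg_normed t)]
    exact mul_le_mul_of_nonneg_left (hM _) ((bump N k).nonneg_normed t)
  · rw [integral_mul_const, (bump N k).integral_normed, one_mul]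

lemma integrable_bump_mul (k : ℕ) {u : 𝔼 → ℝ} (hu : LocallyIntegrable u) (x : 𝔼) :
    Integrable fun t => (bump N k).normed volume t * u (x - t) := by
  have := ((bump N k).hasCompactSupport_normed (μ := volume)).convolutionExists_left
    (ContinuousLinearMap.lsmul ℝ ℝ) ((bump N k).continuous_normed (μ := volume)) hu x
  simpa [ConvolutionExistsAt] using this

lemma lipschitz_mollify (k : ℕ) {f : 𝔼 → ℝ} {K : ℝ≥0} (hf : LipschitzWith K f) :
    LipschitzWith K (mollify k f) := by
  refine LipschitzWith.of_dist_le_mul fun x y => ?_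
  have hl := hf.continuous.locallyIntegrable (μ := (volume : Measure 𝔼))
  rw [Real.dist_eq, mollify_apply, mollify_apply,
    ← integral_sub (integrable_bump_mul k hl x) (integrable_bump_mul k hl y), ← Real.norm_eq_abs]
  refine (norm_integral_le_of_norm_le (g := fun t => (bump N k).normed volume t * (K * dist x y))
    ((bump N k).integrable_normed.mul_const _) (Eventually.of_forall fun t => ?_)).trans ?_
  · rw [← mul_sub, norm_mul, Real.norm_of_nonneg ((bump N k).nonneg_normed t)]
    refine mul_le_mul_of_nonneg_left ?_ ((bump N k).nonneg_normed t)
    have := hf.dist_le_mul (x - t) (y - t)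
    rwa [Real.dist_eq, dist_sub_right] at this
  · rw [integral_mul_const, (bump N k).integral_normed, one_mul]

lemma mollify_eq_of_eqOn_ball (k : ℕ) {f : 𝔼 → ℝ} {x : 𝔼} {c : ℝ}
    (h : ∀ y ∈ ball x (1 / ((k : ℝ) + 1)), f y = c) : mollify k f x = c := by
  have hx : f x = c := h x (mem_ball_self (by positivity))
  rw [← hx] at h ⊢
  exact (bump N k).normed_convolution_eq_right h

lemma mollify_mem_Icc (k : ℕ) {f : 𝔼 → ℝ} {a b : ℝ} (hl : LocallyIntegrable f)
    (h : ∀ x, f x ∈ Icc a b) (x : 𝔼) : mollify k f x ∈ Icc a b := by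
  have hi := integrable_bump_mul k hl x
  have hc : ∀ c : ℝ, ∫ t, (bump N k).normed volume t * c = c := fun c => by
    rw [integral_mul_const, (bump N k).integral_normed, one_mul]
  rw [mollify_apply]
  constructor
  · rw [← hc a]
    exact integral_mono ((bump N k).integrable_normed.mul_const _) hi fun t =>
      mul_le_mul_of_nonneg_left (h _).1 ((bump N k).nonneg_normed t)
  · rw [← hc b]
    exact integral_mono hi ((bump N k).integrable_normed.mul_const _) fun t =>
      mul_le_mul_of_nonneg_left (h _).2 ((bump N k).nonneg_normed t)

lemma IsTestField.comp_add_right {U Ω : Set 𝔼} {φ : 𝔼 → 𝔼} (h : IsTestField U φ) {t : 𝔼}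
    (ht : ∀ x ∈ U, x - t ∈ Ω) : IsTestField Ω fun y => φ (y + t) := by
  have hts : tsupport (fun y => φ (y + t)) = (fun y => y + t) ⁻¹' tsupport φ :=
    tsupport_comp_eq_preimage φ (Homeomorph.addRight t)
  refine ⟨h.contDiff.comp (contDiff_id.add contDiff_const),
    h.hasCompactSupport.comp_homeomorph (Homeomorph.addRight t), ?_, fun x => h.norm_le_one _⟩
  rw [hts]
  intro y hy
  simpa using ht _ (h.tsupport_subset hy)

/-- A mollification is an average of translates. Fubini moves the translation onto the test field,
and a field supported in U, moved by less than 1/(k+1), is still supported in Ω. -/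
lemma totalVariation_mollify_le {U Ω : Set 𝔼} (k : ℕ) {u : 𝔼 → ℝ} (hu : Integrable u)
    (hU : ∀ x ∈ U, ball x (1 / ((k : ℝ) + 1)) ⊆ Ω) :
    totalVariation U (mollify k u) ≤ totalVariation Ω u := by
  by_cases hT : totalVariation Ω u = ⊤
  · simp [hT]
  refine iSup₂_le fun φ hφ => ?_
  rw [setIntegral_mul_divergence_eq hφ.tsupport_subset]
  refine ENNReal.ofReal_le_of_le_toReal ?_
  set η := (bump N k).normed (volume : Measure 𝔼) with hη
  have hηi : Integrable η := (bump N k).integrable_normed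
  obtain ⟨C, hC⟩ := (continuous_divergence hφ.contDiff).bounded_above_of_compact_support
    (hasCompactSupport_divergence hφ.hasCompactSupport)
  have hdc := continuous_divergence hφ.contDiff
  have hint : Integrable (fun p : 𝔼 × 𝔼 => (η p.2 * u (p.1 - p.2)) * divergence φ p.1)
      (volume.prod volume) := by
    have h1 := Integrable.convolution_integrand (ContinuousLinearMap.lsmul ℝ ℝ) hηi hu
    simp only [ContinuousLinearMap.lsmul_apply, smul_eq_mul] at h1
    exact h1.mul_bdd (c := C) (hdc.comp continuous_fst).aestronglyMeasurable
      (Eventually.of_forall fun p => hC p.1)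
  have hswap : ∫ x, mollify k u x * divergence φ x =
      ∫ t, η t * ∫ y, u y * divergence φ (y + t) := by
    calc ∫ x, mollify k u x * divergence φ x
        = ∫ x, ∫ t, (η t * u (x - t)) * divergence φ x := by
          refine integral_congr_ae (Eventually.of_forall fun x => ?_)
          simp only [mollify_apply, integral_mul_const, hη]
      _ = ∫ t, ∫ x, (η t * u (x - t)) * divergence φ x := integral_integral_swap hint
      _ = ∫ t, η t * ∫ y, u y * divergence φ (y + t) := by
          refine integral_congr_ae (Eventually.of_forall fun t => ?_)
          simp only [mul_assoc, integral_const_mul]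
          rw [← integral_add_right_eq_self (fun x => u (x - t) * divergence φ x) t]
          simp
  have hint2 : Integrable fun t => η t * ∫ y, u y * divergence φ (y + t) := by
    refine hint.integral_prod_right.congr (Eventually.of_forall fun t => ?_)
    simp only [mul_assoc, integral_const_mul]
    rw [← integral_add_right_eq_self (fun x => u (x - t) * divergence φ x) t]
    simp
  rw [hswap]
  calc ∫ t, η t * ∫ y, u y * divergence φ (y + t)
      ≤ ∫ t, η t * (totalVariation Ω u).toReal := by
        refine integral_mono hint2 (hηi.mul_const _) fun t => ?_
        by_cases ht : η t = 0
        · simp [ht]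
        refine mul_le_mul_of_nonneg_left ?_ ((bump N k).nonneg_normed t)
        have htb : t ∈ ball (0 : 𝔼) (1 / ((k : ℝ) + 1)) := by
          have : t ∈ support η := ht
          rwa [hη, (bump N k).support_normed_eq] at this
        have hφt : IsTestField Ω fun y => φ (y + t) := hφ.comp_add_right fun x hx =>
          hU x hx (by simpa [dist_eq_norm] using htb)
        have := hφt.le_toReal_totalVariation hT
        rw [setIntegral_mul_divergence_eq hφt.tsupport_subset] at this
        simpa only [divergence_comp_add_right] using this
    _ = (totalVariation Ω u).toReal := by
        rw [integral_mul_const, hη, (bump N k).integral_normed, one_mul]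

/-- The δ/2-thickening of C fits between C and Ω: the gradient mass on C is at most the variation on
the thickening, and that is at most the variation of u on Ω once the mollification radius is below
δ/2. -/
lemma eventually_lintegral_fderiv_mollify_le {Ω C : Set 𝔼} (hΩ : IsOpen Ω) (hC : IsCompact C)
    (hCΩ : C ⊆ Ω) {u : 𝔼 → ℝ} (hu : Integrable u) :
    ∀ᶠ k in atTop, ∫⁻ x in C, ‖fderiv ℝ (mollify k u) x‖ₑ ≤ totalVariation Ω u := by
  obtain ⟨δ, hδ, hδΩ⟩ := hC.exists_thickening_subset_open hΩ hCΩ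
  have h0 := (tendsto_bump_rOut (N := N)).eventually (gt_mem_nhds (half_pos hδ))
  filter_upwards [h0] with k hk
  refine (lintegral_fderiv_le_totalVariation (U := thickening (δ / 2) C) isOpen_thickening hC
    (self_subset_thickening (half_pos hδ) C) (by exact_mod_cast
      (contDiff_infty.1 (contDiff_mollify k hu.locallyIntegrable)) 2)).trans (totalVariation_mollify_le k hu fun x hx y hy => hδΩ ?_)
  rw [mem_thickening_iff] at hx ⊢
  obtain ⟨z, hz, hxz⟩ := hx
  refine ⟨z, hz, ?_⟩
  rw [mem_ball] at hy
  rw [bump_rOut] at hk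
  linarith [dist_triangle y x z]

lemma totalVariation_indicator (Ω : Set 𝔼) (hΩ : MeasurableSet Ω) (u : 𝔼 → ℝ) :
    totalVariation Ω (Ω.indicator u) = totalVariation Ω u :=
  totalVariation_congr_ae (by
    filter_upwards [self_mem_ae_restrict hΩ] with x hx
    rw [indicator_of_mem hx])

/-- Local smooth approximation of an integrable function, with control of the total variation. -/
lemma exists_contDiff_approx {Ω : Set 𝔼} (hΩ : IsOpen Ω) {u : 𝔼 → ℝ} (hu : IntegrableOn u Ω) :
    ∃ w : ℕ → 𝔼 → ℝ, (∀ k, ContDiff ℝ ((⊤ : ℕ∞) : WithTop ℕ∞) (w k)) ∧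
      (∀ᵐ x ∂(volume.restrict Ω), Tendsto (fun k => w k x) atTop (𝓝 (u x))) ∧
      ∀ C, IsCompact C → C ⊆ Ω →
        ∀ᶠ k in atTop, ∫⁻ x in C, ‖fderiv ℝ (w k) x‖ₑ ≤ totalVariation Ω u := by
  have hi : Integrable (Ω.indicator u) := hu.integrable_indicator hΩ.measurableSet
  refine ⟨fun k => mollify k (Ω.indicator u), fun k => contDiff_mollify k hi.locallyIntegrable,
    ?_, fun C hC hCΩ => ?_⟩
  · filter_upwards [ae_restrict_of_ae (ae_tendsto_mollify hi.locallyIntegrable),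
      self_mem_ae_restrict hΩ.measurableSet] with x hx hxΩ
    rwa [indicator_of_mem hxΩ] at hx
  · rw [← totalVariation_indicator Ω hΩ.measurableSet u]
    exact eventually_lintegral_fderiv_mollify_le hΩ hC hCΩ hi

/-! ### Operations on functions of bounded variation -/

/-- Composition with a bounded smooth contraction does not increase the total variation. -/
lemma totalVariation_comp_le {Ω : Set 𝔼} (hΩ : IsOpen Ω) (hΩb : Bornology.IsBounded Ω)
    {u : 𝔼 → ℝ} (hu : IntegrableOn u Ω) {f : ℝ → ℝ}
    (hf : ContDiff ℝ 1 f) (hf' : ∀ s, |deriv f s| ≤ 1) {M : ℝ} (hM : ∀ s, |f s| ≤ M) :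
    totalVariation Ω (fun x => f (u x)) ≤ totalVariation Ω u := by
  obtain ⟨w, hw, hwu, hwC⟩ := exists_contDiff_approx hΩ hu
  have : IsFiniteMeasure (volume.restrict Ω) := ⟨by simpa using hΩb.measure_lt_top⟩
  refine iSup₂_le fun φ hφ => ?_
  -- Since f is bounded, almost everywhere convergence of the approximations is enough for dominated
  -- convergence.
  have hlim : Tendsto (fun k => ∫ x in Ω, f (w k x) * divergence φ x) atTop
      (𝓝 (∫ x in Ω, f (u x) * divergence φ x)) := by
    have hdi := (integrable_divergence hφ.contDiff hφ.hasCompactSupport).integrableOn (s := Ω)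
    refine tendsto_integral_of_dominated_convergence (fun x => M * ‖divergence φ x‖) (fun k => ?_)
      (hdi.norm.const_mul M) (fun k => Eventually.of_forall fun x => ?_) ?_
    · exact ((hf.continuous.comp (hw k).continuous).mul
        (continuous_divergence hφ.contDiff)).aestronglyMeasurable
    · rw [norm_mul]
      exact mul_le_mul_of_nonneg_right (hM _) (norm_nonneg _)
    · filter_upwards [hwu] with x hx
      exact ((hf.continuous.tendsto _).comp hx).mul_const _
  refine le_of_tendsto (ENNReal.tendsto_ofReal hlim) ?_
  filter_upwards [hwC _ hφ.hasCompactSupport hφ.tsupport_subset] with k hk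
  have hfw : ContDiff ℝ 1 fun x => f (w k x) := hf.comp ((hw k).of_le (by exact_mod_cast le_top))
  refine (hφ.ofReal_le_lintegral_fderiv hfw).trans (le_trans (lintegral_mono fun x => ?_) hk)
  have hd : DifferentiableAt ℝ (w k) x := (hw k).differentiable (by simp) x
  have hfd : DifferentiableAt ℝ f (w k x) := hf.differentiable (by norm_num) _
  have heq : fderiv ℝ (fun x => f (w k x)) x = deriv f (w k x) • fderiv ℝ (w k) x :=
    (hfd.hasDerivAt.comp_hasFDerivAt x hd.hasFDerivAt).fderiv
  rw [heq, enorm_le_iff_norm_le, norm_smul]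
  exact mul_le_of_le_one_left (norm_nonneg _) (hf' _)

lemma totalVariation_const_mul (Ω : Set 𝔼) (c : ℝ) (u : 𝔼 → ℝ) :
    totalVariation Ω (fun x => c * u x) ≤ ENNReal.ofReal |c| * totalVariation Ω u := by
  refine iSup₂_le fun φ hφ => ?_
  have hs : ∀ ψ : 𝔼 → 𝔼, IsTestField Ω ψ → IsTestField Ω fun x => -ψ x := fun ψ h =>
    ⟨h.contDiff.neg, h.hasCompactSupport.neg, by
      have : tsupport (fun x => -ψ x) = tsupport ψ := by
        simp [tsupport, Function.support_fun_neg]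
      rw [this]; exact h.tsupport_subset, fun x => by simpa using h.norm_le_one x⟩
  have hdn : ∀ x, divergence (fun x => -φ x) x = - divergence φ x := fun x => by
    simp [divergence, fderiv_fun_neg]
  simp only [mul_assoc, integral_const_mul]
  rcases le_total 0 c with hc | hc
  · rw [ENNReal.ofReal_mul hc, abs_of_nonneg hc]
    gcongr
    exact hφ.le_totalVariation u
  · have h1 : c * ∫ x in Ω, u x * divergence φ x =
        -c * ∫ x in Ω, u x * divergence (fun x => -φ x) x := by
      simp only [hdn, mul_neg, integral_neg]
      ring
    rw [h1, ENNReal.ofReal_mul (neg_nonneg.2 hc), abs_of_nonpos hc]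
    gcongr
    exact (hs φ hφ).le_totalVariation u

/-- Product rule for the total variation, with a smooth cutoff. -/
lemma totalVariation_mul_le {Ω : Set 𝔼} {u χ : 𝔼 → ℝ} (hu : IntegrableOn u Ω)
    (hχ : ContDiff ℝ 1 χ) (hχ01 : ∀ x, χ x ∈ Icc (0 : ℝ) 1) :
    totalVariation Ω (fun x => χ x * u x) ≤
      totalVariation Ω u + ∫⁻ x in Ω, ‖u x‖ₑ * ‖fderiv ℝ χ x‖ₑ := by
  refine iSup₂_le fun φ hφ => ?_
  set ψ : 𝔼 → 𝔼 := fun x => χ x • φ x with hψ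
  have hts : tsupport ψ ⊆ tsupport φ := closure_mono fun x hx h0 => hx (by
    simp only [hψ, h0, smul_zero])
  have hψt : IsTestField Ω ψ := by
    refine ⟨hχ.smul hφ.contDiff, hasCompactSupport_smul_field χ hφ.hasCompactSupport,
      hts.trans hφ.tsupport_subset, fun x => ?_⟩
    rw [hψ]
    simp only [norm_smul, Real.norm_eq_abs, abs_of_nonneg (hχ01 x).1]
    exact mul_le_one₀ (hχ01 x).2 (norm_nonneg _) (hφ.norm_le_one x)
  have hfc := hχ.continuous_fderiv (by norm_num)
  have hφc := hφ.contDiff.continuous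
  have hcs : HasCompactSupport fun x => fderiv ℝ χ x (φ x) := by
    refine hφ.hasCompactSupport.mono fun x hx h0 => hx ?_
    simp only [h0, map_zero]
  have hcont : Continuous fun x => fderiv ℝ χ x (φ x) := by fun_prop
  obtain ⟨C, hC⟩ := hcont.bounded_above_of_compact_support hcs
  have hi2 : IntegrableOn (fun x => u x * fderiv ℝ χ x (φ x)) Ω :=
    hu.mul_bdd (c := C) hcont.aestronglyMeasurable (Eventually.of_forall hC)
  have hsplit : ∫ x in Ω, (χ x * u x) * divergence φ x =
      (∫ x in Ω, u x * divergence ψ x) - ∫ x in Ω, u x * fderiv ℝ χ x (φ x) := by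
    rw [← integral_sub (hψt.integrableOn_mul hu) hi2]
    refine integral_congr_ae (Eventually.of_forall fun x => ?_)
    simp only [hψ]
    rw [divergence_smul (hχ.differentiable (by norm_num) x)
      (hφ.contDiff.differentiable (by norm_num) x)]
    ring
  rw [hsplit, sub_eq_add_neg]
  refine ENNReal.ofReal_add_le.trans (add_le_add (hψt.le_totalVariation u) ?_)
  calc ENNReal.ofReal (-∫ x in Ω, u x * fderiv ℝ χ x (φ x))
      ≤ ‖∫ x in Ω, u x * fderiv ℝ χ x (φ x)‖ₑ := by
        rw [Real.enorm_eq_ofReal_abs]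
        exact ENNReal.ofReal_le_ofReal (neg_le_abs _)
    _ ≤ ∫⁻ x in Ω, ‖u x * fderiv ℝ χ x (φ x)‖ₑ := enorm_integral_le_lintegral_enorm _
    _ ≤ ∫⁻ x in Ω, ‖u x‖ₑ * ‖fderiv ℝ χ x‖ₑ := by
        refine lintegral_mono fun x => ?_
        rw [enorm_mul]
        gcongr
        rw [enorm_le_iff_norm_le]
        calc ‖fderiv ℝ χ x (φ x)‖ ≤ ‖fderiv ℝ χ x‖ * ‖φ x‖ := ContinuousLinearMap.le_opNorm _ _
          _ ≤ ‖fderiv ℝ χ x‖ := mul_le_of_le_one_right (norm_nonneg _) (hφ.norm_le_one x)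

/-- Smoothing of a bounded function of bounded variation with compact support in `Ω`. -/
lemma exists_isTestFunction_approx_of_compact {Ω C : Set 𝔼} (hΩ : IsOpen Ω) (hC : IsCompact C)
    (hCΩ : C ⊆ Ω) {w : 𝔼 → ℝ} (hw : AEStronglyMeasurable w) (hwC : ∀ x ∉ C, w x = 0)
    {M : ℝ} (hM : ∀ x, |w x| ≤ M) :
    ∃ ψ : ℕ → 𝔼 → ℝ, (∀ k, IsTestFunction Ω (ψ k)) ∧
      Tendsto (fun k => ∫⁻ x in Ω, ‖ψ k x - w x‖ₑ) atTop (𝓝 0) ∧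
      ∀ k, ∫⁻ x in Ω, ‖fderiv ℝ (ψ k) x‖ₑ ≤ totalVariation Ω w := by
  obtain ⟨K, hK, hCK, hKΩ⟩ := exists_compact_between hC hΩ hCΩ
  have hwi : Integrable w := by
    refine (Measure.integrableOn_of_bounded (s := C) (M := M) hC.measure_lt_top.ne hw
      (Eventually.of_forall hM)).integrable_of_forall_notMem_eq_zero hwC
  obtain ⟨δ, hδ, hδK⟩ := hC.exists_thickening_subset_open isOpen_interior hCK
  have hM0 : 0 ≤ M := (abs_nonneg _).trans (hM 0)
  have h0 := (tendsto_bump_rOut (N := N)).eventually (gt_mem_nhds hδ)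
  obtain ⟨k₀, hk₀⟩ := eventually_atTop.1
    ((eventually_lintegral_fderiv_mollify_le hΩ hK hKΩ hwi).and h0)
  have hzero : ∀ k ≥ k₀, ∀ x ∉ K, mollify k w x = 0 := by
    intro k hk x hx
    refine mollify_eq_of_eqOn_ball k fun y hy => hwC y fun hyC => hx (interior_subset (hδK ?_))
    rw [mem_thickening_iff]
    refine ⟨y, hyC, ?_⟩
    rw [mem_ball, dist_comm] at hy
    exact hy.trans (hk₀ k hk).2
  have hts : ∀ k ≥ k₀, tsupport (mollify k w) ⊆ K := fun k hk =>
    closure_minimal (fun x hx => by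
      by_contra h
      exact hx (hzero k hk x h)) hK.isClosed
  refine ⟨fun k => mollify (k + k₀) w, fun k => ?_, ?_, fun k => ?_⟩
  · exact ⟨contDiff_mollify _ hwi.locallyIntegrable,
      hK.of_isClosed_subset (isClosed_tsupport _) (hts _ (by omega)),
      (hts _ (by omega)).trans hKΩ⟩
  · have hb : ∀ k x, ‖mollify (k + k₀) w x - w x‖ₑ ≤ K.indicator (fun _ => ENNReal.ofReal (2 * M)) x := by
      intro k x
      by_cases hx : x ∈ K
      · rw [indicator_of_mem hx, Real.enorm_eq_ofReal_abs]
        refine ENNReal.ofReal_le_ofReal ((abs_sub _ _).trans ?_)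
        linarith [abs_mollify_le (k + k₀) hM x, hM x]
      · have hxC : x ∉ C := fun h => hx (interior_subset (hCK h))
        rw [hzero _ (by omega) x hx, hwC x hxC]
        simp
    have hlim : Tendsto (fun k => ∫⁻ x in Ω, ‖mollify (k + k₀) w x - w x‖ₑ) atTop
        (𝓝 (∫⁻ x in Ω, 0)) := by
      refine tendsto_lintegral_of_dominated_convergence'
        (K.indicator (fun _ => ENNReal.ofReal (2 * M))) (fun k => ?_)
        (fun k => Eventually.of_forall (hb k)) ?_ ?_
      · exact (((contDiff_mollify _ hwi.locallyIntegrable).continuous.aestronglyMeasurable.sub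
          hw).enorm).restrict
      · refine ne_of_lt ((setLIntegral_le_lintegral _ _).trans_lt ?_)
        rw [lintegral_indicator hK.measurableSet, lintegral_const, Measure.restrict_apply_univ]
        exact ENNReal.mul_lt_top ENNReal.ofReal_lt_top
          (hK.measure_lt_top (μ := (volume : Measure 𝔼)))
      · filter_upwards [ae_restrict_of_ae (ae_tendsto_mollify hwi.locallyIntegrable)] with x hx
        have h1 := (hx.comp (tendsto_add_atTop_nat k₀)).sub_const (w x)
        rw [sub_self] at h1
        simpa using h1.enorm
    simpa using hlim
  · refine le_trans ?_ (hk₀ (k + k₀) (by omega)).1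
    rw [← lintegral_indicator hΩ.measurableSet, ← lintegral_indicator hK.measurableSet]
    refine lintegral_mono fun x => ?_
    by_cases hx : x ∈ K
    · rw [indicator_of_mem hx]
      exact indicator_le_self' (fun _ _ => bot_le) _
    · have : fderiv ℝ (mollify (k + k₀) w) x = 0 := by
        by_contra h
        exact hx (hts _ (by omega) (support_fderiv_subset ℝ h))
      have h0 : ‖fderiv ℝ (mollify (k + k₀) w) x‖ₑ = 0 := by
        rw [this, ← ofReal_norm, norm_zero, ENNReal.ofReal_zero]
      by_cases hxΩ : x ∈ Ω <;> simp [hx, hxΩ, h0]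

/-! ### One-dimensional limits -/

lemma sum_lintegral_Ioc (γ : ℝ → ℝ≥0∞) {u : ℕ → ℝ} (hu : Monotone u) (n : ℕ) :
    ∑ i ∈ Finset.range n, ∫⁻ τ in Ioc (u i) (u (i + 1)), γ τ = ∫⁻ τ in Ioc (u 0) (u n), γ τ := by
  induction n with
  | zero => simp
  | succ n ih =>
    rw [Finset.sum_range_succ, ih, ← lintegral_union measurableSet_Ioc,
      Ioc_union_Ioc_eq_Ioc (hu (Nat.zero_le n)) (hu (Nat.le_succ n))]
    exact Set.disjoint_left.2 fun x hx hx' => not_lt_of_ge hx.2 hx'.1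

/-- Every finite sum of increments along points of A is the limit of the same sums for φ_k, and
these are bounded by the integral of γ_k between the extreme points. The lower limit 1/(k+1) appears
because gradient bounds for the approximations hold only at a positive distance from the boundary;
it eventually lies below any given partition. -/
lemma eVariationOn_le_liminf {φ : ℕ → ℝ → ℝ} {φ' : ℝ → ℝ} {γ : ℕ → ℝ → ℝ≥0∞} {A : Set ℝ} {H : ℝ}
    (hA : A ⊆ Ioo 0 H) (hlim : ∀ s ∈ A, Tendsto (fun k => φ k s) atTop (𝓝 (φ' s)))
    (hφ : ∀ k s t, 0 < s → s ≤ t → t < H → ‖φ k t - φ k s‖ₑ ≤ ∫⁻ τ in Ioc s t, γ k τ) :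
    eVariationOn φ' A ≤ liminf (fun k : ℕ => ∫⁻ τ in Ioo (1 / ((k : ℝ) + 1)) H, γ k τ) atTop := by
  refine iSup_le fun ⟨n, u, hu, huA⟩ => ?_
  have h1 : Tendsto (fun k => ∑ i ∈ Finset.range n, edist (φ k (u (i + 1))) (φ k (u i))) atTop
      (𝓝 (∑ i ∈ Finset.range n, edist (φ' (u (i + 1))) (φ' (u i)))) :=
    tendsto_finsetSum _ fun i _ => (hlim _ (huA _)).edist (hlim _ (huA _))
  change ∑ i ∈ Finset.range n, edist (φ' (u (i + 1))) (φ' (u i)) ≤ _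
  rw [← h1.liminf_eq]
  refine liminf_le_liminf ?_
  filter_upwards [tendsto_one_div_add_atTop_nhds_zero_nat.eventually
    (gt_mem_nhds (hA (huA 0)).1)] with k hk
  calc ∑ i ∈ Finset.range n, edist (φ k (u (i + 1))) (φ k (u i))
      ≤ ∑ i ∈ Finset.range n, ∫⁻ τ in Ioc (u i) (u (i + 1)), γ k τ := by
        refine Finset.sum_le_sum fun i _ => ?_
        rw [edist_eq_enorm_sub]
        exact hφ k _ _ (hA (huA _)).1 (hu (Nat.le_succ i)) (hA (huA _)).2
    _ = ∫⁻ τ in Ioc (u 0) (u n), γ k τ := sum_lintegral_Ioc _ hu n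
    _ ≤ ∫⁻ τ in Ioo (1 / ((k : ℝ) + 1)) H, γ k τ :=
        lintegral_mono_set fun x hx => ⟨hk.trans hx.1, hx.2.trans_lt (hA (huA n)).2⟩

/-- A function of bounded variation on A has a limit l at 0 from the right along A, and deviates
from l by at most its variation. As A has full measure, both facts pass to averages over (0, h). -/
lemma exists_limit_zero_of_eVariationOn {φ : ℝ → ℝ} {A : Set ℝ} {H : ℝ} (hH : 0 < H)
    (hA : A ⊆ Ioo 0 H) (hAf : ∀ᵐ s ∂(volume.restrict (Ioo 0 H)), s ∈ A) {V : ℝ≥0∞}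
    (hV : eVariationOn φ A ≤ V) (hVt : V ≠ ⊤) :
    ∃ l : ℝ, Tendsto (fun h => (∫⁻ s in Ioo 0 h, ‖φ s - l‖ₑ) / ENNReal.ofReal h) (𝓝[>] 0) (𝓝 0) ∧
      ∀ h ≤ H, ∫⁻ s in Ioo 0 h, ‖φ s - l‖ₑ ≤ V * ENNReal.ofReal h := by
  have hbv : BoundedVariationOn φ A := (hV.trans_lt (lt_top_iff_ne_top.2 hVt)).ne
  obtain ⟨l, hl⟩ := hbv.exists_tendsto_right 0
  have hA0 : A ∩ Ioi 0 = A := inter_eq_left.2 fun x hx => (hA hx).1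
  rw [hA0] at hl
  have hae : ∀ h ≤ H, ∀ᵐ s ∂(volume.restrict (Ioo 0 h)), s ∈ A := fun h hh =>
    ae_restrict_of_ae_restrict_of_subset (Ioo_subset_Ioo_right hh) hAf
  -- A set of full measure in (0, H) accumulates at 0, so bounds can be passed to the limit l.
  have hne : (𝓝[A] (0 : ℝ)).NeBot := by
    rw [← mem_closure_iff_nhdsWithin_neBot, Metric.mem_closure_iff]
    intro ε hε
    have h1 := hae (min H ε) (min_le_left _ _)
    have h2 : volume (Ioo 0 (min H ε)) ≠ 0 := by simp [hH, hε]
    have h3 : (ae (volume.restrict (Ioo 0 (min H ε)))).NeBot := by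
      rw [ae_neBot]
      intro h0
      rw [Measure.restrict_eq_zero] at h0
      exact h2 h0
    obtain ⟨s, hs, hs'⟩ := (h1.and (self_mem_ae_restrict measurableSet_Ioo)).exists
    refine ⟨s, hs, ?_⟩
    rw [dist_comm, Real.dist_eq, sub_zero, abs_of_pos hs'.1]
    exact hs'.2.trans_le (min_le_right _ _)
  refine ⟨l, ?_, fun h hh => ?_⟩
  · rw [ENNReal.tendsto_nhds_zero]
    intro ε hε
    have h1 : ∀ᶠ s in 𝓝[A] (0 : ℝ), ‖φ s - l‖ₑ ≤ ε := by
      have h2 := (hl.sub_const l).enorm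
      rw [sub_self, enorm_zero] at h2
      exact (ENNReal.tendsto_nhds_zero.1 h2) ε hε
    rw [eventually_nhdsWithin_iff, Metric.eventually_nhds_iff] at h1
    obtain ⟨δ, hδ, h1⟩ := h1
    filter_upwards [Ioo_mem_nhdsGT (lt_min hδ hH)] with h hh
    refine ENNReal.div_le_of_le_mul ?_
    calc ∫⁻ s in Ioo 0 h, ‖φ s - l‖ₑ ≤ ∫⁻ _ in Ioo 0 h, ε := by
          refine lintegral_mono_ae ?_
          filter_upwards [hae h (hh.2.le.trans (min_le_right _ _)),
            self_mem_ae_restrict measurableSet_Ioo] with s hs hs'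
          refine h1 ?_ hs
          rw [Real.dist_eq, sub_zero, abs_of_pos hs'.1]
          exact hs'.2.trans (hh.2.trans_le (min_le_left _ _))
      _ = ε * ENNReal.ofReal h := by simp
  · have h1 : ∀ s ∈ A, ‖φ s - l‖ₑ ≤ V := by
      intro s hs
      have h2 := ((hl.const_sub (φ s))).enorm
      refine le_of_tendsto h2 ?_
      filter_upwards [self_mem_nhdsWithin] with t ht
      rw [← edist_eq_enorm_sub]
      exact (eVariationOn.edist_le φ hs ht).trans hV
    calc ∫⁻ s in Ioo 0 h, ‖φ s - l‖ₑ ≤ ∫⁻ _ in Ioo 0 h, V := by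
          refine lintegral_mono_ae ?_
          filter_upwards [hae h hh] with s hs using h1 s hs
      _ = V * ENNReal.ofReal h := by simp

/-! ### Traces on a flat boundary -/

section Flat

variable {F : Type*} [NormedAddCommGroup F] [InnerProductSpace ℝ F] [FiniteDimensional ℝ F]
  [MeasurableSpace F] [BorelSpace F]

/-- Fatou: the vertical variation V(p) of f is dominated by the liminf of the gradient integrals on
the line over p, and the integral of this liminf is at most T. So V is finite almost everywhere and
the one-dimensional lemma applies line by line. In the application w is a smooth approximation in
chart coordinates and γ the norm of its gradient. -/
lemma exists_vertical_limit {Q : Set F} (hQ : MeasurableSet Q) {H : ℝ} (hH : 0 < H)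
    {f : F × ℝ → ℝ} {w : ℕ → F × ℝ → ℝ} {γ : ℕ → F × ℝ → ℝ≥0∞} (hγ : ∀ k, Measurable (γ k))
    (hw : ∀ k, ∀ p ∈ Q, ∀ s t, 0 < s → s ≤ t → t < H →
      ‖w k (p, t) - w k (p, s)‖ₑ ≤ ∫⁻ τ in Ioc s t, γ k (p, τ))
    (hlim : ∀ᵐ z ∂(volume.restrict (Q ×ˢ Ioo 0 H)), Tendsto (fun k => w k z) atTop (𝓝 (f z)))
    {T : ℝ≥0∞} (hT : T ≠ ⊤)
    (hbd : ∀ δ > 0, ∀ᶠ k in atTop, ∫⁻ z in Q ×ˢ Ioo δ H, γ k z ≤ T) :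
    ∃ (g : F → ℝ) (V : F → ℝ≥0∞), Measurable V ∧ ∫⁻ p in Q, V p ≠ ⊤ ∧
      ∀ᵐ p ∂(volume.restrict Q),
        Tendsto (fun h => (∫⁻ s in Ioo 0 h, ‖f (p, s) - g p‖ₑ) / ENNReal.ofReal h)
          (𝓝[>] 0) (𝓝 0) ∧
        ∀ h ≤ H, ∫⁻ s in Ioo 0 h, ‖f (p, s) - g p‖ₑ ≤ V p * ENNReal.ofReal h := by
  -- Diagonal choice: the approximation with index κ(k) satisfies the gradient bound above height
  -- 1/(k+1).
  obtain ⟨κ, hκ, hκT⟩ := extraction_forall_of_eventually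
    fun n : ℕ => hbd (1 / ((n : ℝ) + 1)) (by positivity)
  set V : F → ℝ≥0∞ := fun p =>
    liminf (fun k : ℕ => ∫⁻ τ in Ioo (1 / ((k : ℝ) + 1)) H, γ (κ k) (p, τ)) atTop with hVdef
  have hVm : ∀ k : ℕ, Measurable fun p => ∫⁻ τ in Ioo (1 / ((k : ℝ) + 1)) H, γ (κ k) (p, τ) :=
    fun k => (hγ (κ k)).lintegral_prod_right'
  have hVT : ∫⁻ p in Q, V p ≤ T := by
    refine (lintegral_liminf_le hVm).trans ?_
    refine liminf_le_of_le (by isBoundedDefault) fun b hb => ?_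
    obtain ⟨k, hk⟩ := hb.exists
    refine hk.trans (le_trans (le_of_eq ?_) (hκT k))
    rw [Measure.volume_eq_prod, ← Measure.prod_restrict, lintegral_prod _ (hγ _).aemeasurable]
  have hVt : ∫⁻ p in Q, V p ≠ ⊤ := (hVT.trans_lt (lt_top_iff_ne_top.2 hT)).ne
  have hVmeas : Measurable V := Measurable.liminf hVm
  have hVfin : ∀ᵐ p ∂(volume.restrict Q), V p < ⊤ := ae_lt_top hVmeas hVt
  have hex : ∀ᵐ p ∂(volume.restrict Q), ∃ l : ℝ,
      Tendsto (fun h => (∫⁻ s in Ioo 0 h, ‖f (p, s) - l‖ₑ) / ENNReal.ofReal h) (𝓝[>] 0) (𝓝 0) ∧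
      ∀ h ≤ H, ∫⁻ s in Ioo 0 h, ‖f (p, s) - l‖ₑ ≤ V p * ENNReal.ofReal h := by
    rw [Measure.volume_eq_prod, ← Measure.prod_restrict] at hlim
    filter_upwards [hVfin, Measure.ae_ae_of_ae_prod hlim, self_mem_ae_restrict hQ]
      with p hp hpl hpQ
    set A : Set ℝ := {s | s ∈ Ioo 0 H ∧ Tendsto (fun k => w k (p, s)) atTop (𝓝 (f (p, s)))}
    refine exists_limit_zero_of_eVariationOn hH (A := A) (fun s hs => hs.1) ?_ ?_ hp.ne
    · filter_upwards [hpl, self_mem_ae_restrict measurableSet_Ioo] with s h1 h2 using ⟨h2, h1⟩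
    · exact eVariationOn_le_liminf (φ := fun k s => w (κ k) (p, s)) (φ' := fun s => f (p, s))
        (γ := fun k τ => γ (κ k) (p, τ)) (A := A) (fun s hs => hs.1)
        (fun s hs => hs.2.comp hκ.tendsto_atTop) (fun k s t => hw (κ k) p hpQ s t)
  classical
  refine ⟨fun p => if h : ∃ l : ℝ,
      Tendsto (fun h => (∫⁻ s in Ioo 0 h, ‖f (p, s) - l‖ₑ) / ENNReal.ofReal h) (𝓝[>] 0) (𝓝 0) ∧
      ∀ h ≤ H, ∫⁻ s in Ioo 0 h, ‖f (p, s) - l‖ₑ ≤ V p * ENNReal.ofReal h then h.choose else 0,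
    V, hVmeas, hVt, ?_⟩
  filter_upwards [hex] with p hp
  rw [dif_pos hp]
  exact hp.choose_spec

/-- The boundary values were chosen point by point; they are measurable because they are almost
everywhere limits of averages over shrinking vertical segments, measurable by Fubini. -/
lemma aemeasurable_vertical_limit {Q : Set F} {H : ℝ} (hH : 0 < H)
    {f : F × ℝ → ℝ} (hf : IntegrableOn f (Q ×ˢ Ioo 0 H)) {g : F → ℝ}
    (hg : ∀ᵐ p ∂(volume.restrict Q),
      Tendsto (fun h => (∫⁻ s in Ioo 0 h, ‖f (p, s) - g p‖ₑ) / ENNReal.ofReal h) (𝓝[>] 0) (𝓝 0)) :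
    AEMeasurable g (volume.restrict Q) := by
  set a : ℕ → ℝ := fun n => H / ((n : ℝ) + 1) with ha
  have ha0 : ∀ n, 0 < a n := fun n => by positivity
  have haH : ∀ n, a n ≤ H := fun n => div_le_self hH.le (by linarith [n.cast_nonneg (α := ℝ)])
  have hat : Tendsto a atTop (𝓝[>] 0) := by
    refine tendsto_nhdsWithin_iff.2 ⟨?_, Eventually.of_forall ha0⟩
    have := tendsto_one_div_add_atTop_nhds_zero_nat.const_mul H
    simpa [ha, div_eq_mul_inv] using this
  rw [IntegrableOn, Measure.volume_eq_prod, ← Measure.prod_restrict] at hf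
  refine aemeasurable_of_tendsto_metrizable_ae atTop
    (f := fun n p => (a n)⁻¹ * ∫ s in Ioo 0 (a n), f (p, s)) (fun n => ?_) ?_
  · refine AEMeasurable.const_mul ?_ _
    have h1 : AEStronglyMeasurable f ((volume.restrict Q).prod (volume.restrict (Ioo 0 (a n)))) :=
      hf.1.mono_measure (Measure.prod_mono le_rfl
        (Measure.restrict_mono (Ioo_subset_Ioo_right (haH n)) le_rfl))
    exact h1.integral_prod_right'.aemeasurable
  · filter_upwards [hg, hf.prod_right_ae] with p hp hpi
    rw [tendsto_iff_edist_tendsto_0]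
    refine tendsto_of_tendsto_of_tendsto_of_le_of_le tendsto_const_nhds (hp.comp hat)
      (fun _ => bot_le) fun n => ?_
    have hi : IntegrableOn (fun s => f (p, s)) (Ioo 0 (a n)) :=
      hpi.mono_measure (Measure.restrict_mono (Ioo_subset_Ioo_right (haH n)) le_rfl)
    have hc : ∫ _ in Ioo 0 (a n), g p = a n * g p := by
      simp [(ha0 n).le, Measure.real]
    have h2 : (a n)⁻¹ * (∫ s in Ioo 0 (a n), f (p, s)) - g p =
        (a n)⁻¹ * ∫ s in Ioo 0 (a n), (f (p, s) - g p) := by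
      rw [integral_sub hi (by simp), hc]
      have := (ha0 n).ne'
      field_simp
    rw [edist_eq_enorm_sub, h2, enorm_mul, comp_apply, ENNReal.div_eq_inv_mul]
    gcongr
    · rw [Real.enorm_of_nonneg (inv_nonneg.2 (ha0 n).le), ENNReal.ofReal_inv_of_pos (ha0 n)]
    · exact enorm_integral_le_lintegral_enorm _

/-- Replacing a scale by a comparable 1/(m+1) allows maximal functions to be countable suprema,
hence measurable. -/
lemma exists_nat_scale {h : ℝ} (h0 : 0 < h) (h1 : h ≤ 1) :
    ∃ m : ℕ, h ≤ 1 / ((m : ℝ) + 1) ∧ 1 / ((m : ℝ) + 1) ≤ 2 * h := by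
  obtain ⟨m, hm⟩ := Nat.exists_eq_add_of_le' (Nat.floor_pos.2 ((one_le_div h0).2 h1))
  have hfl := Nat.floor_le (one_div_pos.2 h0).le
  have hlt := Nat.lt_floor_add_one (1 / h)
  rw [hm] at hfl hlt
  push_cast at hfl hlt
  refine ⟨m, ?_, ?_⟩
  · rw [le_div_iff₀ (by positivity), mul_comm]
    exact (le_div_iff₀ h0).1 hfl
  · rw [div_le_iff₀ (by positivity)]
    rw [div_lt_iff₀ h0] at hlt
    have : (0 : ℝ) ≤ m := m.cast_nonneg
    nlinarith

/-- Vertical convergence need not be uniform in p, so it does not by itself control averages over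
cylinders. Let M_n(q) be the largest normalized vertical deviation over q at scales at most about
1/n. It is dominated by the integrable V and tends to 0 almost everywhere. At a common Lebesgue
point p of g and all M_n, the normalized deviation over the cylinder has limsup at most 4 M_n(p) for
every n. -/
lemma ae_tendsto_ball_of_vertical_limit {Q : Set F} (hQ : IsOpen Q) {H : ℝ} (hH : 0 < H)
    {f : F × ℝ → ℝ} (hf : IntegrableOn f (Q ×ˢ Ioo 0 H)) {g : F → ℝ} {V : F → ℝ≥0∞}
    (hV : ∫⁻ p in Q, V p ≠ ⊤)
    (hg : ∀ᵐ p ∂(volume.restrict Q),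
      Tendsto (fun h => (∫⁻ s in Ioo 0 h, ‖f (p, s) - g p‖ₑ) / ENNReal.ofReal h) (𝓝[>] 0) (𝓝 0) ∧
      ∀ h ≤ H, ∫⁻ s in Ioo 0 h, ‖f (p, s) - g p‖ₑ ≤ V p * ENNReal.ofReal h) :
    ∀ᵐ p ∂(volume.restrict Q), Tendsto
      (fun r => (∫⁻ z in closedBall p r ×ˢ Ioo 0 (2 * r), ‖f z - g p‖ₑ) /
        (ENNReal.ofReal r * volume (closedBall p r))) (𝓝[>] 0) (𝓝 0) := by
  have hgm : AEMeasurable g (volume.restrict Q) :=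
    aemeasurable_vertical_limit hH hf (hg.mono fun p hp => hp.1)
  rw [IntegrableOn, Measure.volume_eq_prod, ← Measure.prod_restrict] at hf
  -- normalized vertical deviation
  set D : F → ℝ → ℝ≥0∞ := fun p h => (∫⁻ s in Ioo 0 h, ‖f (p, s) - g p‖ₑ) / ENNReal.ofReal h
  have hDm : ∀ h ≤ H, AEMeasurable (fun p => D p h) (volume.restrict Q) := by
    intro h hh
    refine AEMeasurable.div_const ?_ _
    have h1 : AEMeasurable f ((volume.restrict Q).prod (volume.restrict (Ioo 0 h))) :=
      hf.aemeasurable.mono_measure (Measure.prod_mono le_rfl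
        (Measure.restrict_mono (Ioo_subset_Ioo_right hh) le_rfl))
    exact ((h1.sub (hgm.comp_quasiMeasurePreserving
      Measure.quasiMeasurePreserving_fst)).enorm).lintegral_prod_right'
  obtain ⟨n₀, hn₀⟩ := exists_nat_one_div_lt hH
  have hnH : ∀ n : ℕ, 1 / (((n + n₀ : ℕ) : ℝ) + 1) ≤ H := fun n => by
    refine le_trans ?_ hn₀.le
    refine one_div_le_one_div_of_le (by positivity) ?_
    push_cast
    linarith [n.cast_nonneg (α := ℝ)]
  -- The shift by `n₀` keeps all scales at most H, where the bound by V holds.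
  set M : ℕ → F → ℝ≥0∞ := fun n p => ⨆ m : ℕ, D p (1 / (((n + m + n₀ : ℕ) : ℝ) + 1)) with hM
  have hMm : ∀ n, AEMeasurable (M n) (volume.restrict Q) := fun n =>
    AEMeasurable.iSup fun m => hDm _ (hnH (n + m))
  have hMV : ∀ n, ∀ᵐ p ∂(volume.restrict Q), M n p ≤ V p := by
    intro n
    filter_upwards [hg] with p hp
    exact iSup_le fun m => ENNReal.div_le_of_le_mul (hp.2 _ (hnH (n + m)))
  have hMt : ∀ n, ∫⁻ p in Q, M n p ≠ ⊤ := fun n =>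
    ((lintegral_mono_ae (hMV n)).trans_lt (lt_top_iff_ne_top.2 hV)).ne
  have hM0 : ∀ᵐ p ∂(volume.restrict Q), Tendsto (fun n => M n p) atTop (𝓝 0) := by
    filter_upwards [hg] with p hp
    rw [ENNReal.tendsto_nhds_zero]
    intro ε hε
    have h1 := (ENNReal.tendsto_nhds_zero.1 hp.1) ε hε
    rw [eventually_nhdsWithin_iff, Metric.eventually_nhds_iff] at h1
    obtain ⟨δ, hδ, h1⟩ := h1
    obtain ⟨n₁, hn₁⟩ := exists_nat_one_div_lt hδ
    filter_upwards [eventually_ge_atTop n₁] with n hn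
    refine iSup_le fun m => h1 ?_ (mem_Ioi.2 (by positivity))
    rw [Real.dist_eq, sub_zero, abs_of_pos (by positivity)]
    refine lt_of_le_of_lt (one_div_le_one_div_of_le (by positivity) ?_) hn₁
    have : (n₁ : ℝ) ≤ n := by exact_mod_cast hn
    push_cast
    linarith [m.cast_nonneg (α := ℝ), n₀.cast_nonneg (α := ℝ)]
  have hMlim : ∀ n, ∀ᵐ p ∂(volume.restrict Q), Tendsto
      (fun r => (∫⁻ q in closedBall p r, M n q) / volume (closedBall p r)) (𝓝[>] 0)
      (𝓝 (M n p)) := by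
    intro n
    have h1 := (Besicovitch.vitaliFamily (volume : Measure F)).ae_tendsto_lintegral_div
      (f := Q.indicator (M n)) ((aemeasurable_indicator_iff hQ.measurableSet).2 (hMm n))
      (by rw [lintegral_indicator hQ.measurableSet]; exact hMt n)
    filter_upwards [ae_restrict_of_ae h1, self_mem_ae_restrict hQ.measurableSet] with p hp hpQ
    rw [indicator_of_mem hpQ] at hp
    refine (hp.comp (Besicovitch.tendsto_filterAt volume p)).congr' ?_
    obtain ⟨ε, hε, hεQ⟩ := Metric.isOpen_iff.1 hQ p hpQ
    filter_upwards [Ioo_mem_nhdsGT hε] with r hr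
    simp only [comp_apply]
    congr 1
    refine setLIntegral_congr_fun measurableSet_closedBall fun q hq => ?_
    exact indicator_of_mem (hεQ (closedBall_subset_ball hr.2 hq)) _
  -- Averaging |g| ≤ |f| + |f - g| over the full height H bounds g by integrable quantities.
  have hgi : IntegrableOn g Q := by
    refine ⟨hgm.aestronglyMeasurable, ?_⟩
    have hH0 : ENNReal.ofReal H ≠ 0 := by simpa using hH
    have h2 : ∀ᵐ p ∂(volume.restrict Q), ‖g p‖ₑ * ENNReal.ofReal H ≤
        (∫⁻ s in Ioo 0 H, ‖f (p, s)‖ₑ) + V p * ENNReal.ofReal H := by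
      filter_upwards [hg, hf.prod_right_ae] with p hp hpi
      calc ‖g p‖ₑ * ENNReal.ofReal H = ∫⁻ _ in Ioo 0 H, ‖g p‖ₑ := by simp
        _ ≤ ∫⁻ s in Ioo 0 H, (‖f (p, s)‖ₑ + ‖f (p, s) - g p‖ₑ) := by
            refine lintegral_mono fun s => ?_
            have := enorm_sub_le (a := f (p, s)) (b := f (p, s) - g p)
            rwa [sub_sub_cancel] at this
        _ = (∫⁻ s in Ioo 0 H, ‖f (p, s)‖ₑ) + ∫⁻ s in Ioo 0 H, ‖f (p, s) - g p‖ₑ :=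
            lintegral_add_left' hpi.1.enorm _
        _ ≤ _ := by gcongr; exact hp.2 H le_rfl
    have h3 : (∫⁻ p in Q, ‖g p‖ₑ) * ENNReal.ofReal H < ⊤ := by
      rw [← lintegral_mul_const'' _ hgm.enorm]
      refine (lintegral_mono_ae h2).trans_lt ?_
      rw [lintegral_add_left' hf.1.enorm.lintegral_prod_right', lintegral_mul_const' _ _ (by simp),
        ← lintegral_prod _ hf.1.enorm]
      exact ENNReal.add_lt_top.2 ⟨hf.2, ENNReal.mul_lt_top (lt_top_iff_ne_top.2 hV) (by simp)⟩
    rw [HasFiniteIntegral]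
    by_contra h4
    rw [not_lt, top_le_iff] at h4
    rw [h4, ENNReal.top_mul hH0] at h3
    exact lt_irrefl _ h3
  have hglim : ∀ᵐ p ∂(volume.restrict Q), Tendsto
      (fun r => (∫⁻ q in closedBall p r, ‖g q - g p‖ₑ) / volume (closedBall p r)) (𝓝[>] 0)
      (𝓝 0) := by
    have h1 := (Besicovitch.vitaliFamily (volume : Measure F)).ae_tendsto_lintegral_enorm_sub_div
      (hgi.integrable_indicator hQ.measurableSet).locallyIntegrable
    filter_upwards [ae_restrict_of_ae h1, self_mem_ae_restrict hQ.measurableSet] with p hp hpQ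
    rw [indicator_of_mem hpQ] at hp
    refine (hp.comp (Besicovitch.tendsto_filterAt volume p)).congr' ?_
    obtain ⟨ε, hε, hεQ⟩ := Metric.isOpen_iff.1 hQ p hpQ
    filter_upwards [Ioo_mem_nhdsGT hε] with r hr
    simp only [comp_apply]
    congr 1
    refine setLIntegral_congr_fun measurableSet_closedBall fun q hq => ?_
    rw [indicator_of_mem (hεQ (closedBall_subset_ball hr.2 hq))]
  filter_upwards [hM0, ae_all_iff.2 hMlim, hglim, self_mem_ae_restrict hQ.measurableSet]
    with p hp0 hpM hpg hpQ
  obtain ⟨ε₀, hε₀, hεQ⟩ := Metric.isOpen_iff.1 hQ p hpQ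
  -- the basic estimate
  have key : ∀ n : ℕ, ∀ᶠ r in 𝓝[>] (0 : ℝ),
      (∫⁻ z in closedBall p r ×ˢ Ioo 0 (2 * r), ‖f z - g p‖ₑ) /
        (ENNReal.ofReal r * volume (closedBall p r)) ≤
      4 * ((∫⁻ q in closedBall p r, M n q) / volume (closedBall p r)) +
      2 * ((∫⁻ q in closedBall p r, ‖g q - g p‖ₑ) / volume (closedBall p r)) := by
    intro n
    have hc : 0 < min (ε₀ / 2) (1 / (((n + n₀ : ℕ) : ℝ) + 1) / 4) := by positivity
    filter_upwards [Ioo_mem_nhdsGT hc] with r hr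
    have hr0 : 0 < r := hr.1
    have hrε : r < ε₀ := by linarith [hr.2.trans_le (min_le_left _ _)]
    have hrn : 2 * r < 1 / (((n + n₀ : ℕ) : ℝ) + 1) := by
      have := hr.2.trans_le (min_le_right _ _)
      have h4 : 0 < 1 / (((n + n₀ : ℕ) : ℝ) + 1) := by positivity
      linarith
    have hBQ : closedBall p r ⊆ Q := (closedBall_subset_ball hrε).trans hεQ
    have h2r1 : 2 * r ≤ 1 := hrn.le.trans (by
      rw [div_le_one (by positivity)]
      linarith [((n + n₀ : ℕ)).cast_nonneg (α := ℝ)])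
    -- Here 2r ≤ 1/(m+1) ≤ 4r, which is the origin of the factor 4 in front of M_n.
    obtain ⟨m, hm1, hm2⟩ := exists_nat_scale (by linarith : 0 < 2 * r) h2r1
    have hrH : 2 * r ≤ H := hrn.le.trans (hnH n)
    have hmn : ∃ k, m = n + k + n₀ := by
      have h6 : 1 / ((m : ℝ) + 1) < 1 / (((n + n₀ : ℕ) : ℝ) + 1) := by
        have := hr.2.trans_le (min_le_right _ _)
        linarith
      have h7 := lt_of_one_div_lt_one_div (by positivity) h6
      have h8 : n + n₀ < m := by
        have : (((n + n₀ : ℕ) : ℝ)) < m := by linarith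
        exact_mod_cast this
      exact ⟨m - n - n₀, by omega⟩
    obtain ⟨k, rfl⟩ := hmn
    have hDM : ∀ q, (∫⁻ s in Ioo 0 (2 * r), ‖f (q, s) - g q‖ₑ) ≤ ENNReal.ofReal (4 * r) * M n q := by
      intro q
      calc ∫⁻ s in Ioo 0 (2 * r), ‖f (q, s) - g q‖ₑ
          ≤ ∫⁻ s in Ioo 0 (1 / (((n + k + n₀ : ℕ) : ℝ) + 1)), ‖f (q, s) - g q‖ₑ :=
            lintegral_mono_set (Ioo_subset_Ioo_right hm1)
        _ = D q (1 / (((n + k + n₀ : ℕ) : ℝ) + 1)) *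
              ENNReal.ofReal (1 / (((n + k + n₀ : ℕ) : ℝ) + 1)) := by
            rw [ENNReal.div_mul_cancel]
            · rw [Ne, ENNReal.ofReal_eq_zero, not_le]; positivity
            · simp
        _ ≤ M n q * ENNReal.ofReal (4 * r) := by
            gcongr
            · exact le_iSup (fun m : ℕ => D q (1 / (((n + m + n₀ : ℕ) : ℝ) + 1))) k
            · linarith
        _ = _ := mul_comm _ _
    set B := closedBall p r with hB
    have hMB : AEMeasurable (M n) (volume.restrict B) :=
      (hMm n).mono_measure (Measure.restrict_mono hBQ le_rfl)
    have hint : ∫⁻ z in B ×ˢ Ioo 0 (2 * r), ‖f z - g p‖ₑ ≤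
        ENNReal.ofReal (4 * r) * (∫⁻ q in B, M n q) +
          ENNReal.ofReal (2 * r) * ∫⁻ q in B, ‖g q - g p‖ₑ := by
      rw [Measure.volume_eq_prod, ← Measure.prod_restrict]
      refine (lintegral_prod_le _).trans ?_
      calc ∫⁻ q in B, ∫⁻ s in Ioo 0 (2 * r), ‖f (q, s) - g p‖ₑ
          ≤ ∫⁻ q in B, (ENNReal.ofReal (4 * r) * M n q +
              ENNReal.ofReal (2 * r) * ‖g q - g p‖ₑ) := by
            refine lintegral_mono fun q => ?_
            calc ∫⁻ s in Ioo 0 (2 * r), ‖f (q, s) - g p‖ₑ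
                ≤ ∫⁻ s in Ioo 0 (2 * r), (‖f (q, s) - g q‖ₑ + ‖g q - g p‖ₑ) := by
                  refine lintegral_mono fun s => ?_
                  have := enorm_add_le (f (q, s) - g q) (g q - g p)
                  rwa [sub_add_sub_cancel] at this
              _ = (∫⁻ s in Ioo 0 (2 * r), ‖f (q, s) - g q‖ₑ) +
                    ENNReal.ofReal (2 * r) * ‖g q - g p‖ₑ := by
                  rw [lintegral_add_right _ measurable_const]
                  simp [mul_comm]
              _ ≤ _ := by gcongr; exact hDM q
        _ = _ := by
            rw [lintegral_add_left' (hMB.const_mul _), lintegral_const_mul' _ _ ENNReal.ofReal_ne_top,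
              lintegral_const_mul' _ _ ENNReal.ofReal_ne_top]
    have hr0' : ENNReal.ofReal r ≠ 0 := by simpa using hr0
    have e4 : ENNReal.ofReal (4 * r) = ENNReal.ofReal r * 4 := by
      rw [ENNReal.ofReal_mul (by norm_num), mul_comm]; norm_num
    have e2 : ENNReal.ofReal (2 * r) = ENNReal.ofReal r * 2 := by
      rw [ENNReal.ofReal_mul (by norm_num), mul_comm]; norm_num
    rw [e4, e2, mul_assoc, mul_assoc, ← mul_add] at hint
    calc (∫⁻ z in B ×ˢ Ioo 0 (2 * r), ‖f z - g p‖ₑ) / (ENNReal.ofReal r * volume B)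
        ≤ (ENNReal.ofReal r * (4 * (∫⁻ q in B, M n q) + 2 * ∫⁻ q in B, ‖g q - g p‖ₑ)) /
            (ENNReal.ofReal r * volume B) := ENNReal.div_le_div_right hint _
      _ = (4 * (∫⁻ q in B, M n q) + 2 * ∫⁻ q in B, ‖g q - g p‖ₑ) / volume B :=
          ENNReal.mul_div_mul_left _ _ hr0' ENNReal.ofReal_ne_top
      _ = _ := by rw [ENNReal.add_div, mul_div_assoc, mul_div_assoc]
  rw [ENNReal.tendsto_nhds_zero]
  intro ε hε
  have hlim1 : Tendsto (fun n => 4 * M n p) atTop (𝓝 0) := by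
    simpa using ENNReal.Tendsto.const_mul (a := 4) hp0 (Or.inr (by simp))
  obtain ⟨n, hn⟩ := (hlim1.eventually (gt_mem_nhds hε)).exists
  have hlim2 : Tendsto (fun r => 4 * ((∫⁻ q in closedBall p r, M n q) / volume (closedBall p r)) +
      2 * ((∫⁻ q in closedBall p r, ‖g q - g p‖ₑ) / volume (closedBall p r))) (𝓝[>] 0)
      (𝓝 (4 * M n p + 2 * 0)) :=
    (ENNReal.Tendsto.const_mul (hpM n) (Or.inr (by simp))).add
      (ENNReal.Tendsto.const_mul hpg (Or.inr (by simp)))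
  rw [mul_zero, add_zero] at hlim2
  filter_upwards [key n, hlim2.eventually (gt_mem_nhds hn)] with r h1 h2
  exact h1.trans h2.le

end Flat

/-! ### Graph charts at boundary points -/

/-- Coordinates of the boundary hyperplanes. -/
abbrev Hyp (N : ℕ) := EuclideanSpace ℝ (Fin (N - 1))

/-- A chart of `Ω` at a boundary point `x₀`: coordinates `(p, s)` in which `Ω` is `{s > 0}` near
`x₀`, obtained from orthonormal coordinates by a vertical shear along an `ε`-Lipschitz graph. -/
structure GraphChart (Ω : Set 𝔼) (x₀ : 𝔼) (ε : ℝ) where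
  /-- The parametrization. -/
  Λ : (Hyp N × ℝ) ≃ₜ 𝔼
  /-- The vertical direction. -/
  e : 𝔼
  /-- The size of the chart. -/
  R : ℝ
  norm_e : ‖e‖ = 1
  R_pos : 0 < R
  map_add : ∀ p s, Λ (p, s) = Λ (p, 0) + s • e
  measurePreserving : MeasurePreserving Λ volume volume
  le_dist : ∀ p q s t, dist p q ≤ dist (Λ (p, s)) (Λ (q, t))
  dist_le : ∀ p q s t, dist (Λ (p, s)) (Λ (q, t)) ≤ (1 + ε) * dist p q + |s - t|
  height_le : ∀ p q s, |s| ≤ (1 + ε) * dist (Λ (p, s)) (Λ (q, 0))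
  center : Λ (0, 0) = x₀
  mem_iff : ∀ p s, ‖p‖ < R → |s| < R → (Λ (p, s) ∈ Ω ↔ 0 < s)
  frontier_iff : ∀ p s, ‖p‖ < R → |s| < R → (Λ (p, s) ∈ frontier Ω ↔ s = 0)

lemma exists_orthonormal_coordinates (hN : 1 ≤ N) {e : 𝔼} (he : ‖e‖ = 1) :
    ∃ Φ : WithLp 2 (Hyp N × ℝ) ≃ₗᵢ[ℝ] 𝔼, Φ (WithLp.toLp 2 (0, 1)) = e := by
  have hfin : Fact (Module.finrank ℝ 𝔼 = (N - 1) + 1) :=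
    ⟨by rw [finrank_euclideanSpace_fin]; omega⟩
  have he0 : e ≠ 0 := by
    rintro rfl
    simp at he
  set b := OrthonormalBasis.fromOrthogonalSpanSingleton (𝕜 := ℝ) (N - 1) he0
  have horth : ∀ p : Hyp N, inner ℝ ((b.repr.symm p : (ℝ ∙ e)ᗮ) : 𝔼) e = 0 := fun p =>
    Submodule.mem_orthogonal_singleton_iff_inner_left.1 (b.repr.symm p).2
  let L : WithLp 2 (Hyp N × ℝ) →ₗ[ℝ] 𝔼 :=
    { toFun := fun z => ((b.repr.symm z.fst : (ℝ ∙ e)ᗮ) : 𝔼) + z.snd • e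
      map_add' := fun x y => by
        simp only [WithLp.add_fst, WithLp.add_snd, map_add, Submodule.coe_add, add_smul]
        abel
      map_smul' := fun c x => by
        simp only [WithLp.smul_fst, WithLp.smul_snd, map_smul, Submodule.coe_smul, smul_add,
          smul_eq_mul, mul_smul, RingHom.id_apply] }
  let Li : WithLp 2 (Hyp N × ℝ) →ₗᵢ[ℝ] 𝔼 := ⟨L, fun z => by
    have h1 : ‖L z‖ ^ 2 = ‖z‖ ^ 2 := by
      change ‖((b.repr.symm z.fst : (ℝ ∙ e)ᗮ) : 𝔼) + z.snd • e‖ ^ 2 = _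
      rw [WithLp.prod_norm_sq_eq_of_L2, norm_add_sq_real, inner_smul_right, horth]
      simp only [mul_zero, add_zero, norm_smul, he, mul_one]
      congr 2
      exact b.repr.symm.norm_map _
    exact (sq_eq_sq₀ (norm_nonneg _) (norm_nonneg _)).1 h1⟩
  refine ⟨Li.toLinearIsometryEquiv ?_, ?_⟩
  · rw [finrank_euclideanSpace_fin, (WithLp.linearEquiv 2 ℝ (Hyp N × ℝ)).finrank_eq,
      Module.finrank_prod, finrank_euclideanSpace_fin, Module.finrank_self]
    omega
  · change ((b.repr.symm (0 : Hyp N) : (ℝ ∙ e)ᗮ) : 𝔼) + (1 : ℝ) • e = e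
    simp

/-- The vertical shear along a continuous graph. -/
def shear {F : Type*} [TopologicalSpace F] (g : F → ℝ) (hg : Continuous g) :
    (F × ℝ) ≃ₜ (F × ℝ) where
  toFun z := (z.1, g z.1 + z.2)
  invFun z := (z.1, -g z.1 + z.2)
  left_inv z := by simp
  right_inv z := by simp
  continuous_toFun := by fun_prop
  continuous_invFun := by fun_prop

/-- Each vertical line is only translated, so Fubini suffices; no Jacobian and no differentiability
of the graph enter. -/
lemma measurePreserving_shear {F : Type*} [TopologicalSpace F] [MeasureSpace F] [BorelSpace F]
    [SecondCountableTopology F] [SFinite (volume : Measure F)] (g : F → ℝ) (hg : Continuous g) :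
    MeasurePreserving (shear g hg) volume volume := by
  have := (MeasurePreserving.id (volume : Measure F)).skew_product (μc := (volume : Measure ℝ))
    (μd := volume) (g := fun p s => g p + s) (by
      have : Continuous (uncurry fun p s => g p + s) := by fun_prop
      exact this.measurable)
    (Eventually.of_forall fun p => map_add_left_eq_self volume (g p))
  exact this

/-- Strict differentiability of a C¹ function at x₀, with m = |∇ρ(x₀)| and e = -∇ρ(x₀)/m the inner
normal. This two-point estimate with an arbitrarily small c is all that is kept of the C¹
hypothesis; it makes the Lipschitz constant of the graph small. -/
lemma isC1BoundaryPoint_exists_local {Ω : Set 𝔼} {x₀ : 𝔼} (h : IsC1BoundaryPoint Ω x₀) {c : ℝ}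
    (hc : 0 < c) : ∃ (e : 𝔼) (m r : ℝ) (ρ : 𝔼 → ℝ), ‖e‖ = 1 ∧ 0 < m ∧ 0 < r ∧ ρ x₀ = 0 ∧
      (∀ y ∈ ball x₀ r, (y ∈ Ω ↔ ρ y < 0)) ∧
      ∀ y ∈ ball x₀ r, ∀ z ∈ ball x₀ r,
        |ρ z - ρ y + m * inner ℝ e (z - y)| ≤ c * m * ‖z - y‖ := by
  obtain ⟨ρ, hρ, hρ0, hρd, hρΩ⟩ := h
  set G := gradient ρ x₀ with hG
  have hGn : ‖G‖ = ‖fderiv ℝ ρ x₀‖ := by simp [hG, gradient]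
  have hm : 0 < ‖G‖ := by rw [hGn]; exact norm_pos_iff.2 hρd
  have hs := (hρ.hasStrictFDerivAt (by norm_num)).isLittleO
  have h1 := hs.def (mul_pos hc hm)
  rw [nhds_prod_eq, eventually_prod_self_iff'] at h1
  obtain ⟨t, ht, h1⟩ := h1
  obtain ⟨r, hr, hrt⟩ := Metric.mem_nhds_iff.1 (inter_mem ht hρΩ)
  refine ⟨-(‖G‖⁻¹ • G), ‖G‖, r, ρ, ?_, hm, hr, hρ0, fun y hy => (hrt hy).2, fun y hy z hz => ?_⟩
  · rw [norm_neg, norm_smul, norm_inv, norm_norm, inv_mul_cancel₀ hm.ne']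
  · have h2 := h1 z (hrt hz).1 y (hrt hy).1
    have h3 : fderiv ℝ ρ x₀ (z - y) = inner ℝ G (z - y) := by simp [hG, gradient]
    simp only [h3, Real.norm_eq_abs] at h2
    rw [inner_neg_left, inner_smul_left]
    simp only [conj_trivial]
    rw [mul_neg, ← mul_assoc, mul_inv_cancel₀ hm.ne', one_mul, ← sub_eq_add_neg]
    exact h2

/-- Along the direction e, ρ decreases with slope close to -m, so each vertical line over a small
ball has exactly one zero nearby, found by the intermediate value theorem. Comparing two zeros gives
|g p - g q| ≤ c(|p - q| + |g p - g q|), hence the Lipschitz constant 2c for c ≤ 1/2. -/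
lemma exists_graph {x₀ e : 𝔼} {m r c : ℝ} {ρ : 𝔼 → ℝ} (hm : 0 < m) (hr : 0 < r)
    (hc : 0 < c) (hc2 : c ≤ 1 / 2) (hρ0 : ρ x₀ = 0)
    (hρ : ∀ y ∈ ball x₀ r, ∀ z ∈ ball x₀ r,
      |ρ z - ρ y + m * inner ℝ e (z - y)| ≤ c * m * ‖z - y‖)
    {Φ : WithLp 2 (Hyp N × ℝ) ≃ₗᵢ[ℝ] 𝔼} (hΦ : Φ (WithLp.toLp 2 (0, 1)) = e) :
    ∃ (R : ℝ) (g : Hyp N → ℝ), 0 < R ∧ LipschitzWith (2 * c).toNNReal g ∧ g 0 = 0 ∧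
      ∀ p s, ‖p‖ < R → |s| < R →
        x₀ + Φ (WithLp.toLp 2 (p, g p + s)) ∈ ball x₀ r ∧
        (0 < s → ρ (x₀ + Φ (WithLp.toLp 2 (p, g p + s))) < 0) ∧
        (s = 0 → ρ (x₀ + Φ (WithLp.toLp 2 (p, g p + s))) = 0) ∧
        (s < 0 → 0 < ρ (x₀ + Φ (WithLp.toLp 2 (p, g p + s)))) := by
  set P : Hyp N → ℝ → 𝔼 := fun p t => x₀ + Φ (WithLp.toLp 2 (p, t)) with hP
  have hsub : ∀ p q s t, P p s - P q t = Φ (WithLp.toLp 2 (p - q, s - t)) := by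
    intro p q s t
    simp only [hP, add_sub_add_left_eq_sub, ← map_sub]
    rfl
  have hnorm : ∀ (p : Hyp N) (t : ℝ), ‖Φ (WithLp.toLp 2 (p, t))‖ ≤ ‖p‖ + |t| := by
    intro p t
    rw [Φ.norm_map]
    refine (abs_le_of_sq_le_sq' ?_ (by positivity)).2
    rw [WithLp.prod_norm_sq_eq_of_L2]
    change ‖p‖ ^ 2 + |t| ^ 2 ≤ _
    nlinarith [mul_nonneg (norm_nonneg p) (abs_nonneg t)]
  have hinner : ∀ (p : Hyp N) (t : ℝ), inner ℝ e (Φ (WithLp.toLp 2 (p, t))) = t := by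
    intro p t
    rw [← hΦ, Φ.inner_map_map]
    simp [WithLp.prod_inner_apply]
  have hball : ∀ p t, ‖p‖ < r / 2 → |t| < r / 2 → P p t ∈ ball x₀ r := by
    intro p t hp ht
    rw [mem_ball, dist_eq_norm]
    have : P p t - x₀ = Φ (WithLp.toLp 2 (p, t)) := by simp [hP]
    rw [this]
    linarith [hnorm p t]
  have hdiff : ∀ p q s t, ‖p‖ < r / 2 → |s| < r / 2 → ‖q‖ < r / 2 → |t| < r / 2 →
      |ρ (P p s) - ρ (P q t) + m * (s - t)| ≤ c * m * (‖p - q‖ + |s - t|) := by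
    intro p q s t hp hs hq ht
    have h1 := hρ _ (hball q t hq ht) _ (hball p s hp hs)
    rw [hsub, hinner] at h1
    exact h1.trans (mul_le_mul_of_nonneg_left (hnorm _ _) (by positivity))
  have hanti : ∀ p s t, ‖p‖ < r / 2 → |s| < r / 2 → |t| < r / 2 → s < t →
      ρ (P p t) < ρ (P p s) := by
    intro p s t hp hs ht hst
    have h1 := hdiff p p t s hp ht hp hs
    rw [sub_self, norm_zero, zero_add, abs_of_pos (sub_pos.2 hst)] at h1
    have h2 := (abs_le.1 h1).2
    have : c * m * (t - s) < m * (t - s) := by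
      have : 0 < m * (t - s) := mul_pos hm (sub_pos.2 hst)
      nlinarith
    linarith
  have hP0 : P 0 0 = x₀ := by
    have : Φ (WithLp.toLp 2 ((0 : Hyp N), (0 : ℝ))) = 0 := Φ.map_zero
    simp only [hP, this, add_zero]
  -- With |g p| and |s| both below r/4, the height g p + s stays below r/2, where the estimate is
  -- valid.
  set a := r / 4 with ha
  have ha0 : 0 < a := by positivity
  have hzero : ∀ p, ‖p‖ < a → ∃ t, |t| < a ∧ ρ (P p t) = 0 := by
    intro p hp
    have hsign : ∀ t, |t| = a → |ρ (P p t) + m * t| < m * a := by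
      intro t ht
      have h1 := hdiff p 0 t 0 (by linarith) (by linarith) (by simp; linarith) (by simp; linarith)
      rw [hP0, hρ0, sub_zero, sub_zero, sub_zero, ht] at h1
      have : c * m * (‖p‖ + a) < m * a := by
        have h3 : ‖p‖ + a < 2 * a := by linarith
        nlinarith [mul_lt_mul_of_pos_left h3 (mul_pos hc hm),
          mul_nonneg (sub_nonneg.2 hc2) (mul_pos hm ha0).le]
      exact h1.trans_lt this
    have hcont : ContinuousOn (fun t => ρ (P p t)) (Icc (-a) a) := by
      have : LipschitzOnWith (2 * m).toNNReal (fun t => ρ (P p t)) (Icc (-a) a) := by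
        refine LipschitzOnWith.of_dist_le_mul fun s hs t ht => ?_
        have hs' : |s| < r / 2 := (abs_le.2 hs).trans_lt (by linarith)
        have ht' : |t| < r / 2 := (abs_le.2 ht).trans_lt (by linarith)
        have h1 := hdiff p p s t (by linarith) hs' (by linarith) ht'
        rw [sub_self, norm_zero, zero_add] at h1
        rw [Real.dist_eq, Real.dist_eq, Real.coe_toNNReal _ (by positivity)]
        have h2 : |ρ (P p s) - ρ (P p t)| ≤ |ρ (P p s) - ρ (P p t) + m * (s - t)| +
            |m * (s - t)| := by
          have := abs_sub (ρ (P p s) - ρ (P p t) + m * (s - t)) (m * (s - t))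
          rwa [add_sub_cancel_right] at this
        rw [abs_mul, abs_of_pos hm] at h2
        have : c * m * |s - t| ≤ m * |s - t| := by
          have : 0 ≤ m * |s - t| := by positivity
          nlinarith
        linarith
      exact this.continuousOn
    have h1 := hsign a (abs_of_pos ha0)
    have h2 := hsign (-a) (by rw [abs_neg, abs_of_pos ha0])
    rw [abs_lt] at h1 h2
    obtain ⟨t, ht, ht0⟩ := intermediate_value_Icc' (by linarith : -a ≤ a) hcont
      (show (0 : ℝ) ∈ Icc (ρ (P p a)) (ρ (P p (-a))) from ⟨by linarith, by linarith⟩)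
    refine ⟨t, lt_of_le_of_ne (abs_le.2 ht) fun h => ?_, ht0⟩
    have h3 := hsign t h
    simp only at ht0
    rw [ht0, zero_add, abs_mul, abs_of_pos hm, h] at h3
    exact lt_irrefl _ h3
  choose! g₀ hg₀ hg₀z using hzero
  have hlip : LipschitzOnWith (2 * c).toNNReal g₀ (ball 0 a) := by
    refine LipschitzOnWith.of_dist_le_mul fun p hp q hq => ?_
    rw [mem_ball_zero_iff] at hp hq
    have h1 := hdiff p q (g₀ p) (g₀ q) (by linarith) ((hg₀ p hp).trans (by linarith))
      (by linarith) ((hg₀ q hq).trans (by linarith))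
    rw [hg₀z p hp, hg₀z q hq, sub_zero, zero_add, abs_mul, abs_of_pos hm] at h1
    rw [Real.dist_eq, dist_eq_norm, Real.coe_toNNReal _ (by positivity)]
    have h2 : |g₀ p - g₀ q| ≤ c * (‖p - q‖ + |g₀ p - g₀ q|) := by
      refine le_of_mul_le_mul_left ?_ hm
      linarith
    nlinarith [abs_nonneg (g₀ p - g₀ q)]
  -- Extending the graph without increasing its Lipschitz constant makes the chart a homeomorphism
  -- of the whole space; only its relation to Ω stays local.
  obtain ⟨g, hg, hgg₀⟩ := hlip.extend_real
  have hgz : ∀ p, ‖p‖ < a → |g p| < a ∧ ρ (P p (g p)) = 0 := by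
    intro p hp
    rw [← hgg₀ (mem_ball_zero_iff.2 hp)]
    exact ⟨hg₀ p hp, hg₀z p hp⟩
  refine ⟨a, g, ha0, hg, ?_, fun p s hp hs => ?_⟩
  · have h0 := hgz 0 (by simpa using ha0)
    by_contra hne
    have h00 : ρ (P 0 0) = 0 := by rw [hP0, hρ0]
    have h0n : ‖(0 : Hyp N)‖ < r / 2 := by simp; linarith
    have h0n' : |(0 : ℝ)| < r / 2 := by simp; linarith
    rcases lt_or_gt_of_ne hne with h | h
    · have := hanti 0 (g 0) 0 h0n (by linarith [h0.1]) h0n' h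
      linarith [h0.2]
    · have := hanti 0 0 (g 0) h0n h0n' (by linarith [h0.1]) h
      linarith [h0.2]
  · obtain ⟨hga, hg0⟩ := hgz p hp
    have hp' : ‖p‖ < r / 2 := by linarith
    have hg' : |g p| < r / 2 := by linarith
    have hgs : |g p + s| < r / 2 := by linarith [abs_add_le (g p) s]
    refine ⟨hball p _ hp' hgs, fun h => ?_, fun h => ?_, fun h => ?_⟩
    · have := hanti p (g p) (g p + s) hp' hg' hgs (by linarith)
      rwa [hg0] at this
    · rw [h, add_zero]; exact hg0
    · have := hanti p (g p + s) (g p) hp' hgs hg' (by linarith)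
      rwa [hg0] at this

lemma nonempty_graphChart (hN : 1 ≤ N) {Ω : Set 𝔼} (hΩ : IsOpen Ω) {x₀ : 𝔼}
    (h : IsC1BoundaryPoint Ω x₀) {ε : ℝ} (hε : 0 < ε) (hε1 : ε ≤ 1) :
    Nonempty (GraphChart Ω x₀ ε) := by
  obtain ⟨e, m, r, ρ, he, hm, hr, hρ0, hρΩ, hρ⟩ :=
    isC1BoundaryPoint_exists_local h (half_pos hε)
  obtain ⟨Φ, hΦ⟩ := exists_orthonormal_coordinates hN he
  obtain ⟨R, g, hR, hg, hg0, hgR⟩ :=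
    exists_graph hm hr (half_pos hε) (by linarith) hρ0 hρ hΦ
  rw [show 2 * (ε / 2) = ε by ring] at hg
  have hgl : ∀ p q, |g p - g q| ≤ ε * dist p q := fun p q => by
    have := hg.dist_le_mul p q
    rwa [Real.dist_eq, Real.coe_toNNReal _ hε.le] at this
  let Λ : (Hyp N × ℝ) ≃ₜ 𝔼 := (shear g hg.continuous).trans
    ((WithLp.homeomorphProd 2 (Hyp N) ℝ).symm.trans
      (Φ.toHomeomorph.trans (Homeomorph.addLeft x₀)))
  have hΛ : ∀ p s, Λ (p, s) = x₀ + Φ (WithLp.toLp 2 (p, g p + s)) := fun p s => rfl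
  have hsub : ∀ p q s t, Λ (p, s) - Λ (q, t) =
      Φ (WithLp.toLp 2 (p - q, (g p + s) - (g q + t))) := by
    intro p q s t
    simp only [hΛ, add_sub_add_left_eq_sub, ← map_sub]
    rfl
  -- All the metric fields of the chart follow from this Pythagorean identity and the ε-Lipschitz
  -- bound on g.
  have hdsq : ∀ p q s t, dist (Λ (p, s)) (Λ (q, t)) ^ 2 =
      dist p q ^ 2 + ((g p + s) - (g q + t)) ^ 2 := by
    intro p q s t
    rw [dist_eq_norm, hsub, Φ.norm_map, WithLp.prod_norm_sq_eq_of_L2, dist_eq_norm]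
    simp
  have hdv : ∀ p q s t, |(g p + s) - (g q + t)| ≤ dist (Λ (p, s)) (Λ (q, t)) := fun p q s t => by
    refine abs_le_of_sq_le_sq ?_ dist_nonneg
    rw [hdsq]
    nlinarith [sq_nonneg (dist p q)]
  have hdh : ∀ p q s t, dist p q ≤ dist (Λ (p, s)) (Λ (q, t)) := fun p q s t => by
    refine (abs_le_of_sq_le_sq' ?_ dist_nonneg).2
    rw [hdsq]
    nlinarith [sq_nonneg ((g p + s) - (g q + t))]
  have hmem : ∀ p s, ‖p‖ < R → |s| < R → (Λ (p, s) ∈ Ω ↔ 0 < s) := by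
    intro p s hp hs
    obtain ⟨h1, h2, h3, h4⟩ := hgR p s hp hs
    rw [hΛ, hρΩ _ h1]
    constructor
    · intro h5
      by_contra h6
      rcases lt_or_eq_of_le (not_lt.1 h6) with h7 | h7
      · linarith [h4 h7]
      · linarith [h3 h7]
    · exact h2
  have hVo : ∀ (p : Hyp N) (s : ℝ), ‖p‖ < R → |s| < R →
      ∀ᶠ y in 𝓝 (Λ (p, s)), ‖(Λ.symm y).1‖ < R ∧ |(Λ.symm y).2| < R := by
    intro p s hp hs
    have hc : Continuous fun y => Λ.symm y := Λ.symm.continuous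
    refine ((hc.fst.norm.tendsto _).eventually (gt_mem_nhds ?_)).and
      ((hc.snd.abs.tendsto _).eventually (gt_mem_nhds ?_)) <;> simpa
  refine ⟨⟨Λ, e, R, he, hR, fun p s => ?_, ?_, hdh, fun p q s t => ?_, fun p q s => ?_, ?_, hmem,
    fun p s hp hs => ?_⟩⟩
  · have h1 : WithLp.toLp 2 (p, g p + s) =
        WithLp.toLp 2 (p, g p + 0) + s • (WithLp.toLp 2 ((0 : Hyp N), (1 : ℝ))) :=
      WithLp.ofLp_injective 2 (Prod.ext (by simp) (by simp))
    rw [hΛ, hΛ, h1, map_add, map_smul, hΦ, add_assoc]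
  · exact (measurePreserving_add_left volume x₀).comp (Φ.measurePreserving.comp
      ((WithLp.volume_preserving_toLp (Hyp N) ℝ).comp (measurePreserving_shear g hg.continuous)))
  · refine (abs_le_of_sq_le_sq' ?_ (by positivity)).2
    rw [hdsq]
    have h1 : |(g p + s) - (g q + t)| ≤ ε * dist p q + |s - t| := by
      calc |(g p + s) - (g q + t)| = |(g p - g q) + (s - t)| := by congr 1; ring
        _ ≤ |g p - g q| + |s - t| := abs_add_le _ _
        _ ≤ _ := by gcongr; exact hgl p q
    have h2 := sq_le_sq' (by linarith [neg_abs_le ((g p + s) - (g q + t))])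
      ((le_abs_self _).trans h1)
    have : 0 ≤ dist p q * (ε * dist p q + |s - t|) := by positivity
    nlinarith
  · have h1 := hdv p q s 0
    have h2 := hdh p q s 0
    have h3 := hgl p q
    have h4 : |s| ≤ |(g p + s) - (g q + 0)| + |g p - g q| := by
      have := abs_sub ((g p + s) - (g q + 0)) (g p - g q)
      rwa [show (g p + s) - (g q + 0) - (g p - g q) = s by ring] at this
    nlinarith
  · rw [hΛ, hg0, add_zero]
    have : Φ (WithLp.toLp 2 ((0 : Hyp N), (0 : ℝ))) = 0 := Φ.map_zero
    rw [this, add_zero]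
  · rcases lt_trichotomy s 0 with h | h | h
    · refine iff_of_false (fun hf => ?_) h.ne
      have h1 : ∀ᶠ y in 𝓝 (Λ (p, s)), y ∉ Ω := by
        have hc : Continuous fun y => (Λ.symm y).2 := Λ.symm.continuous.snd
        have h2 : ∀ᶠ y in 𝓝 (Λ (p, s)), (Λ.symm y).2 < 0 :=
          (hc.tendsto _).eventually (gt_mem_nhds (by simpa using h))
        filter_upwards [hVo p s hp hs, h2] with y hy1 hy2 hyΩ
        have := (hmem _ _ hy1.1 hy1.2).1 (by simpa using hyΩ)
        linarith
      exact mem_closure_iff_frequently.1 (frontier_subset_closure hf) h1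
    · refine iff_of_true ?_ h
      subst h
      rw [hΩ.frontier_eq, Set.mem_sdiff]
      refine ⟨?_, fun h => lt_irrefl _ ((hmem p 0 hp hs).1 h)⟩
      have h1 : Tendsto (fun t : ℝ => Λ (p, t)) (𝓝[>] 0) (𝓝 (Λ (p, 0))) :=
        ((Λ.continuous.comp (by fun_prop : Continuous fun t : ℝ => (p, t))).tendsto 0).mono_left
          nhdsWithin_le_nhds
      refine mem_closure_of_tendsto h1 ?_
      filter_upwards [Ioo_mem_nhdsGT hR] with t ht
      exact (hmem p t hp (by rw [abs_of_pos ht.1]; exact ht.2)).2 ht.1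
    · refine iff_of_false (fun hf => ?_) h.ne'
      rw [hΩ.frontier_eq] at hf
      exact hf.2 ((hmem p s hp hs).2 h)

/-! ### Surface measure in a chart -/

/-- This and the next estimate replace the area formula. The parametrization of the boundary is
(1+ε)-Lipschitz and its inverse is 1-Lipschitz, so (N-1)-dimensional measure is distorted by a
factor between 1 and (1+ε)^(N-1), which disappears as ε → 0. -/
lemma euclideanHausdorffMeasure_image_le {f : Hyp N → 𝔼} {K : ℝ≥0} (hf : LipschitzWith K f)
    (s : Set (Hyp N)) :
    Measure.euclideanHausdorffMeasure (N - 1) (f '' s) ≤ (K : ℝ≥0∞) ^ (N - 1) * volume s := by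
  rw [← EuclideanSpace.euclideanHausdorffMeasure_eq_volume,
    Measure.euclideanHausdorffMeasure_def, Measure.euclideanHausdorffMeasure_def,
    Measure.smul_apply, Measure.smul_apply, mul_smul_comm]
  have := hf.hausdorffMeasure_image_le (d := ((N - 1 : ℕ) : ℝ)) (Nat.cast_nonneg _) s
  rw [ENNReal.rpow_natCast] at this
  gcongr

lemma volume_le_euclideanHausdorffMeasure_image {f : Hyp N → 𝔼} (hf : AntilipschitzWith 1 f)
    (s : Set (Hyp N)) :
    volume s ≤ Measure.euclideanHausdorffMeasure (N - 1) (f '' s) := by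
  rw [← EuclideanSpace.euclideanHausdorffMeasure_eq_volume,
    Measure.euclideanHausdorffMeasure_def, Measure.euclideanHausdorffMeasure_def,
    Measure.smul_apply, Measure.smul_apply]
  have := hf.le_hausdorffMeasure_image (d := ((N - 1 : ℕ) : ℝ)) (Nat.cast_nonneg _) s
  simp only [ENNReal.coe_one, ENNReal.one_rpow, one_mul] at this
  gcongr

namespace GraphChart

variable {Ω : Set (EuclideanSpace ℝ (Fin N))} {x₀ : EuclideanSpace ℝ (Fin N)} {ε : ℝ} (c : GraphChart Ω x₀ ε)

/-- The chart domain. -/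
def dom : Set 𝔼 := c.Λ '' (ball 0 c.R ×ˢ Ioo (-c.R) c.R)

lemma mem_dom {p : Hyp N} {s : ℝ} : c.Λ (p, s) ∈ c.dom ↔ ‖p‖ < c.R ∧ |s| < c.R := by
  rw [dom, c.Λ.injective.mem_set_image]
  simp [abs_lt]

lemma isOpen_dom : IsOpen c.dom := c.Λ.isOpenMap _ (isOpen_ball.prod isOpen_Ioo)

lemma center_mem_dom : x₀ ∈ c.dom := by
  have h := c.mem_dom (p := 0) (s := 0)
  rw [c.center] at h
  exact h.2 (by simp [c.R_pos])

lemma exists_of_mem_dom {x : 𝔼} (hx : x ∈ c.dom) :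
    ∃ p s, ‖p‖ < c.R ∧ |s| < c.R ∧ c.Λ (p, s) = x := by
  obtain ⟨⟨p, s⟩, ⟨hp, hs⟩, rfl⟩ := hx
  exact ⟨p, s, by simpa using hp, abs_lt.2 hs, rfl⟩

/-- The boundary parametrization. -/
def bdry (p : Hyp N) : 𝔼 := c.Λ (p, 0)

lemma continuous_bdry : Continuous c.bdry := c.Λ.continuous.comp (by fun_prop)

lemma lipschitzWith_bdry : LipschitzWith (1 + ε).toNNReal c.bdry := by
  refine LipschitzWith.of_dist_le_mul fun p q => ?_
  have h := c.dist_le p q 0 0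
  rw [sub_self, abs_zero, add_zero] at h
  exact h.trans (mul_le_mul_of_nonneg_right (Real.le_coe_toNNReal _) dist_nonneg)

lemma antilipschitzWith_bdry : AntilipschitzWith 1 c.bdry :=
  AntilipschitzWith.of_le_mul_dist fun p q => by simpa [bdry] using c.le_dist p q 0 0

lemma measurableEmbedding_bdry : MeasurableEmbedding c.bdry :=
  (c.antilipschitzWith_bdry.isClosedEmbedding
    c.lipschitzWith_bdry.uniformContinuous).measurableEmbedding

lemma bdry_mem_frontier {p : Hyp N} (hp : ‖p‖ < c.R) : c.bdry p ∈ frontier Ω :=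
  (c.frontier_iff p 0 hp (by simpa using c.R_pos)).2 rfl

lemma bdry_mem_dom {p : Hyp N} : c.bdry p ∈ c.dom ↔ ‖p‖ < c.R := by
  rw [bdry, c.mem_dom]
  simp [c.R_pos]

lemma inter_dom_frontier (A : Set 𝔼) :
    A ∩ c.dom ∩ frontier Ω = c.bdry '' (c.bdry ⁻¹' A ∩ ball 0 c.R) := by
  ext x
  constructor
  · rintro ⟨⟨hxA, hxd⟩, hxf⟩
    obtain ⟨p, s, hp, hs, rfl⟩ := c.exists_of_mem_dom hxd
    have := (c.frontier_iff p s hp hs).1 hxf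
    subst this
    exact ⟨p, ⟨hxA, by simpa using hp⟩, rfl⟩
  · rintro ⟨p, ⟨hpA, hp⟩, rfl⟩
    have hp' : ‖p‖ < c.R := by simpa using hp
    exact ⟨⟨hpA, c.bdry_mem_dom.2 hp'⟩, c.bdry_mem_frontier hp'⟩

lemma surfaceMeasure_restrict_dom_apply {A : Set 𝔼} (hA : MeasurableSet A) :
    (surfaceMeasure Ω).restrict c.dom A =
      Measure.euclideanHausdorffMeasure (N - 1) (c.bdry '' (c.bdry ⁻¹' A ∩ ball 0 c.R)) := by
  rw [Measure.restrict_apply hA, surfaceMeasure,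
    Measure.restrict_apply (hA.inter c.isOpen_dom.measurableSet), c.inter_dom_frontier]

lemma map_bdry_le :
    (volume.restrict (ball 0 c.R)).map c.bdry ≤ (surfaceMeasure Ω).restrict c.dom := by
  refine Measure.le_iff.2 fun A hA => ?_
  rw [c.surfaceMeasure_restrict_dom_apply hA, c.measurableEmbedding_bdry.map_apply,
    Measure.restrict_apply (c.continuous_bdry.measurable hA)]
  exact volume_le_euclideanHausdorffMeasure_image c.antilipschitzWith_bdry _

lemma le_map_bdry :
    (surfaceMeasure Ω).restrict c.dom ≤
      (ENNReal.ofReal (1 + ε) ^ (N - 1)) • (volume.restrict (ball 0 c.R)).map c.bdry := by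
  refine Measure.le_iff.2 fun A hA => ?_
  rw [c.surfaceMeasure_restrict_dom_apply hA, Measure.smul_apply,
    c.measurableEmbedding_bdry.map_apply,
    Measure.restrict_apply (c.continuous_bdry.measurable hA), smul_eq_mul]
  exact euclideanHausdorffMeasure_image_le (c.lipschitzWith_bdry) _

lemma lintegral_bdry_le (f : 𝔼 → ℝ≥0∞) :
    ∫⁻ p in ball 0 c.R, f (c.bdry p) ≤ ∫⁻ x in c.dom, f x ∂(surfaceMeasure Ω) := by
  rw [← c.measurableEmbedding_bdry.lintegral_map]
  exact lintegral_mono' c.map_bdry_le le_rfl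

lemma lintegral_le_bdry (f : 𝔼 → ℝ≥0∞) :
    ∫⁻ x in c.dom, f x ∂(surfaceMeasure Ω) ≤
      ENNReal.ofReal (1 + ε) ^ (N - 1) * ∫⁻ p in ball 0 c.R, f (c.bdry p) := by
  rw [← c.measurableEmbedding_bdry.lintegral_map, ← smul_eq_mul, ← lintegral_smul_measure]
  exact lintegral_mono' (c.le_map_bdry) le_rfl

lemma ae_of_ae_bdry {P : 𝔼 → Prop}
    (h : ∀ᵐ p ∂(volume.restrict (ball 0 c.R)), P (c.bdry p)) :
    ∀ᵐ x ∂((surfaceMeasure Ω).restrict c.dom), P x := by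
  refine (Measure.absolutelyContinuous_of_le (c.le_map_bdry)).ae_le ?_
  exact Measure.ae_smul_measure (c.measurableEmbedding_bdry.ae_map_iff.2 h) _

/-- The chart with half the size. -/
def half : GraphChart Ω x₀ ε :=
  { c with
    R := c.R / 2
    R_pos := half_pos c.R_pos
    mem_iff := fun p s hp hs => c.mem_iff p s (hp.trans (half_lt_self c.R_pos))
      (hs.trans (half_lt_self c.R_pos))
    frontier_iff := fun p s hp hs => c.frontier_iff p s (hp.trans (half_lt_self c.R_pos))
      (hs.trans (half_lt_self c.R_pos)) }

/-! ### Vertical lines in a chart -/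

lemma hasDerivAt_vertical {w : 𝔼 → ℝ} (hw : ContDiff ℝ 1 w) (p : Hyp N) (t : ℝ) :
    HasDerivAt (fun s => w (c.Λ (p, s))) (fderiv ℝ w (c.Λ (p, t)) c.e) t := by
  have h1 : HasDerivAt (fun s : ℝ => c.Λ (p, s)) c.e t := by
    have h2 : (fun s : ℝ => c.Λ (p, s)) = fun s => c.Λ (p, 0) + s • c.e := by
      ext1 s; exact c.map_add p s
    rw [h2]
    simpa using ((hasDerivAt_id t).smul_const c.e).const_add (c.Λ (p, 0))
  exact ((hw.differentiable (by norm_num) _).hasFDerivAt).comp_hasDerivAt t h1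

lemma enorm_sub_le_lintegral_vertical {w : 𝔼 → ℝ} (hw : ContDiff ℝ 1 w) (p : Hyp N) {s t : ℝ}
    (hst : s ≤ t) : ‖w (c.Λ (p, t)) - w (c.Λ (p, s))‖ₑ ≤
      ∫⁻ τ in Ioc s t, ‖fderiv ℝ w (c.Λ (p, τ))‖ₑ := by
  have hcont : Continuous fun τ => fderiv ℝ w (c.Λ (p, τ)) c.e := by
    have h1 := hw.continuous_fderiv (by norm_num)
    have h2 : Continuous fun τ : ℝ => c.Λ (p, τ) := c.Λ.continuous.comp (by fun_prop)
    exact (h1.comp h2).clm_apply continuous_const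
  have h := intervalIntegral.integral_eq_sub_of_hasDerivAt
    (fun τ _ => c.hasDerivAt_vertical hw p τ) (hcont.intervalIntegrable s t)
  rw [← h, intervalIntegral.integral_of_le hst]
  refine (enorm_integral_le_lintegral_enorm _).trans (lintegral_mono fun τ => ?_)
  rw [enorm_le_iff_norm_le]
  simpa [c.norm_e] using (fderiv ℝ w (c.Λ (p, τ))).le_opNorm c.e

lemma lintegral_comp {A : Set (Hyp N × ℝ)} (f : 𝔼 → ℝ≥0∞) :
    ∫⁻ z in A, f (c.Λ z) = ∫⁻ x in c.Λ '' A, f x :=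
  c.measurePreserving.setLIntegral_comp_emb c.Λ.measurableEmbedding f A

lemma image_subset {A : Set (Hyp N)} {B : Set ℝ} (hA : A ⊆ ball 0 c.R) (hB : B ⊆ Ioo 0 c.R) :
    c.Λ '' (A ×ˢ B) ⊆ Ω := by
  rintro _ ⟨⟨p, s⟩, ⟨hp, hs⟩, rfl⟩
  have hp' := hA hp
  have hs' := hB hs
  exact (c.mem_iff p s (by simpa using hp') (by rw [abs_of_pos hs'.1]; exact hs'.2)).2 hs'.1

end GraphChart

/-! ### Traces -/

/-- `a` is the trace of `u` at `x` in the strong (Lebesgue point) sense. -/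
def HasTrace (Ω : Set 𝔼) (u : 𝔼 → ℝ) (x : 𝔼) (a : ℝ) : Prop :=
  Tendsto (fun r => (∫⁻ y in Ω ∩ ball x r, ‖u y - a‖ₑ) / volume (Ω ∩ ball x r)) (𝓝[>] 0) (𝓝 0)

lemma volume_inter_ball_ne_zero {Ω : Set 𝔼} (hΩ : IsOpen Ω) {x : 𝔼} (hx : x ∈ closure Ω) {r : ℝ}
    (hr : 0 < r) : volume (Ω ∩ ball x r) ≠ 0 := by
  refine ((hΩ.inter isOpen_ball).measure_pos volume ?_).ne'
  obtain ⟨y, hy, hyx⟩ := Metric.mem_closure_iff.1 hx r hr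
  exact ⟨y, hy, by rwa [mem_ball, dist_comm]⟩

lemma volume_inter_ball_ne_top (Ω : Set 𝔼) (x : 𝔼) (r : ℝ) : volume (Ω ∩ ball x r) ≠ ⊤ :=
  ((measure_mono inter_subset_right).trans_lt measure_ball_lt_top).ne

lemma HasTrace.tendsto_average {Ω : Set 𝔼} (hΩ : IsOpen Ω) {u : 𝔼 → ℝ} (hu : IntegrableOn u Ω)
    {x : 𝔼} (hx : x ∈ closure Ω) {a : ℝ} (h : HasTrace Ω u x a) :
    Tendsto (fun r => ⨍ y in Ω ∩ ball x r, u y) (𝓝[>] 0) (𝓝 a) := by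
  rw [tendsto_iff_edist_tendsto_0]
  refine tendsto_of_tendsto_of_tendsto_of_le_of_le' tendsto_const_nhds h
    (Eventually.of_forall fun r => bot_le) ?_
  filter_upwards [self_mem_nhdsWithin] with r hr
  have h0 := volume_inter_ball_ne_zero hΩ hx hr
  have ht := volume_inter_ball_ne_top Ω x r
  have hui : IntegrableOn u (Ω ∩ ball x r) := hu.mono_set inter_subset_left
  have hne : volume.real (Ω ∩ ball x r) ≠ 0 := (ENNReal.toReal_pos h0 ht).ne'
  have hconst : IntegrableOn (fun _ : 𝔼 => a) (Ω ∩ ball x r) := integrableOn_const ht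
  have : (⨍ y in Ω ∩ ball x r, u y) - a =
      (volume.real (Ω ∩ ball x r))⁻¹ * ∫ y in Ω ∩ ball x r, (u y - a) := by
    rw [setAverage_eq, integral_sub hui hconst, setIntegral_const, smul_eq_mul, smul_eq_mul,
      mul_sub, ← mul_assoc, inv_mul_cancel₀ hne, one_mul]
  rw [edist_eq_enorm_sub, this, enorm_mul, ENNReal.div_eq_inv_mul]
  refine mul_le_mul' (le_of_eq ?_) (enorm_integral_le_lintegral_enorm _)
  rw [enorm_inv hne, Real.enorm_of_nonneg measureReal_nonneg, ofReal_measureReal ht]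

lemma HasTrace.trace_eq {Ω : Set 𝔼} (hΩ : IsOpen Ω) {u : 𝔼 → ℝ} (hu : IntegrableOn u Ω)
    {x : 𝔼} (hx : x ∈ closure Ω) {a : ℝ} (h : HasTrace Ω u x a) : trace Ω u x = a :=
  (h.tendsto_average hΩ hu hx).limUnder_eq

lemma HasTrace.of_enorm_sub_le {Ω : Set 𝔼} {u v : 𝔼 → ℝ} {x : 𝔼} {a b : ℝ}
    (h : HasTrace Ω u x a) {K : ℝ≥0∞} (hK : K ≠ ⊤) (hv : ∀ y, ‖v y - b‖ₑ ≤ K * ‖u y - a‖ₑ) :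
    HasTrace Ω v x b := by
  have h' := ENNReal.Tendsto.const_mul h (Or.inr hK)
  rw [mul_zero] at h'
  refine tendsto_of_tendsto_of_tendsto_of_le_of_le tendsto_const_nhds h'
    (fun r => bot_le) fun r => ?_
  dsimp only
  rw [← mul_div_assoc, ← lintegral_const_mul' _ _ hK]
  gcongr
  exact hv _

lemma HasTrace.comp {Ω : Set 𝔼} {u : 𝔼 → ℝ} {x : 𝔼} {a : ℝ} (h : HasTrace Ω u x a) {f : ℝ → ℝ}
    (hf : LipschitzWith 1 f) : HasTrace Ω (fun y => f (u y)) x (f a) :=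
  h.of_enorm_sub_le ENNReal.one_ne_top fun y => by
    have := hf (u y) a
    rwa [edist_eq_enorm_sub, edist_eq_enorm_sub, ENNReal.coe_one] at this

lemma HasTrace.const_mul {Ω : Set 𝔼} {u : 𝔼 → ℝ} {x : 𝔼} {a : ℝ} (h : HasTrace Ω u x a) (t : ℝ) :
    HasTrace Ω (fun y => t * u y) x (t * a) :=
  h.of_enorm_sub_le (enorm_ne_top (x := t)) fun y => by rw [← mul_sub, enorm_mul]

/-! ### Existence of traces at C¹ boundary points -/

namespace GraphChart

variable {Ω : Set (EuclideanSpace ℝ (Fin N))} {x₀ : EuclideanSpace ℝ (Fin N)} {ε : ℝ}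
  (c : GraphChart Ω x₀ ε)

lemma inter_ball_subset (hε : 0 ≤ ε) (hε1 : ε ≤ 1) {p : Hyp N} {r : ℝ}
    (hr : ‖p‖ + 2 * r ≤ c.R) (hr0 : 0 < r) :
    Ω ∩ ball (c.bdry p) r ⊆ c.Λ '' (closedBall p r ×ˢ Ioo 0 (2 * r)) := by
  rintro x ⟨hxΩ, hx⟩
  obtain ⟨⟨q, t⟩, rfl⟩ := c.Λ.surjective x
  have hd : dist (c.Λ (q, t)) (c.Λ (p, 0)) < r := hx
  have h1 : dist q p < r := (c.le_dist q p t 0).trans_lt hd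
  have h2 : |t| < 2 * r := by
    have := c.height_le q p t
    nlinarith [dist_nonneg (x := c.Λ (q, t)) (y := c.Λ (p, 0))]
  have h3 : ‖q‖ < c.R := by
    have := norm_le_norm_add_norm_sub' q p
    rw [← dist_eq_norm] at this
    linarith
  have h4 : 0 < t := (c.mem_iff q t h3 (by linarith [norm_nonneg p])).1 hxΩ
  exact ⟨(q, t), ⟨h1.le, h4, (le_abs_self t).trans_lt h2⟩, rfl⟩

lemma image_subset_inter_ball (hε1 : ε ≤ 1) {p : Hyp N} {r : ℝ}
    (hr : ‖p‖ + 2 * r ≤ c.R) :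
    c.Λ '' (closedBall p (4⁻¹ * r) ×ˢ Ioo 0 (4⁻¹ * r)) ⊆ Ω ∩ ball (c.bdry p) r := by
  rintro _ ⟨⟨q, t⟩, ⟨hq, ht⟩, rfl⟩
  have hq' : dist q p ≤ 4⁻¹ * r := hq
  have ht0 : 0 < t := ht.1
  have ht1 : t < 4⁻¹ * r := ht.2
  have h3 : ‖q‖ < c.R := by
    have := norm_le_norm_add_norm_sub' q p
    rw [← dist_eq_norm] at this
    linarith
  refine ⟨(c.mem_iff q t h3 (by rw [abs_of_pos ht0]; linarith [norm_nonneg p])).2 ht0, ?_⟩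
  have := c.dist_le q p t 0
  rw [sub_zero, abs_of_pos ht0] at this
  rw [mem_ball, bdry]
  nlinarith [dist_nonneg (x := q) (y := p)]

/-- Ω ∩ B(x, r) contains a chart cylinder of radius and height r/4, because such points are at
distance less than 2·r/4 + r/4 from x when ε ≤ 1. Its volume is therefore at least a fixed fraction
of r|B_r|, so averages over Ω ∩ B(x, r) are controlled by normalized integrals over the cylinder of
height 2r containing it. -/
lemma le_volume_inter_ball (hε1 : ε ≤ 1) {p : Hyp N} {r : ℝ} (hr : ‖p‖ + 2 * r ≤ c.R)
    (hr0 : 0 < r) :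
    ENNReal.ofReal r * volume (closedBall p r) ≤
      ENNReal.ofReal (4 ^ (N - 1) * 4) * volume (Ω ∩ ball (c.bdry p) r) := by
  have h1 : volume (c.Λ '' (closedBall p (4⁻¹ * r) ×ˢ Ioo 0 (4⁻¹ * r))) =
      volume (closedBall p (4⁻¹ * r)) * ENNReal.ofReal (4⁻¹ * r) := by
    have := c.measurePreserving.measure_preimage_emb c.Λ.measurableEmbedding
      (c.Λ '' (closedBall p (4⁻¹ * r) ×ˢ Ioo 0 (4⁻¹ * r)))
    rw [preimage_image_eq _ c.Λ.injective] at this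
    rw [← this, Measure.volume_eq_prod, Measure.prod_prod, Real.volume_Ioo, sub_zero]
  have h2 : volume (closedBall p (4⁻¹ * r)) =
      ENNReal.ofReal ((4⁻¹ : ℝ) ^ (N - 1)) * volume (closedBall p r) := by
    have := Measure.addHaar_closedBall_mul_of_pos (volume : Measure (Hyp N)) p
      (r := 4⁻¹) (by norm_num) r
    rw [finrank_euclideanSpace_fin] at this
    rw [this, Measure.addHaar_closedBall_center volume p r]
  calc ENNReal.ofReal r * volume (closedBall p r)
      = ENNReal.ofReal (4 ^ (N - 1) * 4) *
          (volume (closedBall p (4⁻¹ * r)) * ENNReal.ofReal (4⁻¹ * r)) := by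
        rw [h2, mul_comm (ENNReal.ofReal ((4⁻¹ : ℝ) ^ (N - 1))), mul_assoc,
          ← ENNReal.ofReal_mul (by positivity), mul_left_comm, ← ENNReal.ofReal_mul (by positivity),
          mul_comm]
        congr 2
        rw [inv_pow]
        field_simp
    _ ≤ _ := by
        rw [← h1]
        gcongr
        exact c.image_subset_inter_ball hε1 hr

/-- The function `u` has a trace in the chart, and its deviation from the trace is controlled on
vertical segments. -/
def IsTraced (u : 𝔼 → ℝ) : Prop :=
  ∃ V : Hyp N → ℝ≥0∞, Measurable V ∧ ∫⁻ p in ball 0 c.R, V p ≠ ⊤ ∧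
    ∀ᵐ p ∂(volume.restrict (ball 0 c.R)),
      HasTrace Ω u (c.bdry p) (trace Ω u (c.bdry p)) ∧
      Tendsto (fun h => (∫⁻ s in Ioo 0 h, ‖u (c.Λ (p, s)) - trace Ω u (c.bdry p)‖ₑ) /
        ENNReal.ofReal h) (𝓝[>] 0) (𝓝 0) ∧
      ∀ h ≤ c.R, ∫⁻ s in Ioo 0 h, ‖u (c.Λ (p, s)) - trace Ω u (c.bdry p)‖ₑ ≤
        V p * ENNReal.ofReal h

lemma ae_comp {A : Set (Hyp N × ℝ)} {P : 𝔼 → Prop}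
    (h : ∀ᵐ x ∂(volume.restrict (c.Λ '' A)), P x) : ∀ᵐ z ∂(volume.restrict A), P (c.Λ z) :=
  (c.measurePreserving.restrict_image_emb c.Λ.measurableEmbedding A).quasiMeasurePreserving.ae h

lemma integrableOn_comp {A : Set (Hyp N × ℝ)} {u : 𝔼 → ℝ} (h : IntegrableOn u (c.Λ '' A)) :
    IntegrableOn (fun z => u (c.Λ z)) A :=
  (c.measurePreserving.restrict_image_emb c.Λ.measurableEmbedding A).integrable_comp_of_integrable h

/-- The smooth approximations have gradient bounds only on compact subsets of Ω. In the halved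
chart, the closed cylinder between heights δ and R/2 is such a subset, so the flat theory applies;
the comparison of half balls with cylinders then identifies the vertical limit with the trace. -/
lemma isTraced_half (hΩ : IsOpen Ω) (hε : 0 ≤ ε) (hε1 : ε ≤ 1) {u : 𝔼 → ℝ} (hu : MemBV Ω u) :
    c.half.IsTraced u := by
  have hR : c.half.R = c.R / 2 := rfl
  have hRp := c.R_pos
  have hsub : c.Λ '' (ball 0 (c.R / 2) ×ˢ Ioo 0 (c.R / 2)) ⊆ Ω :=
    c.image_subset (ball_subset_ball (by linarith)) (Ioo_subset_Ioo_right (by linarith))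
  have hint : IntegrableOn (fun z => u (c.Λ z)) (ball 0 (c.R / 2) ×ˢ Ioo 0 (c.R / 2)) :=
    c.integrableOn_comp (hu.1.mono_set hsub)
  obtain ⟨w, hw, hlim, hbd⟩ := exists_contDiff_approx hΩ hu.1
  have hw1 : ∀ k, ContDiff ℝ 1 (w k) := fun k => (hw k).of_le (by simp)
  obtain ⟨g, V, hV, hVT, hg⟩ := exists_vertical_limit (Q := ball (0 : Hyp N) (c.R / 2))
    measurableSet_ball (H := c.R / 2) (by linarith) (f := fun z => u (c.Λ z))
    (w := fun k z => w k (c.Λ z)) (γ := fun k z => ‖fderiv ℝ (w k) (c.Λ z)‖ₑ)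
    (fun k => (((hw1 k).continuous_fderiv (by norm_num)).comp c.Λ.continuous).enorm.measurable)
    (fun k p _ s t _ hst _ => c.enorm_sub_le_lintegral_vertical (hw1 k) p hst)
    (c.ae_comp (ae_restrict_of_ae_restrict_of_subset hsub hlim)) hu.2.ne
    (fun δ hδ => by
      have hK : IsCompact (c.Λ '' (closedBall 0 (c.R / 2) ×ˢ Icc δ (c.R / 2))) :=
        ((isCompact_closedBall _ _).prod isCompact_Icc).image c.Λ.continuous
      have hKΩ : c.Λ '' (closedBall 0 (c.R / 2) ×ˢ Icc δ (c.R / 2)) ⊆ Ω :=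
        c.image_subset (closedBall_subset_ball (by linarith))
          fun s hs => ⟨hδ.trans_le hs.1, hs.2.trans_lt (by linarith)⟩
      filter_upwards [hbd _ hK hKΩ] with k hk
      refine le_trans ?_ hk
      rw [c.lintegral_comp (fun x => ‖fderiv ℝ (w k) x‖ₑ)]
      exact lintegral_mono_set (image_mono (prod_mono ball_subset_closedBall Ioo_subset_Icc_self)))
  refine ⟨V, hV, hVT, ?_⟩
  have hball := ae_tendsto_ball_of_vertical_limit isOpen_ball (by linarith) hint hVT hg
  filter_upwards [hg, hball, ae_restrict_mem measurableSet_ball] with p hp hpb hpR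
  have hpR' : ‖p‖ < c.R / 2 := by simpa [hR] using hpR
  have htr : HasTrace Ω u (c.bdry p) (g p) := by
    have hK : ENNReal.ofReal (4 ^ (N - 1) * 4) ≠ ⊤ := ENNReal.ofReal_ne_top
    have h' := ENNReal.Tendsto.const_mul hpb (Or.inr hK)
    rw [mul_zero] at h'
    refine tendsto_of_tendsto_of_tendsto_of_le_of_le' tendsto_const_nhds h'
      (Eventually.of_forall fun r => bot_le) ?_
    filter_upwards [Ioo_mem_nhdsGT (show 0 < c.R / 4 by linarith)] with r hr
    have hr' : ‖p‖ + 2 * r ≤ c.R := by linarith [hr.2]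
    have hfr : c.bdry p ∈ closure Ω :=
      frontier_subset_closure (c.bdry_mem_frontier (by linarith))
    have h0 := volume_inter_ball_ne_zero hΩ hfr hr.1
    have ht := volume_inter_ball_ne_top Ω (c.bdry p) r
    refine ENNReal.div_le_of_le_mul ?_
    have hle : ∫⁻ y in Ω ∩ ball (c.bdry p) r, ‖u y - g p‖ₑ ≤
        ∫⁻ z in closedBall p r ×ˢ Ioo 0 (2 * r), ‖u (c.Λ z) - g p‖ₑ := by
      rw [c.lintegral_comp (fun x => ‖u x - g p‖ₑ)]
      exact lintegral_mono_set (c.inter_ball_subset hε hε1 hr' hr.1)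
    refine hle.trans ?_
    have hv0 : ENNReal.ofReal r * volume (closedBall p r) ≠ 0 :=
      mul_ne_zero (by simpa using hr.1) (measure_closedBall_pos _ _ hr.1).ne'
    have hvt : ENNReal.ofReal r * volume (closedBall p r) ≠ ⊤ :=
      ENNReal.mul_ne_top ENNReal.ofReal_ne_top measure_closedBall_lt_top.ne
    calc _ = (∫⁻ z in closedBall p r ×ˢ Ioo 0 (2 * r), ‖u (c.Λ z) - g p‖ₑ) /
            (ENNReal.ofReal r * volume (closedBall p r)) *
            (ENNReal.ofReal r * volume (closedBall p r)) :=
          (ENNReal.div_mul_cancel hv0 hvt).symm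
      _ ≤ _ := mul_le_mul_right (c.le_volume_inter_ball hε1 hr' hr.1) _
      _ = _ := by ring
  have hcl : c.bdry p ∈ closure Ω := frontier_subset_closure (c.bdry_mem_frontier (by linarith))
  have heq := htr.trace_eq hΩ hu.1 hcl
  change HasTrace Ω u (c.bdry p) (trace Ω u (c.bdry p)) ∧
    Tendsto (fun h => (∫⁻ s in Ioo 0 h, ‖u (c.Λ (p, s)) - trace Ω u (c.bdry p)‖ₑ) /
        ENNReal.ofReal h) (𝓝[>] 0) (𝓝 0) ∧
    ∀ h ≤ c.R / 2, ∫⁻ s in Ioo 0 h, ‖u (c.Λ (p, s)) - trace Ω u (c.bdry p)‖ₑ ≤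
        V p * ENNReal.ofReal h
  rw [heq]
  exact ⟨htr, hp⟩

end GraphChart

lemma exists_graphChart_isTraced (hN : 1 ≤ N) {Ω : Set 𝔼} (hΩ : IsOpen Ω) {x₀ : 𝔼}
    (h : IsC1BoundaryPoint Ω x₀) {ε : ℝ} (hε : 0 < ε) (hε1 : ε ≤ 1) :
    ∃ c : GraphChart Ω x₀ ε, ∀ u, MemBV Ω u → c.IsTraced u := by
  obtain ⟨c⟩ := nonempty_graphChart hN hΩ h hε hε1
  exact ⟨c.half, fun u hu => c.isTraced_half hΩ hε.le hε1 hu⟩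

/-- A locally null set is null, so the charts settle the C¹ part of the boundary; the rest has zero
area. -/
lemma ae_hasTrace (hN : 1 ≤ N) {Ω : Set 𝔼} (hΩ : IsPiecewiseC1Domain Ω) {u : 𝔼 → ℝ}
    (hu : MemBV Ω u) : ∀ᵐ x ∂(surfaceMeasure Ω), HasTrace Ω u x (trace Ω u x) := by
  set A : Set 𝔼 := {x | ¬ HasTrace Ω u x (trace Ω u x)}
  have h0 : surfaceMeasure Ω (A ∩ {x | IsC1BoundaryPoint Ω x}) = 0 := by
    refine measure_null_of_locally_null _ fun x hx => ?_
    obtain ⟨c, hc⟩ := exists_graphChart_isTraced hN hΩ.isOpen hx.2 one_pos le_rfl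
    refine ⟨A ∩ {x | IsC1BoundaryPoint Ω x} ∩ c.dom,
      inter_mem_nhdsWithin _ (c.isOpen_dom.mem_nhds c.center_mem_dom), ?_⟩
    obtain ⟨V, -, -, hV⟩ := hc u hu
    have := c.ae_of_ae_bdry (P := fun x => HasTrace Ω u x (trace Ω u x)) (hV.mono fun p hp => hp.1)
    rw [ae_restrict_iff' c.isOpen_dom.measurableSet] at this
    exact measure_mono_null (fun y hy (h : y ∈ c.dom → _) => hy.1.1 (h hy.2)) (ae_iff.1 this)
  refine measure_mono_null (t := A ∩ {x | IsC1BoundaryPoint Ω x} ∪ {x | ¬ IsC1BoundaryPoint Ω x})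
    (fun x hx => ?_) (measure_union_null h0 hΩ.ae_c1)
  by_cases h : IsC1BoundaryPoint Ω x
  exacts [Or.inl ⟨hx, h⟩, Or.inr h]

lemma measurable_setIntegral_ball {Ω : Set 𝔼} (hΩ : MeasurableSet Ω) {u : 𝔼 → ℝ}
    (hu : IntegrableOn u Ω) (r : ℝ) : Measurable fun x => ∫ y in Ω ∩ ball x r, u y := by
  have hi : Integrable (Ω.indicator u) := hu.integrable_indicator hΩ
  obtain ⟨v, hv, hvu⟩ := hi.aestronglyMeasurable
  have : ∀ x, ∫ y in Ω ∩ ball x r, u y = ∫ y, ({z : 𝔼 × 𝔼 | dist z.2 z.1 < r}.indicator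
      (fun z => v z.2)) (x, y) := by
    intro x
    rw [inter_comm, ← setIntegral_indicator hΩ, ← integral_indicator measurableSet_ball]
    refine integral_congr_ae (hvu.mono fun y hy => ?_)
    by_cases hyx : dist y x < r
    · simp only [indicator, mem_ball, hyx, mem_ofPred_eq, if_true]
      simpa [indicator] using hy
    · simp [indicator, hyx]
  simp_rw [this]
  refine (StronglyMeasurable.integral_prod_right ?_).measurable
  exact (hv.comp_measurable measurable_snd).indicator
    (measurableSet_lt (measurable_snd.dist measurable_fst) measurable_const)

lemma aemeasurable_trace (hN : 1 ≤ N) {Ω : Set 𝔼} (hΩ : IsPiecewiseC1Domain Ω) {u : 𝔼 → ℝ}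
    (hu : MemBV Ω u) : AEMeasurable (trace Ω u) (surfaceMeasure Ω) := by
  have hone : IntegrableOn (fun _ : 𝔼 => (1 : ℝ)) Ω :=
    integrableOn_const hΩ.isBounded.measure_lt_top.ne
  have hm : ∀ n : ℕ, Measurable fun x => ⨍ y in Ω ∩ ball x (1 / ((n : ℝ) + 1)), u y := by
    intro n
    have h1 := measurable_setIntegral_ball hΩ.isOpen.measurableSet hu.1 (1 / ((n : ℝ) + 1))
    have h2 := measurable_setIntegral_ball hΩ.isOpen.measurableSet hone (1 / ((n : ℝ) + 1))
    simp only [setIntegral_const, smul_eq_mul, mul_one] at h2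
    simp only [setAverage_eq, smul_eq_mul]
    exact h2.inv.mul h1
  refine aemeasurable_of_tendsto_metrizable_ae atTop (fun n => (hm n).aemeasurable) ?_
  have hfr : ∀ᵐ x ∂(surfaceMeasure Ω), x ∈ frontier Ω :=
    ae_restrict_mem isClosed_frontier.measurableSet
  filter_upwards [ae_hasTrace hN hΩ hu, hfr] with x hx hxf
  refine (hx.tendsto_average hΩ.isOpen hu.1 (frontier_subset_closure hxf)).comp
    (tendsto_nhdsWithin_iff.2 ⟨tendsto_one_div_add_atTop_nhds_zero_nat, ?_⟩)
  exact Eventually.of_forall fun n => by simp only [mem_Ioi]; positivity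

/-! ### Partitions of unity near the boundary -/

/-- The same ρ serves nearby boundary points y. If ρ(y) > 0, points of Ω could not accumulate at y;
if ρ(y) < 0, y would lie in the open set Ω. Hence the singular part of the boundary is closed. -/
lemma IsC1BoundaryPoint.eventually {Ω : Set 𝔼} (hΩ : IsOpen Ω) {x : 𝔼}
    (h : IsC1BoundaryPoint Ω x) : ∀ᶠ y in 𝓝 x, y ∈ frontier Ω → IsC1BoundaryPoint Ω y := by
  obtain ⟨ρ, hρ, -, hd, hρΩ⟩ := h
  have h1 : ∀ᶠ y in 𝓝 x, ContDiffAt ℝ 1 ρ y := hρ.eventually (by simp)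
  have h2 : ∀ᶠ y in 𝓝 x, fderiv ℝ ρ y ≠ 0 :=
    ((hρ.fderiv_right (m := 0) (by norm_num)).continuousAt).eventually_ne hd
  filter_upwards [h1, h2, eventually_eventually_nhds.2 hρΩ] with y hy1 hy2 hy3 hyf
  refine ⟨ρ, hy1, le_antisymm ?_ ?_, hy2, hy3⟩
  · have hyc := frontier_subset_closure hyf
    by_contra! hpos
    obtain ⟨z, hz, hzΩ⟩ := mem_closure_iff_frequently.1 hyc |>.and_eventually
      (hy3.and (hy1.continuousAt.eventually (lt_mem_nhds hpos))) |>.exists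
    exact absurd (hzΩ.1.1 hz) (not_lt.2 hzΩ.2.le)
  · by_contra! hneg
    have : y ∈ Ω := hy3.self_of_nhds.2 hneg
    rw [hΩ.frontier_eq] at hyf
    exact hyf.2 this

/-- A smooth partition of unity near a compact part `K` of the boundary, subordinate to charts. -/
structure BoundaryPartition (Ω K : Set 𝔼) (ε : ℝ) where
  /-- The index set. -/
  ι : Type
  /-- The index set is finite. -/
  [fin : Fintype ι]
  /-- The centers of the charts. -/
  x : ι → 𝔼
  /-- The charts. -/
  c : ∀ i, GraphChart Ω (x i) ε
  /-- The functions of the partition. -/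
  ζ : ι → 𝔼 → ℝ
  isTraced : ∀ i u, MemBV Ω u → (c i).IsTraced u
  contDiff : ∀ i, ContDiff ℝ 1 (ζ i)
  hasCompactSupport : ∀ i, HasCompactSupport (ζ i)
  tsupport_subset : ∀ i, tsupport (ζ i) ⊆ (c i).dom
  nonneg : ∀ i y, 0 ≤ ζ i y
  sum_le_one : ∀ y, ∑ i, ζ i y ≤ 1
  /-- The region where the functions add up to one. -/
  W : Set 𝔼
  isOpen_W : IsOpen W
  subset_W : K ⊆ W
  sum_eq_one : ∀ y ∈ W, ∑ i, ζ i y = 1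

attribute [instance] BoundaryPartition.fin

lemma BoundaryPartition.mem_Icc {Ω K : Set 𝔼} {ε : ℝ} (P : BoundaryPartition Ω K ε) (i : P.ι)
    (y : 𝔼) : P.ζ i y ∈ Icc (0 : ℝ) 1 :=
  ⟨P.nonneg i y, (Finset.single_le_sum (f := fun j => P.ζ j y) (fun j _ => P.nonneg j y)
    (Finset.mem_univ i)).trans (P.sum_le_one y)⟩

lemma GraphChart.isBounded_dom {Ω : Set 𝔼} {x₀ : 𝔼} {ε : ℝ} (c : GraphChart Ω x₀ ε) :
    Bornology.IsBounded c.dom :=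
  (((isCompact_closedBall (0 : Hyp N) c.R).prod (isCompact_Icc (a := -c.R) (b := c.R))).image
    c.Λ.continuous).isBounded.subset
      (image_mono (prod_mono ball_subset_closedBall Ioo_subset_Icc_self))

/-- The partition of unity is built on a compact neighbourhood L of K and not on K alone. The
functions thus add up to one on the open set `W`, which also covers the nearby interior points of a
thin layer. -/
lemma nonempty_boundaryPartition (hN : 1 ≤ N) {Ω : Set 𝔼} (hΩ : IsOpen Ω) {K : Set 𝔼}
    (hK : IsCompact K) (hKc : ∀ x ∈ K, IsC1BoundaryPoint Ω x) {ε : ℝ} (hε : 0 < ε) (hε1 : ε ≤ 1) :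
    Nonempty (BoundaryPartition Ω K ε) := by
  choose c hc using fun x hx => exists_graphChart_isTraced hN hΩ (hKc x hx) hε hε1
  have hcover : K ⊆ ⋃ x : K, (c x x.2).dom := fun x hx =>
    mem_iUnion.2 ⟨⟨x, hx⟩, (c x hx).center_mem_dom⟩
  obtain ⟨t, ht⟩ := hK.elim_finite_subcover _ (fun x : K => (c x x.2).isOpen_dom) hcover
  have ht' : K ⊆ ⋃ i : t, (c i.1 i.1.2).dom := by
    refine ht.trans fun y hy => ?_
    obtain ⟨i, hi, hy⟩ := mem_iUnion₂.1 hy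
    exact mem_iUnion.2 ⟨⟨i, hi⟩, hy⟩
  obtain ⟨L, hL, hKL, hLU⟩ := exists_compact_between hK
    (isOpen_iUnion fun i : t => (c i.1 i.1.2).isOpen_dom) ht'
  obtain ⟨f, hf⟩ := SmoothPartitionOfUnity.exists_isSubordinate (modelWithCornersSelf ℝ 𝔼)
    hL.isClosed (fun i : t => (c i.1 i.1.2).dom) (fun i => (c i.1 i.1.2).isOpen_dom) hLU
  exact ⟨{
    ι := t
    x := fun i => i.1
    c := fun i => c i.1 i.1.2
    ζ := fun i => f i
    isTraced := fun i u hu => hc _ i.1.2 u hu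
    contDiff := fun i => ((f i).contMDiff.contDiff).of_le (by simp)
    hasCompactSupport := fun i => (c i.1 i.1.2).isBounded_dom.isCompact_closure.of_isClosed_subset
      (isClosed_tsupport _) ((hf i).trans subset_closure)
    tsupport_subset := fun i => hf i
    nonneg := fun i y => f.nonneg i y
    sum_le_one := fun y => by
      rw [← finsum_eq_sum_of_fintype]; exact f.sum_le_one y
    W := interior L
    isOpen_W := isOpen_interior
    subset_W := hKL
    sum_eq_one := fun y hy => by
      rw [← finsum_eq_sum_of_fintype]; exact f.sum_eq_one (interior_subset hy) }⟩

/-! ### Averages over vertical strips -/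

lemma tendsto_of_le_add {α : Type*} {l : Filter α} {A D : α → ℝ≥0∞} {a : ℝ≥0∞} (ha : a ≠ ⊤)
    (h1 : ∀ᶠ x in l, A x ≤ a + D x) (h2 : ∀ᶠ x in l, a ≤ A x + D x) (hD : Tendsto D l (𝓝 0)) :
    Tendsto A l (𝓝 a) := by
  refine tendsto_of_tendsto_of_tendsto_of_le_of_le' (g := fun x => a - D x)
    (h := fun x => a + D x) ?_ ?_ (h2.mono fun x hx => tsub_le_iff_right.2 hx) h1
  · simpa using ENNReal.Tendsto.sub (tendsto_const_nhds (x := a)) hD (Or.inl ha)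
  · simpa using (tendsto_const_nhds (x := a)).add hD

lemma tendsto_lintegral_Ioo_div {φ : ℝ → ℝ≥0∞} (hφ : Tendsto φ (𝓝[>] 0) (𝓝 0)) :
    Tendsto (fun h => (∫⁻ s in Ioo 0 h, φ s) / ENNReal.ofReal h) (𝓝[>] 0) (𝓝 0) := by
  rw [ENNReal.tendsto_nhds_zero] at hφ ⊢
  intro δ hδ
  obtain ⟨h₀, hh₀, hφ'⟩ := mem_nhdsGT_iff_exists_Ioo_subset.1 (hφ δ hδ)
  filter_upwards [Ioo_mem_nhdsGT hh₀] with h hh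
  refine ENNReal.div_le_of_le_mul ?_
  calc ∫⁻ s in Ioo 0 h, φ s ≤ ∫⁻ _ in Ioo 0 h, δ :=
        setLIntegral_mono' measurableSet_Ioo fun s hs => hφ' ⟨hs.1, hs.2.trans hh.2⟩
    _ = _ := by rw [setLIntegral_const, Real.volume_Ioo, sub_zero]

lemma lintegral_enorm_le_add {α E : Type*} [MeasurableSpace α] [NormedAddCommGroup E]
    [MeasurableSpace E] [OpensMeasurableSpace E] {μ : Measure α} {f g : α → E}
    (hg : AEMeasurable g μ) :
    ∫⁻ x, ‖f x‖ₑ ∂μ ≤ ∫⁻ x, ‖g x‖ₑ ∂μ + ∫⁻ x, ‖f x - g x‖ₑ ∂μ := by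
  rw [← lintegral_add_left' hg.enorm]
  refine lintegral_mono fun x => ?_
  calc ‖f x‖ₑ = ‖g x + (f x - g x)‖ₑ := by rw [add_sub_cancel]
    _ ≤ _ := enorm_add_le _ _

lemma lintegral_enorm_sub_comm {α : Type*} [MeasurableSpace α] {μ : Measure α} (f g : α → ℝ) :
    ∫⁻ x, ‖f x - g x‖ₑ ∂μ = ∫⁻ x, ‖g x - f x‖ₑ ∂μ := by
  simp_rw [← enorm_neg (f _ - g _), neg_sub]

namespace GraphChart

variable {Ω : Set (EuclideanSpace ℝ (Fin N))} {x₀ : EuclideanSpace ℝ (Fin N)} {ε : ℝ}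
  (c : GraphChart Ω x₀ ε)

/-- The strip of height `h` in the chart. -/
def strip (h : ℝ) : Set 𝔼 := c.Λ '' (ball 0 c.R ×ˢ Ioo 0 h)

lemma measurableSet_strip (h : ℝ) : MeasurableSet (c.strip h) :=
  (c.Λ.isOpenMap _ (isOpen_ball.prod isOpen_Ioo)).measurableSet

lemma strip_subset {h : ℝ} (hh : h ≤ c.R) : c.strip h ⊆ Ω :=
  c.image_subset Subset.rfl (Ioo_subset_Ioo_right hh)

lemma lintegral_strip {h : ℝ} {f : 𝔼 → ℝ≥0∞}
    (hf : AEMeasurable f (volume.restrict (c.strip h))) :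
    ∫⁻ x in c.strip h, f x = ∫⁻ p in ball 0 c.R, ∫⁻ s in Ioo 0 h, f (c.Λ (p, s)) := by
  have hm : AEMeasurable (fun z => f (c.Λ z)) (volume.restrict (ball 0 c.R ×ˢ Ioo 0 h)) :=
    hf.comp_quasiMeasurePreserving
      (c.measurePreserving.restrict_image_emb c.Λ.measurableEmbedding _).quasiMeasurePreserving
  rw [strip, ← c.lintegral_comp]
  rw [Measure.volume_eq_prod, ← Measure.prod_restrict] at hm ⊢
  exact lintegral_prod _ hm

lemma aemeasurable_trace_bdry (hN : 1 ≤ N) (hΩ : IsPiecewiseC1Domain Ω) {u : 𝔼 → ℝ}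
    (hu : MemBV Ω u) :
    AEMeasurable (fun p => trace Ω u (c.bdry p)) (volume.restrict (ball 0 c.R)) := by
  have h1 : AEMeasurable (trace Ω u) ((volume.restrict (ball 0 c.R)).map c.bdry) :=
    (aemeasurable_trace hN hΩ hu).mono_measure (c.map_bdry_le.trans Measure.restrict_le_self)
  exact h1.comp_aemeasurable c.continuous_bdry.aemeasurable

lemma ae_aemeasurable_vertical {u : 𝔼 → ℝ} (hu : IntegrableOn u Ω) :
    ∀ᵐ p ∂(volume.restrict (ball 0 c.R)),
      AEMeasurable (fun s => u (c.Λ (p, s))) (volume.restrict (Ioo 0 c.R)) := by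
  have h := (c.integrableOn_comp (hu.mono_set (c.strip_subset le_rfl))).aestronglyMeasurable
  rw [Measure.volume_eq_prod, ← Measure.prod_restrict] at h
  exact h.prodMk_left.mono fun p hp => hp.aemeasurable

/-- Averaging |trace| ≤ |u| + |u - trace| over heights up to R bounds the trace by the L¹ norm of u
and the integrable V. -/
lemma lintegral_trace_bdry_ne_top (hN : 1 ≤ N) (hΩ : IsPiecewiseC1Domain Ω) {u : 𝔼 → ℝ}
    (hu : MemBV Ω u) (hc : c.IsTraced u) : ∫⁻ p in ball 0 c.R, ‖trace Ω u (c.bdry p)‖ₑ ≠ ⊤ := by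
  obtain ⟨V, hV, hVT, hg⟩ := hc
  have hRp := c.R_pos
  have hum : AEMeasurable u (volume.restrict (c.strip c.R)) :=
    (hu.1.mono_set (c.strip_subset le_rfl)).aemeasurable
  have hfin : ∫⁻ x in c.strip c.R, ‖u x‖ₑ ≠ ⊤ :=
    ((lintegral_mono_set (c.strip_subset le_rfl)).trans_lt hu.1.2).ne
  rw [c.lintegral_strip hum.enorm] at hfin
  have hm := c.aemeasurable_trace_bdry hN hΩ hu
  have key : ENNReal.ofReal c.R * ∫⁻ p in ball 0 c.R, ‖trace Ω u (c.bdry p)‖ₑ ≤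
      (∫⁻ p in ball 0 c.R, ∫⁻ s in Ioo 0 c.R, ‖u (c.Λ (p, s))‖ₑ) +
        (∫⁻ p in ball 0 c.R, V p) * ENNReal.ofReal c.R := by
    rw [← lintegral_const_mul'' _ hm.enorm, ← lintegral_mul_const'' _ hV.aemeasurable,
      ← lintegral_add_right' _ (hV.aemeasurable.mul_const _)]
    refine lintegral_mono_ae ?_
    filter_upwards [hg, c.ae_aemeasurable_vertical hu.1] with p hp hps
    have h1 := hp.2.2 c.R le_rfl
    calc ENNReal.ofReal c.R * ‖trace Ω u (c.bdry p)‖ₑ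
        = ∫⁻ s in Ioo 0 c.R, ‖trace Ω u (c.bdry p)‖ₑ := by
          rw [setLIntegral_const, Real.volume_Ioo, sub_zero, mul_comm]
      _ ≤ (∫⁻ s in Ioo 0 c.R, ‖u (c.Λ (p, s))‖ₑ) +
            ∫⁻ s in Ioo 0 c.R, ‖u (c.Λ (p, s)) - trace Ω u (c.bdry p)‖ₑ := by
          rw [← lintegral_add_left' hps.enorm]
          refine lintegral_mono fun s => ?_
          calc ‖trace Ω u (c.bdry p)‖ₑ
              = ‖u (c.Λ (p, s)) - (u (c.Λ (p, s)) - trace Ω u (c.bdry p))‖ₑ := by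
                rw [sub_sub_cancel]
            _ ≤ _ := enorm_sub_le
      _ ≤ _ := by gcongr
  have hne := ENNReal.add_ne_top.2 ⟨hfin, ENNReal.mul_ne_top hVT
    (ENNReal.ofReal_ne_top (r := c.R))⟩
  intro htop
  rw [htop, ENNReal.mul_top (by simpa using hRp)] at key
  exact hne (top_le_iff.1 key)

/-- On almost every vertical line the mean of |ζu| up to height h tends to |ζ trace|, with majorant
|trace| + V; dominated convergence in p does the rest. Being an exact limit, it serves both the
upper bound in the approximation and the lower bound in the semicontinuity. -/
lemma tendsto_lintegral_strip_div (hN : 1 ≤ N) (hΩ : IsPiecewiseC1Domain Ω) {u : 𝔼 → ℝ}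
    (hu : MemBV Ω u) (hc : c.IsTraced u) {ζ : 𝔼 → ℝ} (hζ : Continuous ζ)
    (hζ1 : ∀ y, ζ y ∈ Icc (0 : ℝ) 1) :
    Tendsto (fun h => (∫⁻ x in c.strip h, ‖ζ x * u x‖ₑ) / ENNReal.ofReal h) (𝓝[>] 0)
      (𝓝 (∫⁻ p in ball 0 c.R, ‖ζ (c.bdry p) * trace Ω u (c.bdry p)‖ₑ)) := by
  have hfin := c.lintegral_trace_bdry_ne_top hN hΩ hu hc
  have hm := c.aemeasurable_trace_bdry hN hΩ hu
  obtain ⟨V, hV, hVT, hg⟩ := hc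
  have hRp := c.R_pos
  have hζ2 : ∀ y, ‖ζ y‖ₑ ≤ 1 := fun y => by
    rw [Real.enorm_of_nonneg (hζ1 y).1]
    exact ENNReal.ofReal_le_one.2 (hζ1 y).2
  have hzum : AEMeasurable (fun x => ‖ζ x * u x‖ₑ) (volume.restrict (c.strip c.R)) :=
    (hζ.aemeasurable.mul (hu.1.mono_set (c.strip_subset le_rfl)).aemeasurable).enorm
  have hmono : ∀ h ≤ c.R, c.strip h ⊆ c.strip c.R := fun h hh =>
    image_mono (prod_mono Subset.rfl (Ioo_subset_Ioo_right hh))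
  set F : ℝ → Hyp N → ℝ≥0∞ := fun h p =>
    (∫⁻ s in Ioo 0 h, ‖ζ (c.Λ (p, s)) * u (c.Λ (p, s))‖ₑ) / ENNReal.ofReal h
  have hsl : ∀ᵐ p ∂(volume.restrict (ball 0 c.R)),
      AEMeasurable (fun s => u (c.Λ (p, s))) (volume.restrict (Ioo 0 c.R)) :=
    c.ae_aemeasurable_vertical hu.1
  have hFm : ∀ h ≤ c.R, AEMeasurable (F h) (volume.restrict (ball 0 c.R)) := fun h hh => by
    have h1 : AEMeasurable (fun z => ‖ζ (c.Λ z) * u (c.Λ z)‖ₑ)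
        (volume.restrict (ball 0 c.R ×ˢ Ioo 0 h)) :=
      (hzum.mono_measure (Measure.restrict_mono (hmono h hh) le_rfl)).comp_quasiMeasurePreserving
        (c.measurePreserving.restrict_image_emb c.Λ.measurableEmbedding _).quasiMeasurePreserving
    rw [Measure.volume_eq_prod, ← Measure.prod_restrict] at h1
    exact h1.lintegral_prod_right'.div_const _
  have hFeq : ∀ h ≤ c.R, (∫⁻ x in c.strip h, ‖ζ x * u x‖ₑ) / ENNReal.ofReal h =
      ∫⁻ p in ball 0 c.R, F h p := fun h hh => by
    have h1 := hzum.mono_measure (Measure.restrict_mono (hmono h hh) le_rfl)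
    rw [c.lintegral_strip h1]
    simp only [F, div_eq_mul_inv]
    have h2 : AEMeasurable (fun z => ‖ζ (c.Λ z) * u (c.Λ z)‖ₑ)
        (volume.restrict (ball 0 c.R ×ˢ Ioo 0 h)) :=
      h1.comp_quasiMeasurePreserving
        (c.measurePreserving.restrict_image_emb c.Λ.measurableEmbedding _).quasiMeasurePreserving
    rw [Measure.volume_eq_prod, ← Measure.prod_restrict] at h2
    rw [lintegral_mul_const'' _ h2.lintegral_prod_right']
  have hev : ∀ᶠ h in 𝓝[>] (0 : ℝ), 0 < h ∧ h ≤ c.R := by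
    filter_upwards [Ioc_mem_nhdsGT hRp] with h hh using hh
  refine Tendsto.congr' (hev.mono fun h hh => (hFeq h hh.2).symm) ?_
  refine tendsto_lintegral_filter_of_dominated_convergence'
    (fun p => ‖trace Ω u (c.bdry p)‖ₑ + V p) (hev.mono fun h hh => hFm h hh.2) ?_ ?_ ?_
  · filter_upwards [hev] with h hh
    filter_upwards [hg] with p hp
    refine ENNReal.div_le_of_le_mul ?_
    rw [add_mul]
    refine (lintegral_mono (g := fun s => ‖u (c.Λ (p, s))‖ₑ) fun s => ?_).trans
      ((lintegral_enorm_le_add (g := fun _ => trace Ω u (c.bdry p)) aemeasurable_const).trans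
      (add_le_add (le_of_eq ?_) (hp.2.2 h hh.2)))
    · rw [enorm_mul]
      exact mul_le_of_le_one_left' (hζ2 _)
    · rw [setLIntegral_const, Real.volume_Ioo, sub_zero]
  · rw [lintegral_add_right _ hV]
    exact ENNReal.add_ne_top.2 ⟨hfin, hVT⟩
  · filter_upwards [hg, hsl] with p hp hps
    set g := trace Ω u (c.bdry p)
    have hcont : Continuous fun s : ℝ => c.Λ (p, s) := c.Λ.continuous.comp (by fun_prop)
    have hφ : Tendsto (fun s => ‖ζ (c.Λ (p, s)) - ζ (c.bdry p)‖ₑ * ‖g‖ₑ) (𝓝[>] 0) (𝓝 0) := by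
      have h1 : Continuous fun s => ‖ζ (c.Λ (p, s)) - ζ (c.bdry p)‖ₑ * ‖g‖ₑ :=
        ENNReal.continuous_mul_const (enorm_ne_top) |>.comp
          ((hζ.comp hcont).sub continuous_const).enorm
      have h2 := h1.tendsto 0
      simp only [bdry, sub_self, enorm_zero, zero_mul] at h2 ⊢
      exact h2.mono_left nhdsWithin_le_nhds
    have hD := (tendsto_lintegral_Ioo_div hφ).add hp.2.1
    rw [add_zero] at hD
    have hmD : Measurable fun s : ℝ => ‖ζ (c.Λ (p, s)) - ζ (c.bdry p)‖ₑ * ‖g‖ₑ :=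
      (((hζ.comp hcont).sub continuous_const).enorm.measurable).mul_const _
    have hle : ∀ s, ‖ζ (c.Λ (p, s)) * u (c.Λ (p, s)) - ζ (c.bdry p) * g‖ₑ ≤
        ‖ζ (c.Λ (p, s)) - ζ (c.bdry p)‖ₑ * ‖g‖ₑ + ‖u (c.Λ (p, s)) - g‖ₑ := fun s => by
      rw [show ζ (c.Λ (p, s)) * u (c.Λ (p, s)) - ζ (c.bdry p) * g =
        (ζ (c.Λ (p, s)) - ζ (c.bdry p)) * g + ζ (c.Λ (p, s)) * (u (c.Λ (p, s)) - g) by ring]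
      refine (enorm_add_le _ _).trans ?_
      rw [enorm_mul, enorm_mul]
      gcongr
      exact mul_le_of_le_one_left' (hζ2 _)
    have hDle : ∀ h, ∫⁻ s in Ioo 0 h, ‖ζ (c.Λ (p, s)) * u (c.Λ (p, s)) - ζ (c.bdry p) * g‖ₑ ≤
        (∫⁻ s in Ioo 0 h, ‖ζ (c.Λ (p, s)) - ζ (c.bdry p)‖ₑ * ‖g‖ₑ) +
          ∫⁻ s in Ioo 0 h, ‖u (c.Λ (p, s)) - g‖ₑ := fun h => by
      rw [← lintegral_add_left hmD]
      exact lintegral_mono hle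
    have hconst : ∀ h > 0, ‖ζ (c.bdry p) * g‖ₑ =
        (∫⁻ s in Ioo 0 h, ‖ζ (c.bdry p) * g‖ₑ) / ENNReal.ofReal h := fun h hh => by
      rw [setLIntegral_const, Real.volume_Ioo, sub_zero, ENNReal.mul_div_cancel_right
        (by simpa using hh) ENNReal.ofReal_ne_top]
    refine tendsto_of_le_add enorm_ne_top ?_ ?_ hD
    · filter_upwards [hev] with h hh
      rw [hconst h hh.1, ← ENNReal.add_div, ← ENNReal.add_div]
      exact ENNReal.div_le_div_right ((lintegral_enorm_le_add aemeasurable_const).trans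
        (add_le_add le_rfl (hDle h))) _
    · filter_upwards [hev] with h hh
      rw [hconst h hh.1, ← ENNReal.add_div, ← ENNReal.add_div]
      refine ENNReal.div_le_div_right ?_ _
      refine (lintegral_enorm_le_add (g := fun s => ζ (c.Λ (p, s)) * u (c.Λ (p, s))) ?_).trans
        (add_le_add le_rfl ?_)
      · exact (hζ.comp hcont).aemeasurable.mul
          (hps.mono_measure (Measure.restrict_mono (Ioo_subset_Ioo_right hh.2) le_rfl))
      · rw [lintegral_enorm_sub_comm]
        exact hDle h

end GraphChart

/-! ### The boundary layer -/

/-- The points of `Ω` at distance less than `h` from the complement. -/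
def layer (Ω : Set 𝔼) (h : ℝ) : Set 𝔼 := Ω ∩ {x | infDist x Ωᶜ < h}

lemma measurableSet_layer {Ω : Set 𝔼} (hΩ : IsOpen Ω) (h : ℝ) : MeasurableSet (layer Ω h) :=
  hΩ.measurableSet.inter
    (isOpen_lt (continuous_infDist_pt _) continuous_const).measurableSet

namespace GraphChart

variable {Ω : Set (EuclideanSpace ℝ (Fin N))} {x₀ : EuclideanSpace ℝ (Fin N)} {ε : ℝ}
  (c : GraphChart Ω x₀ ε)

/-- A point of the layer is within h of a boundary point, which lies in the same chart for small h.
The height in the chart exceeds the distance to the boundary by at most the factor 1 + ε.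
Conversely, a strip of height h lies in the layer of width h, since vertical segments keep their
length. -/
lemma eventually_layer_subset_strip (hΩ : Ω ≠ univ) (hε : 0 ≤ ε) {C : Set 𝔼} (hC : IsCompact C)
    (hCd : C ⊆ c.dom) : ∀ᶠ h in 𝓝[>] (0 : ℝ), layer Ω h ∩ C ⊆ c.strip ((1 + ε) * h) := by
  obtain ⟨δ, hδ, hδC⟩ := hC.exists_thickening_subset_open c.isOpen_dom hCd
  filter_upwards [Ioo_mem_nhdsGT hδ] with h hh
  rintro x ⟨⟨hxΩ, hxh⟩, hxC⟩
  obtain ⟨z, hz, hxz⟩ := exists_mem_frontier_infDist_compl_eq_dist hxΩ hΩ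
  have hxz' : dist x z < h := hxz ▸ hxh
  have hzd : z ∈ c.dom := hδC (mem_thickening_iff.2 ⟨x, hxC, by
    rw [dist_comm]; exact hxz'.trans hh.2⟩)
  obtain ⟨q, t, hq, ht, rfl⟩ := c.exists_of_mem_dom hzd
  obtain rfl : t = 0 := (c.frontier_iff q t hq ht).1 hz
  obtain ⟨p, s, hp, hs, rfl⟩ := c.exists_of_mem_dom (hCd hxC)
  have hs0 : 0 < s := (c.mem_iff p s hp hs).1 hxΩ
  refine ⟨(p, s), ⟨by simpa using hp, hs0, ?_⟩, rfl⟩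
  have := c.height_le p q s
  rw [abs_of_pos hs0] at this
  exact this.trans_lt (mul_lt_mul_of_pos_left hxz' (by linarith))

lemma strip_subset_layer {h : ℝ} (hh : h ≤ c.R) : c.strip h ⊆ layer Ω h := by
  intro x hx
  refine ⟨c.strip_subset hh hx, ?_⟩
  obtain ⟨⟨p, s⟩, ⟨hp, hs⟩, rfl⟩ := hx
  have hp' : ‖p‖ < c.R := by simpa using hp
  have h0 : c.Λ (p, 0) ∈ Ωᶜ := fun h =>
    lt_irrefl _ ((c.mem_iff p 0 hp' (by simpa using c.R_pos)).1 h)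
  have h1 := c.dist_le p p s 0
  rw [dist_self, mul_zero, zero_add, sub_zero, abs_of_pos hs.1] at h1
  exact (infDist_le_dist_of_mem h0).trans_lt (h1.trans_lt hs.2)

end GraphChart

/-- The part of closure Ω ∩ C outside W is compact and misses the boundary, so the distance to the
complement has a positive minimum there. -/
lemma eventually_layer_inter_subset {Ω : Set 𝔼} (hΩ : Bornology.IsBounded Ω) (hne : Ω ≠ univ)
    {C W : Set 𝔼} (hC : IsClosed C) (hW : IsOpen W) (h : frontier Ω ∩ C ⊆ W) :
    ∀ᶠ h in 𝓝[>] (0 : ℝ), layer Ω h ∩ C ⊆ W := by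
  have hcpt : IsCompact ((closure Ω ∩ C) \ W) :=
    (hΩ.isCompact_closure.inter_right hC).diff hW
  rcases ((closure Ω ∩ C) \ W).eq_empty_or_nonempty with he | hne'
  · refine Eventually.of_forall fun h x hx => ?_
    by_contra hxW
    exact (he ▸ (⟨⟨subset_closure hx.1.1, hx.2⟩, hxW⟩ : x ∈ (closure Ω ∩ C) \ W) : x ∈ (∅ : Set 𝔼))
  obtain ⟨y, hy, hmin⟩ := hcpt.exists_isMinOn hne' (continuous_infDist_pt Ωᶜ).continuousOn
  have hpos : 0 < infDist y Ωᶜ := by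
    refine infDist_nonneg.lt_of_ne' fun h0 => hy.2 (h ⟨?_, hy.1.2⟩)
    rw [frontier_eq_closure_inter_closure]
    exact ⟨hy.1.1, (mem_closure_iff_infDist_zero (nonempty_compl.2 hne)).2 h0⟩
  filter_upwards [Ioo_mem_nhdsGT hpos] with h hh x hx
  by_contra hxW
  have := hmin (⟨⟨subset_closure hx.1.1, hx.2⟩, hxW⟩ : x ∈ (closure Ω ∩ C) \ W)
  exact absurd (hx.1.2.trans hh.2) (not_lt.2 this)

lemma BoundaryPartition.sum_lintegral_le {Ω K : Set 𝔼} {ε : ℝ} (P : BoundaryPartition Ω K ε)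
    {μ : Measure 𝔼} {f : 𝔼 → ℝ≥0∞} (hf : AEMeasurable f μ) :
    ∑ i, ∫⁻ x, ‖P.ζ i x‖ₑ * f x ∂μ ≤ ∫⁻ x, f x ∂μ := by
  rw [← lintegral_finsetSum' _ fun i _ => AEMeasurable.fun_mul
    (P.contDiff i).continuous.enorm.measurable.aemeasurable hf]
  refine lintegral_mono fun x => ?_
  dsimp only
  rw [← Finset.sum_mul]
  refine mul_le_of_le_one_left' ?_
  simp_rw [fun i => Real.enorm_of_nonneg (P.nonneg i x)]
  rw [← ENNReal.ofReal_sum_of_nonneg fun i _ => P.nonneg i x]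
  exact ENNReal.ofReal_le_one.2 (P.sum_le_one x)

lemma IsPiecewiseC1Domain.ne_univ (hN : 1 ≤ N) {Ω : Set 𝔼} (hΩ : IsPiecewiseC1Domain Ω) :
    Ω ≠ univ := by
  rintro rfl
  have : Nonempty (Fin N) := ⟨⟨0, hN⟩⟩
  exact (NormedSpace.noncompactSpace ℝ 𝔼).noncompact_univ
    (isCompact_of_isClosed_isBounded isClosed_univ hΩ.isBounded)

/-- The layer, restricted to the support of η, lies in chart strips of height (1+ε)h, where averages
converge to the trace integral; the partition of unity prevents double counting. Since η avoids the
singular points, C¹ charts suffice. The loss 1 + ε fits into the strict inequality with b. -/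
lemma eventually_lintegral_layer_lt (hN : 1 ≤ N) {Ω : Set 𝔼} (hΩ : IsPiecewiseC1Domain Ω)
    {u : 𝔼 → ℝ} (hu : MemBV Ω u) {η : 𝔼 → ℝ} (hη1 : ∀ x, η x ∈ Icc (0 : ℝ) 1)
    (hηc : ∀ x ∈ frontier Ω ∩ tsupport η, IsC1BoundaryPoint Ω x) {b : ℝ≥0∞}
    (hb : ∫⁻ x, ‖trace Ω u x‖ₑ ∂(surfaceMeasure Ω) < b) :
    ∀ᶠ h in 𝓝[>] (0 : ℝ), (∫⁻ x in layer Ω h, ‖η x * u x‖ₑ) / ENNReal.ofReal h < b := by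
  set T := ∫⁻ x, ‖trace Ω u x‖ₑ ∂(surfaceMeasure Ω) with hT
  have hTt : T ≠ ⊤ := hb.ne_top
  have hne := hΩ.ne_univ hN
  obtain ⟨ε, hεb, hε, hε1⟩ : ∃ ε : ℝ, ENNReal.ofReal (1 + ε) * T < b ∧ 0 < ε ∧ ε ≤ 1 := by
    have h1 : Tendsto (fun ε : ℝ => ENNReal.ofReal (1 + ε) * T) (𝓝 0) (𝓝 T) := by
      have h2 : Continuous fun ε : ℝ => ENNReal.ofReal (1 + ε) :=
        ENNReal.continuous_ofReal.comp (by fun_prop)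
      have h3 := ENNReal.Tendsto.mul_const (h2.tendsto 0) (Or.inr hTt)
      simpa using h3
    have h4 := ((h1.mono_left nhdsWithin_le_nhds).eventually (gt_mem_nhds hb)).and
      (Ioc_mem_nhdsGT one_pos)
    obtain ⟨ε, h, h'⟩ := h4.exists
    exact ⟨ε, h, h'.1, h'.2⟩
  have hK : IsCompact (frontier Ω ∩ tsupport η) :=
    (hΩ.isBounded.isCompact_closure.of_isClosed_subset isClosed_frontier
      frontier_subset_closure).inter_right (isClosed_tsupport η)
  obtain ⟨P⟩ := nonempty_boundaryPartition hN hΩ.isOpen hK hηc hε hε1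
  set G : ℝ → ℝ≥0∞ := fun h =>
    ∑ i, (∫⁻ x in (P.c i).strip ((1 + ε) * h), ‖P.ζ i x * u x‖ₑ) / ENNReal.ofReal h
  have htr := aemeasurable_trace hN hΩ hu
  have hG : Tendsto G (𝓝[>] 0) (𝓝 (∑ i, ENNReal.ofReal (1 + ε) *
      ∫⁻ p in ball 0 (P.c i).R, ‖P.ζ i ((P.c i).bdry p) * trace Ω u ((P.c i).bdry p)‖ₑ)) := by
    refine tendsto_finsetSum _ fun i _ => ?_
    have h1 := (P.c i).tendsto_lintegral_strip_div hN hΩ hu (P.isTraced i u hu)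
      (P.contDiff i).continuous (P.mem_Icc i)
    have h2 : Tendsto (fun h : ℝ => (1 + ε) * h) (𝓝[>] 0) (𝓝[>] 0) := by
      refine tendsto_nhdsWithin_iff.2 ⟨?_, ?_⟩
      · have : Continuous fun h : ℝ => (1 + ε) * h := by fun_prop
        simpa using (this.tendsto 0).mono_left nhdsWithin_le_nhds
      · filter_upwards [self_mem_nhdsWithin] with h hh
        exact mul_pos (by linarith : (0 : ℝ) < 1 + ε) hh
    have h3 := ENNReal.Tendsto.const_mul (h1.comp h2)
      (Or.inr (ENNReal.ofReal_ne_top (r := 1 + ε)))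
    refine h3.congr' ?_
    filter_upwards [self_mem_nhdsWithin] with h hh
    have h4 : ENNReal.ofReal (1 + ε) ≠ 0 := (ENNReal.ofReal_pos.2 (by linarith)).ne'
    rw [Function.comp_apply, ENNReal.ofReal_mul (by linarith), ← mul_div_assoc,
      ENNReal.mul_div_mul_left _ _ h4 ENNReal.ofReal_ne_top]
  have hle : (∑ i, ENNReal.ofReal (1 + ε) *
      ∫⁻ p in ball 0 (P.c i).R, ‖P.ζ i ((P.c i).bdry p) * trace Ω u ((P.c i).bdry p)‖ₑ) < b := by
    refine lt_of_le_of_lt ?_ hεb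
    rw [← Finset.mul_sum]
    gcongr
    refine le_trans (Finset.sum_le_sum fun i _ => ?_) (P.sum_lintegral_le htr.enorm)
    refine ((P.c i).lintegral_bdry_le (fun x => ‖P.ζ i x * trace Ω u x‖ₑ)).trans ?_
    refine (setLIntegral_le_lintegral _ _).trans (lintegral_mono fun x => ?_)
    rw [enorm_mul]
  have hsub : ∀ᶠ h in 𝓝[>] (0 : ℝ), ∀ i,
      layer Ω h ∩ tsupport (P.ζ i) ⊆ (P.c i).strip ((1 + ε) * h) :=
    eventually_all.2 fun i => (P.c i).eventually_layer_subset_strip hne hε.le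
      (P.hasCompactSupport i).isCompact (P.tsupport_subset i)
  filter_upwards [hG.eventually (gt_mem_nhds hle), hsub,
    eventually_layer_inter_subset hΩ.isBounded hne (isClosed_tsupport η) P.isOpen_W P.subset_W]
    with h hGh hsubh hWh
  refine lt_of_le_of_lt ?_ hGh
  simp only [G, div_eq_mul_inv]
  rw [← Finset.sum_mul]
  gcongr
  have hlm := measurableSet_layer hΩ.isOpen h
  have hum : AEMeasurable u (volume.restrict (layer Ω h)) :=
    (hu.1.mono_set inter_subset_left).aemeasurable
  calc ∫⁻ x in layer Ω h, ‖η x * u x‖ₑ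
      ≤ ∫⁻ x in layer Ω h, ∑ i, ‖P.ζ i x * u x‖ₑ := by
        refine setLIntegral_mono' hlm fun x hx => ?_
        by_cases hxη : x ∈ tsupport η
        · have h1 := P.sum_eq_one x (hWh ⟨hx, hxη⟩)
          calc ‖η x * u x‖ₑ ≤ ‖u x‖ₑ := by
                rw [enorm_mul, Real.enorm_of_nonneg (hη1 x).1]
                exact mul_le_of_le_one_left' (ENNReal.ofReal_le_one.2 (hη1 x).2)
            _ = ‖∑ i, P.ζ i x * u x‖ₑ := by rw [← Finset.sum_mul, h1, one_mul]
            _ ≤ _ := enorm_sum_le _ _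
        · rw [image_eq_zero_of_notMem_tsupport hxη, zero_mul, enorm_zero]
          exact bot_le
    _ = ∑ i, ∫⁻ x in layer Ω h, ‖P.ζ i x * u x‖ₑ :=
        lintegral_finsetSum' _ fun i _ =>
          ((P.contDiff i).continuous.aemeasurable.mul hum).enorm
    _ ≤ _ := by
        refine Finset.sum_le_sum fun i _ => ?_
        refine (setLIntegral_mono' hlm (g := ((P.c i).strip ((1 + ε) * h)).indicator
          fun x => ‖P.ζ i x * u x‖ₑ) fun x hx => ?_).trans ?_
        · by_cases hxζ : x ∈ tsupport (P.ζ i)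
          · rw [indicator_of_mem (hsubh i ⟨hx, hxζ⟩)]
          · rw [image_eq_zero_of_notMem_tsupport hxζ, zero_mul, enorm_zero]
            exact bot_le
        · rw [← lintegral_indicator ((P.c i).measurableSet_strip _)]
          exact setLIntegral_le_lintegral _ _

/-- A mollified ramp in the distance to the complement. A slope slightly above 1/h leaves room for χ
to vanish near the boundary and to be constant at distance h and beyond. -/
lemma exists_layer_cutoff {Ω : Set 𝔼} (hΩ : Bornology.IsBounded Ω) {h θ : ℝ} (hh : 0 < h)
    (hθ : 0 < θ) :
    ∃ χ : 𝔼 → ℝ, ContDiff ℝ 1 χ ∧ (∀ x, χ x ∈ Icc (0 : ℝ) 1) ∧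
      (∃ C, IsCompact C ∧ C ⊆ Ω ∧ ∀ x, x ∉ C → χ x = 0) ∧
      (∀ x, h ≤ infDist x Ωᶜ → χ x = 1 ∧ fderiv ℝ χ x = 0) ∧
      ∀ x, ‖fderiv ℝ χ x‖ₑ ≤ ENNReal.ofReal ((1 + θ) / h) := by
  -- The ramp has width b and rises between distances a and a + b. Mollifying at a radius below a
  -- keeps χ zero near the boundary and equal to 1 from 2a + b on, and 3a + b = h.
  set b := h / (1 + θ) with hb
  set a := (h - b) / 3 with ha
  have hb0 : 0 < b := by positivity
  have hbh : b < h := div_lt_self hh (by linarith)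
  have ha0 : 0 < a := by rw [ha]; linarith
  set f : 𝔼 → ℝ := fun x => max 0 (min 1 (b⁻¹ * (infDist x Ωᶜ - a)))
  have hf : LipschitzWith (b⁻¹).toNNReal f := by
    refine LipschitzWith.const_max (LipschitzWith.const_min ?_ 1) 0
    refine LipschitzWith.of_dist_le_mul fun x y => ?_
    rw [Real.coe_toNNReal _ (by positivity), Real.dist_eq, ← mul_sub, abs_mul,
      abs_of_pos (inv_pos.2 hb0), sub_sub_sub_cancel_right, ← Real.dist_eq]
    gcongr
    simpa using (lipschitz_infDist_pt Ωᶜ).dist_le_mul x y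
  have hfI : ∀ x, f x ∈ Icc (0 : ℝ) 1 := fun x =>
    ⟨le_max_left _ _, max_le zero_le_one (min_le_left _ _)⟩
  have hf0 : ∀ x, infDist x Ωᶜ ≤ a → f x = 0 := fun x hx =>
    max_eq_left ((min_le_right _ _).trans
      (mul_nonpos_of_nonneg_of_nonpos (inv_pos.2 hb0).le (by linarith)))
  have hf1 : ∀ x, a + b ≤ infDist x Ωᶜ → f x = 1 := fun x hx => by
    have : 1 ≤ b⁻¹ * (infDist x Ωᶜ - a) := by
      rw [← div_eq_inv_mul, one_le_div hb0]; linarith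
    simp [f, min_eq_left this]
  obtain ⟨k, hk⟩ := exists_nat_one_div_lt ha0
  have hd : ∀ x y, y ∈ ball x (1 / ((k : ℝ) + 1)) → |infDist y Ωᶜ - infDist x Ωᶜ| < a :=
    fun x y hy => by
      rw [← Real.dist_eq]
      exact ((lipschitz_infDist_pt Ωᶜ).dist_le_mul y x).trans_lt (by simpa using hy.out.trans hk)
  have hm1 : ∀ x, a + b + a ≤ infDist x Ωᶜ → mollify k f x = 1 := fun x hx =>
    mollify_eq_of_eqOn_ball k fun y hy => hf1 y (by linarith [(abs_lt.1 (hd x y hy)).1])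
  refine ⟨mollify k f, (contDiff_mollify k hf.continuous.locallyIntegrable).of_le (by simp),
    fun x => mollify_mem_Icc k hf.continuous.locallyIntegrable hfI x, ?_, fun x hx => ⟨?_, ?_⟩,
    fun x => ?_⟩
  · have hsub : {x | a - 1 / ((k : ℝ) + 1) ≤ infDist x Ωᶜ} ⊆ Ω := fun x hx => by
      by_contra hxΩ
      have h0 : a - 1 / ((k : ℝ) + 1) ≤ infDist x Ωᶜ := hx
      rw [infDist_zero_of_mem (show x ∈ Ωᶜ from hxΩ)] at h0
      linarith
    refine ⟨_, isCompact_of_isClosed_isBounded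
      (isClosed_le continuous_const (continuous_infDist_pt _)) (hΩ.subset hsub), hsub,
      fun x hx => mollify_eq_of_eqOn_ball k fun y hy => hf0 y ?_⟩
    have hx' : infDist x Ωᶜ < a - 1 / ((k : ℝ) + 1) := not_le.1 hx
    have := (lipschitz_infDist_pt Ωᶜ).dist_le_mul y x
    rw [NNReal.coe_one, one_mul, Real.dist_eq] at this
    have hy' : dist y x < 1 / ((k : ℝ) + 1) := hy
    linarith [le_abs_self (infDist y Ωᶜ - infDist x Ωᶜ)]
  · exact hm1 x (by linarith [show 3 * a = h - b by rw [ha]; ring])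
  · have : mollify k f =ᶠ[𝓝 x] fun _ => 1 := by
      filter_upwards [(continuous_infDist_pt Ωᶜ).continuousAt.eventually
        (lt_mem_nhds (show a + b + a < infDist x Ωᶜ by
          linarith [show 3 * a = h - b by rw [ha]; ring]))] with y hy using hm1 y hy.le
    rw [this.fderiv_eq, fderiv_const_apply]
  · have := norm_fderiv_le_of_lipschitz ℝ (lipschitz_mollify k hf) (x₀ := x)
    rw [← ofReal_norm]
    refine ENNReal.ofReal_le_ofReal (this.trans (le_of_eq ?_))
    rw [Real.coe_toNNReal _ (by positivity), hb, inv_div]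

/-! ### Cutoff functions near sets of zero area -/

/-- A cover with small sum of diam^d is enlarged to open balls of radius diam + δ_n with δ_n
summable and small; compactness makes it finite. Since d ≥ 1, empty sets contribute nothing and
δ_n^d ≤ δ_n for δ_n ≤ 1. -/
lemma exists_finite_cover_of_hausdorffMeasure_eq_zero {d : ℕ} (hd : 1 ≤ d) {S : Set 𝔼}
    (hS : IsCompact S) (h0 : Measure.hausdorffMeasure (d : ℝ) S = 0) {ε : ℝ≥0∞} (hε : ε ≠ 0) :
    ∃ (t : Finset ℕ) (x : ℕ → 𝔼) (r : ℕ → ℝ), (∀ n, 0 < r n ∧ r n ≤ 2) ∧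
      S ⊆ ⋃ n ∈ t, ball (x n) (r n) ∧ ∑ n ∈ t, ENNReal.ofReal (r n) ^ d ≤ ε := by
  -- The factor 2^d comes from (a + b)^d ≤ 2^d (a^d + b^d), the factor 2 from the two sums.
  set ε' := ε / (2 * 2 ^ d) with hε'
  have hε'0 : ε' ≠ 0 := by
    rw [hε', Ne, ENNReal.div_eq_zero_iff]
    push Not
    exact ⟨hε, ENNReal.mul_ne_top ENNReal.ofNat_ne_top (by simp)⟩
  rw [Measure.hausdorffMeasure_apply] at h0
  have h1 := ENNReal.iSup_eq_zero.1 (ENNReal.iSup_eq_zero.1 h0 1) one_pos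
  obtain ⟨t, h2⟩ := iInf_lt_iff.1 (lt_of_eq_of_lt h1 (pos_iff_ne_zero.2 hε'0))
  obtain ⟨hcov, h3⟩ := iInf_lt_iff.1 h2
  obtain ⟨hdiam, hsum⟩ := iInf_lt_iff.1 h3
  obtain ⟨δ', hδ'0, hδ'⟩ := ENNReal.exists_pos_sum_of_countable hε'0 ℕ
  set δ : ℕ → ℝ := fun n => min (δ' n) 1
  have hδ0 : ∀ n, 0 < δ n := fun n => lt_min (hδ'0 n) one_pos
  have hδd : ∀ n, ENNReal.ofReal (δ n) ^ d ≤ δ' n := fun n => by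
    calc ENNReal.ofReal (δ n) ^ d ≤ ENNReal.ofReal (δ n) ^ 1 :=
          pow_le_pow_right_of_le_one' (ENNReal.ofReal_le_one.2 (min_le_right _ _)) hd
      _ ≤ δ' n := by
          rw [pow_one]
          exact ENNReal.ofReal_le_of_le_toReal (min_le_left _ _)
  have hdt : ∀ n, ediam (t n) ≠ ⊤ := fun n => ((hdiam n).trans_lt ENNReal.one_lt_top).ne
  set r : ℕ → ℝ := fun n => (ediam (t n)).toReal + δ n
  have hr : ∀ n, ENNReal.ofReal (r n) = ediam (t n) + ENNReal.ofReal (δ n) := fun n => by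
    rw [ENNReal.ofReal_add ENNReal.toReal_nonneg (hδ0 n).le, ENNReal.ofReal_toReal (hdt n)]
  have hr0 : ∀ n, 0 < r n := fun n => add_pos_of_nonneg_of_pos ENNReal.toReal_nonneg (hδ0 n)
  have hex : ∀ n, ∃ x, (t n).Nonempty → x ∈ t n := fun n => by
    rcases (t n).eq_empty_or_nonempty with he | ⟨y, hy⟩
    exacts [⟨0, fun h => absurd he h.ne_empty⟩, ⟨y, fun _ => hy⟩]
  choose x hx' using hex
  have htb : ∀ n, t n ⊆ ball (x n) (r n) := fun n y hy => by
    have hx : x n ∈ t n := hx' n ⟨y, hy⟩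
    rw [← Metric.eball_ofReal, Metric.mem_eball, hr]
    exact (Metric.edist_le_ediam_of_mem hy hx).trans_lt
      (ENNReal.lt_add_right (hdt n) (by simpa using hδ0 n))
  obtain ⟨F, hF⟩ := hS.elim_finite_subcover (fun n => ball (x n) (r n)) (fun n => isOpen_ball)
    (hcov.trans (iUnion_mono htb))
  refine ⟨F, x, r, fun n => ⟨hr0 n, ?_⟩, hF, ?_⟩
  · have h4 : (ediam (t n)).toReal ≤ 1 := ENNReal.toReal_le_of_le_ofReal zero_le_one
      (by simpa using hdiam n)
    have h5 : δ n ≤ 1 := min_le_right _ _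
    change (ediam (t n)).toReal + δ n ≤ 2
    linarith
  have hpow : ∀ a b : ℝ≥0∞, (a + b) ^ d ≤ 2 ^ d * (a ^ d + b ^ d) := fun a b => by
    rcases le_total a b with h | h
    · calc (a + b) ^ d ≤ (2 * b) ^ d := by rw [two_mul]; gcongr
        _ ≤ _ := by rw [mul_pow]; gcongr; exact le_add_self
    · calc (a + b) ^ d ≤ (2 * a) ^ d := by rw [two_mul]; gcongr
        _ ≤ _ := by rw [mul_pow]; gcongr; exact le_self_add
  have hterm : ∀ n, ENNReal.ofReal (r n) ^ d ≤
      2 ^ d * ((⨆ _ : (t n).Nonempty, ediam (t n) ^ (d : ℝ)) + δ' n) := fun n => by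
    rw [hr]
    refine (hpow _ _).trans ?_
    gcongr
    · rcases (t n).eq_empty_or_nonempty with he | hne
      · rw [he, Metric.ediam_empty, zero_pow (by omega)]
        exact bot_le
      · rw [iSup_pos hne, ENNReal.rpow_natCast]
    · exact hδd n
  calc ∑ n ∈ F, ENNReal.ofReal (r n) ^ d
      ≤ ∑' n, 2 ^ d * ((⨆ _ : (t n).Nonempty, ediam (t n) ^ (d : ℝ)) + δ' n) :=
        (Finset.sum_le_sum fun n _ => hterm n).trans (ENNReal.sum_le_tsum F)
    _ = 2 ^ d * ((∑' n, ⨆ _ : (t n).Nonempty, ediam (t n) ^ (d : ℝ)) + ∑' n, (δ' n : ℝ≥0∞)) := by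
        rw [ENNReal.tsum_mul_left, ENNReal.tsum_add]
    _ ≤ 2 ^ d * (ε' + ε') := by gcongr
    _ = ε := by
        rw [← two_mul, ← mul_assoc, mul_comm (2 ^ d) (2 : ℝ≥0∞), hε']
        exact ENNReal.mul_div_cancel (by simp) (ENNReal.mul_ne_top (by simp) (by simp))

/-- Take the product of 1 - b_n, with b_n a fixed bump rescaled to radius r_n. Its gradient is of
order 1/r_n on a set of volume of order r_n^N. As all factors lie in [0, 1], the errors add at most.
The bound r_n ≤ 2 absorbs the volume r_n^N into r_n^(N-1). -/
lemma exists_balls_cutoff (hN : 1 ≤ N) : ∃ A : ℝ≥0∞, A ≠ ⊤ ∧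
    ∀ (x : ℕ → EuclideanSpace ℝ (Fin N)) (r : ℕ → ℝ), (∀ n, 0 < r n ∧ r n ≤ 2) → ∀ t : Finset ℕ,
    ∃ η : EuclideanSpace ℝ (Fin N) → ℝ, ContDiff ℝ 1 η ∧ (∀ y, η y ∈ Icc (0 : ℝ) 1) ∧
      (∀ n ∈ t, ∀ y ∈ ball (x n) (r n), η y = 0) ∧
      ∫⁻ y, ‖fderiv ℝ η y‖ₑ ≤ A * ∑ n ∈ t, ENNReal.ofReal (r n) ^ (N - 1) ∧
      ∫⁻ y, ‖1 - η y‖ₑ ≤ A * ∑ n ∈ t, ENNReal.ofReal (r n) ^ (N - 1) := by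
  obtain ⟨β, hβ, hβc, hβU, hβ1, hβI⟩ := exists_contDiff_cutoff
    (isCompact_closedBall (0 : 𝔼) 1) isOpen_ball (closedBall_subset_ball one_lt_two)
  have hβd : ContDiff ℝ 1 β := hβ.of_le (by simp)
  obtain ⟨L₀, hL₀⟩ := (hβc.fderiv (𝕜 := ℝ)).exists_bound_of_continuous
    (hβd.continuous_fderiv (by norm_num))
  set L := max L₀ 1
  have hL : ∀ y, ‖fderiv ℝ β y‖ ≤ L := fun y => (hL₀ y).trans (le_max_left _ _)
  have hL1 : 1 ≤ L := le_max_right _ _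
  have : Nonempty (Fin N) := ⟨⟨0, hN⟩⟩
  set ω := volume (ball (0 : 𝔼) 1)
  have hω : ω ≠ ⊤ := measure_ball_lt_top.ne
  refine ⟨ENNReal.ofReal (2 * L * 2 ^ N) * ω, ENNReal.mul_ne_top ENNReal.ofReal_ne_top hω,
    fun x r hr t => ?_⟩
  set b : ℕ → 𝔼 → ℝ := fun n y => β ((r n)⁻¹ • (y - x n))
  have hb : ∀ n, ContDiff ℝ 1 (b n) := fun n =>
    hβd.comp (by fun_prop)
  have hb0 : ∀ n y, y ∉ ball (x n) (2 * r n) → b n y = 0 := fun n y hy => by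
    refine image_eq_zero_of_notMem_tsupport (f := β) fun h => hy ?_
    have h1 := hβU h
    rw [mem_ball_zero_iff, norm_smul, norm_inv, Real.norm_of_nonneg (hr n).1.le,
      inv_mul_lt_iff₀ (hr n).1, ← dist_eq_norm] at h1
    rw [mem_ball]; linarith
  have hbd : ∀ n y, ‖fderiv ℝ (b n) y‖ₑ ≤
      (ball (x n) (2 * r n)).indicator (fun _ => ENNReal.ofReal (L / r n)) y := fun n y => by
    have h1 : HasFDerivAt (fun y : 𝔼 => (r n)⁻¹ • (y - x n))
        ((r n)⁻¹ • ContinuousLinearMap.id ℝ 𝔼) y :=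
      ((hasFDerivAt_id y).sub_const (x n)).const_smul ((r n)⁻¹)
    have h2 : fderiv ℝ (b n) y = (r n)⁻¹ • fderiv ℝ β ((r n)⁻¹ • (y - x n)) := by
      have h3 := ((hβd.differentiable (by norm_num) _).hasFDerivAt.comp y h1).fderiv
      rw [ContinuousLinearMap.comp_smul, ContinuousLinearMap.comp_id] at h3
      exact h3
    rw [h2]
    by_cases hy : y ∈ ball (x n) (2 * r n)
    · rw [indicator_of_mem hy, ← ofReal_norm, norm_smul, norm_inv,
        Real.norm_of_nonneg (hr n).1.le, ← div_eq_inv_mul]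
      exact ENNReal.ofReal_le_ofReal (div_le_div_of_nonneg_right (hL _) (hr n).1.le)
    · have h4 : fderiv ℝ β ((r n)⁻¹ • (y - x n)) = 0 := by
        refine image_eq_zero_of_notMem_tsupport fun h => hy ?_
        have h5 := hβU (tsupport_fderiv_subset ℝ h)
        rw [mem_ball_zero_iff, norm_smul, norm_inv, Real.norm_of_nonneg (hr n).1.le,
          inv_mul_lt_iff₀ (hr n).1, ← dist_eq_norm] at h5
        rw [mem_ball]; linarith
      rw [h4, smul_zero, ← ofReal_norm, norm_zero, ENNReal.ofReal_zero]
      exact bot_le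
  have hvol : ∀ n, volume (ball (x n) (2 * r n)) = ENNReal.ofReal (2 ^ N * r n) * ω *
      ENNReal.ofReal (r n) ^ (N - 1) := fun n => by
    rw [Measure.addHaar_ball _ _ (by linarith [(hr n).1]), finrank_euclideanSpace_fin,
      ← ENNReal.ofReal_pow (hr n).1.le, mul_right_comm, ← ENNReal.ofReal_mul
      (mul_nonneg (by positivity) (hr n).1.le), mul_assoc, ← pow_succ', Nat.sub_add_cancel hN,
      mul_pow]
  have hD : ∀ n, ∫⁻ y, ‖fderiv ℝ (b n) y‖ₑ ≤
      ENNReal.ofReal (2 * L * 2 ^ N) * ω * ENNReal.ofReal (r n) ^ (N - 1) := fun n => by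
    refine (lintegral_mono (hbd n)).trans ?_
    rw [lintegral_indicator_const measurableSet_ball, hvol, ← mul_assoc, ← mul_assoc,
      ← ENNReal.ofReal_mul (div_nonneg (by linarith) (hr n).1.le)]
    have := (hr n).1
    refine mul_le_mul_left (mul_le_mul_left (ENNReal.ofReal_le_ofReal ?_) _) _
    rw [show L / r n * (2 ^ N * r n) = L * 2 ^ N by field_simp]
    nlinarith [show (0 : ℝ) < 2 ^ N by positivity]
  have hB : ∀ n, ∫⁻ y, ‖b n y‖ₑ ≤
      ENNReal.ofReal (2 * L * 2 ^ N) * ω * ENNReal.ofReal (r n) ^ (N - 1) := fun n => by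
    refine (lintegral_mono (g := (ball (x n) (2 * r n)).indicator fun _ => 1) fun y => ?_).trans ?_
    · by_cases hy : y ∈ ball (x n) (2 * r n)
      · rw [indicator_of_mem hy, Real.enorm_of_nonneg (hβI _).1]
        exact ENNReal.ofReal_le_one.2 (hβI _).2
      · rw [hb0 n y hy, enorm_zero]; exact bot_le
    · rw [lintegral_indicator_const measurableSet_ball, one_mul, hvol]
      have := (hr n).2
      refine mul_le_mul_left (mul_le_mul_left (ENNReal.ofReal_le_ofReal ?_) _) _
      nlinarith [show (0 : ℝ) < 2 ^ N by positivity]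
  induction t using Finset.induction_on with
  | empty => exact ⟨fun _ => 1, contDiff_const, by simp, by simp,
      by simp [fderiv_fun_const, ← ofReal_norm], by simp⟩
  | insert m t hm ih =>
    obtain ⟨η, hη, hηI, hη0, hηD, hηB⟩ := ih
    refine ⟨fun y => η y * (1 - b m y), hη.mul (contDiff_const.sub (hb m)), fun y => ?_, ?_, ?_, ?_⟩
    · have h1 := hηI y
      have h2 : b m y ∈ Icc (0 : ℝ) 1 := hβI _
      exact ⟨mul_nonneg h1.1 (by linarith [h2.2]),
        mul_le_one₀ h1.2 (by linarith [h2.2]) (by linarith [h2.1])⟩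
    · intro n hn y hy
      rcases Finset.mem_insert.1 hn with rfl | hn
      · have : b n y = 1 := hβ1 _ (by
          rw [mem_closedBall_zero_iff, norm_smul, norm_inv, Real.norm_of_nonneg (hr n).1.le,
            inv_mul_le_iff₀ (hr n).1, ← dist_eq_norm, mul_one]
          exact (mem_ball.1 hy).le)
        simp [this]
      · simp [hη0 n hn y hy]
    · rw [Finset.sum_insert hm, mul_add]
      refine le_trans ?_ (add_le_add (hD m) hηD)
      rw [← lintegral_add_left ((hb m).continuous_fderiv (by norm_num)).enorm.measurable]
      refine lintegral_mono fun y => ?_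
      have hd1 := hη.differentiable (by norm_num) y
      have hd2 := (hb m).differentiable (by norm_num) y
      dsimp only
      rw [fderiv_fun_mul hd1 (hd2.const_sub 1), fderiv_const_sub]
      have h2 : b m y ∈ Icc (0 : ℝ) 1 := hβI _
      rw [← ofReal_norm, ← ofReal_norm, ← ofReal_norm,
        ← ENNReal.ofReal_add (norm_nonneg _) (norm_nonneg _)]
      refine ENNReal.ofReal_le_ofReal ((norm_add_le _ _).trans (add_le_add ?_ ?_))
      · rw [smul_neg, norm_neg, norm_smul, Real.norm_of_nonneg (hηI y).1]
        exact mul_le_of_le_one_left (norm_nonneg _) (hηI y).2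
      · rw [norm_smul, Real.norm_of_nonneg (by linarith [h2.2])]
        exact mul_le_of_le_one_left (norm_nonneg _) (by linarith [h2.1])
    · rw [Finset.sum_insert hm, mul_add]
      refine le_trans ?_ (add_le_add (hB m) hηB)
      rw [← lintegral_add_left (hb m).continuous.enorm.measurable]
      refine lintegral_mono fun y => ?_
      dsimp only
      rw [show 1 - η y * (1 - b m y) = η y * b m y + (1 - η y) by ring]
      refine (enorm_add_le _ _).trans (add_le_add ?_ le_rfl)
      rw [enorm_mul, Real.enorm_of_nonneg (hηI y).1]
      exact mul_le_of_le_one_left' (ENNReal.ofReal_le_one.2 (hηI y).2)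

lemma exists_cutoff_of_hausdorffMeasure_eq_zero (hN : 2 ≤ N) {S : Set 𝔼} (hS : IsCompact S)
    (h0 : Measure.hausdorffMeasure ((N - 1 : ℕ) : ℝ) S = 0) {ε : ℝ≥0∞} (hε : ε ≠ 0) :
    ∃ η : 𝔼 → ℝ, ContDiff ℝ 1 η ∧ (∀ y, η y ∈ Icc (0 : ℝ) 1) ∧ (∀ x ∈ S, x ∉ tsupport η) ∧
      ∫⁻ y, ‖fderiv ℝ η y‖ₑ ≤ ε ∧ ∫⁻ y, ‖1 - η y‖ₑ ≤ ε := by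
  obtain ⟨A, hA, h⟩ := exists_balls_cutoff (N := N) (by omega)
  obtain ⟨t, x, r, hr, hSt, hsum⟩ := exists_finite_cover_of_hausdorffMeasure_eq_zero
    (by omega : 1 ≤ N - 1) hS h0 (ENNReal.div_ne_zero.2 ⟨hε, hA⟩)
  obtain ⟨η, hη, hηI, hη0, hηD, hηB⟩ := h x r hr t
  have hle : A * ∑ n ∈ t, ENNReal.ofReal (r n) ^ (N - 1) ≤ ε :=
    (mul_le_mul_right hsum A).trans ENNReal.mul_div_le
  refine ⟨η, hη, hηI, fun y hy => ?_, hηD.trans hle, hηB.trans hle⟩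
  obtain ⟨n, hn, hyn⟩ := mem_iUnion₂.1 (hSt hy)
  rw [notMem_tsupport_iff_eventuallyEq]
  filter_upwards [isOpen_ball.mem_nhds hyn] with z hz using hη0 n hn z hz

lemma isClosed_singular {Ω : Set 𝔼} (hΩ : IsOpen Ω) :
    IsClosed {x ∈ frontier Ω | ¬ IsC1BoundaryPoint Ω x} := by
  refine isClosed_of_closure_subset fun x hx => ?_
  refine ⟨closure_minimal (fun y hy => hy.1) isClosed_frontier hx, fun h => ?_⟩
  obtain ⟨y, hy, hyS⟩ := (mem_closure_iff_frequently.1 hx).and_eventually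
    (h.eventually hΩ) |>.exists
  exact hy.2 (hyS hy.1)

/-- The singular part of the boundary is compact with zero (N-1)-dimensional measure, so it has zero
W^{1,1} capacity and can be removed at arbitrarily small cost. -/
lemma exists_cutoff_singular (hN : 2 ≤ N) {Ω : Set 𝔼} (hΩ : IsPiecewiseC1Domain Ω) {ε : ℝ≥0∞}
    (hε : ε ≠ 0) :
    ∃ η : 𝔼 → ℝ, ContDiff ℝ 1 η ∧ (∀ y, η y ∈ Icc (0 : ℝ) 1) ∧
      (∀ x ∈ frontier Ω ∩ tsupport η, IsC1BoundaryPoint Ω x) ∧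
      ∫⁻ y, ‖fderiv ℝ η y‖ₑ ≤ ε ∧ ∫⁻ y, ‖1 - η y‖ₑ ≤ ε := by
  set S : Set 𝔼 := {x ∈ frontier Ω | ¬ IsC1BoundaryPoint Ω x}
  have hSc : IsClosed S := isClosed_singular hΩ.isOpen
  have hScpt : IsCompact S := hΩ.isBounded.isCompact_closure.of_isClosed_subset hSc
    fun x hx => frontier_subset_closure hx.1
  have h0 : Measure.hausdorffMeasure ((N - 1 : ℕ) : ℝ) S = 0 := by
    have h1 : surfaceMeasure Ω S = 0 := measure_mono_null (fun x hx => hx.2) hΩ.ae_c1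
    rw [surfaceMeasure, Measure.restrict_apply hSc.measurableSet,
      inter_eq_left.2 fun x hx => hx.1, Measure.euclideanHausdorffMeasure_def,
      Measure.smul_apply, ENNReal.smul_def, smul_eq_mul, mul_eq_zero] at h1
    exact h1.resolve_left (by
      simpa using Measure.addHaarScalarFactor_volume_hausdorffMeasure_ne_zero (N - 1))
  obtain ⟨η, h1, h2, h3, h4, h5⟩ := exists_cutoff_of_hausdorffMeasure_eq_zero hN hScpt h0 hε
  exact ⟨η, h1, h2, fun x hx => by
    by_contra h
    exact h3 x ⟨hx.1, h⟩ hx.2, h4, h5⟩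

/-! ### Strict approximation by test functions -/

lemma tendsto_lintegral_layer {Ω : Set 𝔼} (hΩ : IsOpen Ω) (hne : Ω ≠ univ) {u : 𝔼 → ℝ}
    (hu : IntegrableOn u Ω) :
    Tendsto (fun h => ∫⁻ x in layer Ω h, ‖u x‖ₑ) (𝓝[>] 0) (𝓝 0) := by
  have h1 : ∀ h, ∫⁻ x in layer Ω h, ‖u x‖ₑ =
      ∫⁻ x in Ω, {x | infDist x Ωᶜ < h}.indicator (fun x => ‖u x‖ₑ) x := fun h => by
    rw [lintegral_indicator (isOpen_lt (continuous_infDist_pt _) continuous_const).measurableSet,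
      Measure.restrict_restrict (isOpen_lt (continuous_infDist_pt _)
        continuous_const).measurableSet, inter_comm]
    rfl
  simp_rw [h1]
  rw [← lintegral_zero (μ := volume.restrict Ω)]
  refine tendsto_lintegral_filter_of_dominated_convergence' (fun x => ‖u x‖ₑ)
    (Eventually.of_forall fun h => hu.aestronglyMeasurable.enorm.indicator
      (isOpen_lt (continuous_infDist_pt _) continuous_const).measurableSet)
    (Eventually.of_forall fun h => Eventually.of_forall fun x => indicator_le_self _ _ x)
    hu.2.ne ?_
  filter_upwards [ae_restrict_mem hΩ.measurableSet] with x hx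
  have hpos : 0 < infDist x Ωᶜ := by
    refine infDist_nonneg.lt_of_ne' fun h0 => ?_
    have := (hΩ.isClosed_compl.mem_iff_infDist_zero (nonempty_compl.2 hne)).2 h0
    exact this hx
  refine tendsto_const_nhds.congr' ?_
  filter_upwards [Ioo_mem_nhdsGT hpos] with h hh
  rw [indicator_of_notMem]
  exact not_lt.2 hh.2.le

lemma lintegral_enorm_sub_triangle {α : Type*} [MeasurableSpace α] {μ : Measure α} {f g k : α → ℝ}
    (hg : AEMeasurable (fun x => g x - k x) μ) :
    ∫⁻ x, ‖f x - k x‖ₑ ∂μ ≤ ∫⁻ x, ‖f x - g x‖ₑ ∂μ + ∫⁻ x, ‖g x - k x‖ₑ ∂μ := by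
  rw [← lintegral_add_right' _ hg.enorm]
  refine lintegral_mono fun x => ?_
  calc ‖f x - k x‖ₑ = ‖(f x - g x) + (g x - k x)‖ₑ := by rw [sub_add_sub_cancel]
    _ ≤ _ := enorm_add_le _ _

/-- For w = ηχu, the product rule bounds the variation by that of u plus ∫|u||∇η| + ∫|ηu||∇χ|. The
first integral is small because u is bounded and η has small gradient mass. The second is at most
(1+θ)/h times the mass of ηu in the layer, hence at most the trace integral up to a small error. As
w vanishes outside a compact subset of Ω, mollification finishes. -/
lemma exists_isTestFunction_approx_of_bounded (hN : 2 ≤ N) {Ω : Set 𝔼}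
    (hΩ : IsPiecewiseC1Domain Ω) {u : 𝔼 → ℝ} (hu : MemBV Ω u) {M : ℝ} (hM : ∀ x, |u x| ≤ M)
    (hE : relaxedEnergy Ω u ≠ ⊤) {δ : ℝ} (hδ : 0 < δ) :
    ∃ ψ, IsTestFunction Ω ψ ∧ ∫⁻ x in Ω, ‖ψ x - u x‖ₑ ≤ ENNReal.ofReal δ ∧
      ∫⁻ x in Ω, ‖fderiv ℝ ψ x‖ₑ ≤ relaxedEnergy Ω u + ENNReal.ofReal δ := by
  have hM0 : 0 ≤ M := (abs_nonneg _).trans (hM 0)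
  have hne := hΩ.ne_univ (by omega)
  have hMe : ∀ x, ‖u x‖ₑ ≤ ENNReal.ofReal M := fun x => by
    rw [← ofReal_norm]; exact ENNReal.ofReal_le_ofReal (hM x)
  set T := ∫⁻ x, ‖trace Ω u x‖ₑ ∂(surfaceMeasure Ω) with hT
  have hTt : T ≠ ⊤ := fun h => hE (by rw [relaxedEnergy, ← hT, h, add_top])
  set e := ENNReal.ofReal (δ / 4) with he
  have he0 : 0 < e := ENNReal.ofReal_pos.2 (by linarith)
  have het : e ≠ ⊤ := ENNReal.ofReal_ne_top
  have h4e : ENNReal.ofReal δ = e + e + e + e := by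
    rw [he, ← ENNReal.ofReal_add (by linarith) (by linarith),
      ← ENNReal.ofReal_add (by linarith) (by linarith),
      ← ENNReal.ofReal_add (by linarith) (by linarith)]
    congr 1; ring
  -- cut off near the singular part of the boundary
  obtain ⟨η, hη, hηI, hηc, hηD, hηB⟩ := exists_cutoff_singular hN hΩ
    (ENNReal.div_ne_zero.2 ⟨he0.ne', ENNReal.ofReal_ne_top (r := M)⟩)
  -- If M = 0 the quotient is ⊤, and the bound still holds because 0 * ⊤ = 0.
  have hMη : ∀ {I : ℝ≥0∞}, I ≤ e / ENNReal.ofReal M → ENNReal.ofReal M * I ≤ e := fun h =>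
    (mul_le_mul_right h _).trans ENNReal.mul_div_le
  -- choose the slope
  obtain ⟨θ, hθ, hθT⟩ : ∃ θ : ℝ, 0 < θ ∧ ENNReal.ofReal (1 + θ) * (T + e) < T + e + e := by
    have h1 : Tendsto (fun θ : ℝ => ENNReal.ofReal (1 + θ) * (T + e)) (𝓝 0) (𝓝 (T + e)) := by
      have h2 : Continuous fun θ : ℝ => ENNReal.ofReal (1 + θ) :=
        ENNReal.continuous_ofReal.comp (by fun_prop)
      have h3 := ENNReal.Tendsto.mul_const (b := T + e) (h2.tendsto 0)
        (Or.inr (ENNReal.add_ne_top.2 ⟨hTt, het⟩))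
      simpa using h3
    have h4 := ((h1.mono_left nhdsWithin_le_nhds).eventually (gt_mem_nhds
      (ENNReal.lt_add_right (ENNReal.add_ne_top.2 ⟨hTt, het⟩) he0.ne'))).and
      (self_mem_nhdsWithin (a := (0 : ℝ)) (s := Ioi 0))
    obtain ⟨θ, h, h'⟩ := h4.exists
    exact ⟨θ, h', h⟩
  -- choose the width of the layer
  obtain ⟨h, hh, hlayer, hL1⟩ : ∃ h : ℝ, 0 < h ∧
      (∫⁻ x in layer Ω h, ‖η x * u x‖ₑ) / ENNReal.ofReal h < T + e ∧
      ∫⁻ x in layer Ω h, ‖u x‖ₑ ≤ e := by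
    have h1 := eventually_lintegral_layer_lt (by omega) hΩ hu hηI hηc
      (ENNReal.lt_add_right hTt he0.ne')
    have h2 := (tendsto_lintegral_layer hΩ.isOpen hne hu.1).eventually_le_const he0
    obtain ⟨h, ⟨h3, h4⟩, h5⟩ := ((h1.and h2).and (self_mem_nhdsWithin (a := (0 : ℝ))
      (s := Ioi 0))).exists
    exact ⟨h, h5, h3, h4⟩
  obtain ⟨χ, hχ, hχI, ⟨C, hC, hCΩ, hχC⟩, hχ1, hχD⟩ := exists_layer_cutoff hΩ.isBounded hh hθ
  have hlm := measurableSet_layer hΩ.isOpen h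
  have hlΩ : layer Ω h ⊆ Ω := inter_subset_left
  have hηχI : ∀ x, η x * χ x ∈ Icc (0 : ℝ) 1 := fun x =>
    ⟨mul_nonneg (hηI x).1 (hχI x).1, mul_le_one₀ (hηI x).2 (hχI x).1 (hχI x).2⟩
  set w : 𝔼 → ℝ := fun x => (η x * χ x) * u x with hw
  have hwC : ∀ x ∉ C, w x = 0 := fun x hx => by simp [hw, hχC x hx]
  have hum := hu.1.aestronglyMeasurable
  have hwm' : AEStronglyMeasurable w (volume.restrict Ω) :=
    (hη.continuous.mul hχ.continuous).aestronglyMeasurable.mul hum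
  have hwm : AEStronglyMeasurable w := by
    have : Ω.indicator w = w := indicator_eq_self.2 fun x hx => by
      by_contra hxΩ
      exact hx (hwC x fun h => hxΩ (hCΩ h))
    rw [← this]
    exact (aestronglyMeasurable_indicator_iff hΩ.isOpen.measurableSet).2 hwm'
  have hwM : ∀ x, |w x| ≤ M := fun x => by
    rw [hw, abs_mul, abs_of_nonneg (hηχI x).1]
    exact (mul_le_of_le_one_left (abs_nonneg _) (hηχI x).2).trans (hM x)
  have hTV : totalVariation Ω w ≤ relaxedEnergy Ω u + ENNReal.ofReal δ := by
    have h1 := totalVariation_mul_le hu.1 (hη.mul hχ) hηχI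
    have hpt : ∀ x ∈ Ω, ‖u x‖ₑ * ‖fderiv ℝ (fun x => η x * χ x) x‖ₑ ≤
        ENNReal.ofReal M * ‖fderiv ℝ η x‖ₑ + ENNReal.ofReal ((1 + θ) / h) *
          (layer Ω h).indicator (fun x => ‖η x * u x‖ₑ) x := fun x hx => by
      have hd : ‖fderiv ℝ (fun x => η x * χ x) x‖ₑ ≤
          ‖fderiv ℝ η x‖ₑ + ‖η x‖ₑ * ‖fderiv ℝ χ x‖ₑ := by
        rw [fderiv_fun_mul (hη.differentiable (by norm_num) x)
          (hχ.differentiable (by norm_num) x), ← ofReal_norm, ← ofReal_norm, ← ofReal_norm,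
          ← ofReal_norm, ← ENNReal.ofReal_mul (norm_nonneg _),
          ← ENNReal.ofReal_add (norm_nonneg _) (by positivity)]
        refine ENNReal.ofReal_le_ofReal ((norm_add_le _ _).trans ?_)
        rw [add_comm, norm_smul, norm_smul, Real.norm_of_nonneg (hχI x).1]
        exact add_le_add (mul_le_of_le_one_left (norm_nonneg _) (hχI x).2) le_rfl
      refine (mul_le_mul_right hd _).trans ?_
      rw [mul_add]
      refine add_le_add (mul_le_mul_left (hMe x) _) ?_
      by_cases hxh : infDist x Ωᶜ < h
      · rw [indicator_of_mem (show x ∈ layer Ω h from ⟨hx, hxh⟩), enorm_mul, ← mul_assoc,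
          mul_comm (‖u x‖ₑ), mul_comm]
        exact mul_le_mul_left (hχD x) _
      · rw [(hχ1 x (not_lt.1 hxh)).2, ← ofReal_norm (0 : 𝔼 →L[ℝ] ℝ), norm_zero,
          ENNReal.ofReal_zero, mul_zero, mul_zero]
        exact bot_le
    have h2 : ∫⁻ x in Ω, ‖u x‖ₑ * ‖fderiv ℝ (fun x => η x * χ x) x‖ₑ ≤
        e + (T + e + e) := by
      refine (setLIntegral_mono' hΩ.isOpen.measurableSet hpt).trans ?_
      rw [lintegral_add_left ((hη.continuous_fderiv (by norm_num)).enorm.measurable.const_mul _),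
        lintegral_const_mul' _ _ ENNReal.ofReal_ne_top,
        lintegral_const_mul' _ _ ENNReal.ofReal_ne_top]
      refine add_le_add (hMη ((setLIntegral_le_lintegral _ _).trans hηD)) ?_
      rw [lintegral_indicator hlm, Measure.restrict_restrict hlm,
        inter_eq_left.2 hlΩ]
      refine le_trans (le_of_eq ?_) ((mul_le_mul_right hlayer.le (ENNReal.ofReal (1 + θ))).trans
        hθT.le)
      rw [ENNReal.ofReal_div_of_pos hh, mul_div_assoc', ENNReal.mul_div_right_comm]
    refine h1.trans ((add_le_add le_rfl h2).trans ?_)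
    rw [relaxedEnergy, ← hT, h4e]
    calc totalVariation Ω u + (e + (T + e + e)) = totalVariation Ω u + T + (e + e + e) := by ring
      _ ≤ _ := add_le_add le_rfl le_self_add
  have hwu : ∫⁻ x in Ω, ‖w x - u x‖ₑ ≤ e + e := by
    have hpt : ∀ x ∈ Ω, ‖w x - u x‖ₑ ≤ ENNReal.ofReal M * ‖1 - η x‖ₑ +
        (layer Ω h).indicator (fun x => ‖u x‖ₑ) x := fun x hx => by
      have h1 : w x - u x = -((1 - η x) * u x + η x * (1 - χ x) * u x) := by
        simp only [hw]; ring
      rw [h1, enorm_neg]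
      refine (enorm_add_le _ _).trans (add_le_add ?_ ?_)
      · rw [enorm_mul, mul_comm]
        exact mul_le_mul_left (hMe x) _
      by_cases hxh : infDist x Ωᶜ < h
      · rw [indicator_of_mem (show x ∈ layer Ω h from ⟨hx, hxh⟩), enorm_mul]
        refine mul_le_of_le_one_left' ?_
        rw [Real.enorm_of_nonneg (mul_nonneg (hηI x).1 (by linarith [(hχI x).2]))]
        exact ENNReal.ofReal_le_one.2 (mul_le_one₀ (hηI x).2 (by linarith [(hχI x).2])
          (by linarith [(hχI x).1]))
      · rw [(hχ1 x (not_lt.1 hxh)).1, sub_self, mul_zero, zero_mul, enorm_zero]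
        exact bot_le
    refine (setLIntegral_mono' hΩ.isOpen.measurableSet hpt).trans ?_
    have hm : Measurable fun x => ENNReal.ofReal M * ‖1 - η x‖ₑ := by
      have := hη.continuous.measurable
      fun_prop
    rw [lintegral_add_left hm,
      lintegral_const_mul' _ _ ENNReal.ofReal_ne_top, lintegral_indicator hlm,
      Measure.restrict_restrict hlm, inter_eq_left.2 hlΩ]
    exact add_le_add (hMη ((setLIntegral_le_lintegral _ _).trans hηB)) hL1
  obtain ⟨ψ, hψ, hψw, hψD⟩ := exists_isTestFunction_approx_of_compact hΩ.isOpen hC hCΩ hwm hwC hwM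
  obtain ⟨k, hk⟩ := (hψw.eventually_le_const he0).exists
  refine ⟨ψ k, hψ k, ?_, (hψD k).trans hTV⟩
  refine (lintegral_enorm_sub_triangle (g := w) (hwm'.sub hum).aemeasurable).trans
    ((add_le_add hk hwu).trans ?_)
  rw [h4e, add_assoc, add_assoc e e (e + e)]
  exact add_le_add le_rfl (add_le_add le_rfl le_self_add)

/-- The truncations `n sin (s / n)`. -/
def sinTrunc (n : ℕ) (s : ℝ) : ℝ := ((n : ℝ) + 1) * Real.sin (s / ((n : ℝ) + 1))

lemma hasDerivAt_sinTrunc (n : ℕ) (s : ℝ) :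
    HasDerivAt (sinTrunc n) (Real.cos (s / ((n : ℝ) + 1))) s := by
  have hn : (n : ℝ) + 1 ≠ 0 := by positivity
  have h := (((hasDerivAt_id s).div_const ((n : ℝ) + 1)).sin).const_mul ((n : ℝ) + 1)
  have e : ((n : ℝ) + 1) * (Real.cos (id s / ((n : ℝ) + 1)) * (1 / ((n : ℝ) + 1))) =
      Real.cos (s / ((n : ℝ) + 1)) := by
    rw [one_div, mul_comm, mul_assoc, inv_mul_cancel₀ hn, mul_one, id]
  rw [← e]
  exact h

lemma contDiff_sinTrunc (n : ℕ) : ContDiff ℝ 1 (sinTrunc n) := by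
  unfold sinTrunc
  fun_prop

lemma abs_sinTrunc_le (n : ℕ) (s : ℝ) : |sinTrunc n s| ≤ (n : ℝ) + 1 := by
  have hn : 0 < (n : ℝ) + 1 := by positivity
  rw [sinTrunc, abs_mul, abs_of_pos hn]
  exact mul_le_of_le_one_right hn.le (Real.abs_sin_le_one _)

lemma lipschitzWith_sinTrunc (n : ℕ) : LipschitzWith 1 (sinTrunc n) :=
  lipschitzWith_of_nnnorm_deriv_le (fun s => (hasDerivAt_sinTrunc n s).differentiableAt)
    fun s => by
      rw [(hasDerivAt_sinTrunc n s).deriv, ← NNReal.coe_le_coe]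
      exact Real.abs_cos_le_one _

lemma enorm_sinTrunc_le (n : ℕ) (s : ℝ) : ‖sinTrunc n s‖ₑ ≤ ‖s‖ₑ := by
  have := lipschitzWith_sinTrunc n s 0
  rw [edist_eq_enorm_sub, edist_eq_enorm_sub] at this
  simpa [sinTrunc] using this

lemma tendsto_sinTrunc (s : ℝ) : Tendsto (fun n => sinTrunc n s) atTop (𝓝 s) := by
  have h1 : HasDerivAt (fun t => Real.sin (t * s)) s 0 := by
    have h := ((hasDerivAt_id (0 : ℝ)).mul_const s).sin
    simpa using h
  have h2 := hasDerivAt_iff_tendsto_slope_zero.1 h1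
  have h3 : Tendsto (fun n : ℕ => 1 / ((n : ℝ) + 1)) atTop (𝓝[≠] 0) :=
    tendsto_nhdsWithin_iff.2 ⟨tendsto_one_div_add_atTop_nhds_zero_nat,
      Eventually.of_forall fun n => by
        simp only [mem_compl_iff, mem_singleton_iff]; positivity⟩
  refine (h2.comp h3).congr fun n => ?_
  simp only [Function.comp_apply, sinTrunc, smul_eq_mul, zero_add, zero_mul, Real.sin_zero,
    sub_zero]
  rw [one_div, inv_inv, ← div_eq_inv_mul]

lemma MemBV.comp_sinTrunc {Ω : Set 𝔼} (hΩ : IsPiecewiseC1Domain Ω) {u : 𝔼 → ℝ} (hu : MemBV Ω u)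
    (n : ℕ) : MemBV Ω (fun x => sinTrunc n (u x)) ∧
      totalVariation Ω (fun x => sinTrunc n (u x)) ≤ totalVariation Ω u := by
  have h := totalVariation_comp_le hΩ.isOpen hΩ.isBounded hu.1 (contDiff_sinTrunc n)
    (fun s => by rw [(hasDerivAt_sinTrunc n s).deriv]; exact Real.abs_cos_le_one _)
    (abs_sinTrunc_le n)
  refine ⟨⟨Integrable.mono hu.1 ((contDiff_sinTrunc n).continuous.comp_aestronglyMeasurable
    hu.1.aestronglyMeasurable) (Eventually.of_forall fun x => ?_), h.trans_lt hu.2⟩, h⟩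
  have := enorm_sinTrunc_le n (u x)
  rwa [enorm_le_iff_norm_le] at this

/-- The truncations `sinTrunc n` remove the boundedness assumption: they are bounded, smooth enough
for `totalVariation_comp_le`, and 1-Lipschitz. Thus they do not increase the variation, and since
traces commute with 1-Lipschitz maps, they do not increase the boundary term either. -/
lemma exists_isTestFunction_approx (hN : 2 ≤ N) {Ω : Set 𝔼} (hΩ : IsPiecewiseC1Domain Ω)
    {u : 𝔼 → ℝ} (hu : MemBV Ω u) (hE : relaxedEnergy Ω u ≠ ⊤) {δ : ℝ} (hδ : 0 < δ) :
    ∃ ψ, IsTestFunction Ω ψ ∧ ∫⁻ x in Ω, ‖ψ x - u x‖ₑ ≤ ENNReal.ofReal δ ∧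
      ∫⁻ x in Ω, ‖fderiv ℝ ψ x‖ₑ ≤ relaxedEnergy Ω u + ENNReal.ofReal δ := by
  have hEn : ∀ n, relaxedEnergy Ω (fun x => sinTrunc n (u x)) ≤ relaxedEnergy Ω u := fun n => by
    refine add_le_add (hu.comp_sinTrunc hΩ n).2 (lintegral_mono_ae ?_)
    filter_upwards [ae_hasTrace (by omega) hΩ hu,
      ae_restrict_mem isClosed_frontier.measurableSet] with x hx hxf
    rw [(hx.comp (lipschitzWith_sinTrunc n)).trace_eq hΩ.isOpen (hu.comp_sinTrunc hΩ n).1.1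
      (frontier_subset_closure hxf)]
    exact enorm_sinTrunc_le n _
  have hlim : Tendsto (fun n => ∫⁻ x in Ω, ‖sinTrunc n (u x) - u x‖ₑ) atTop (𝓝 0) := by
    rw [← lintegral_zero (μ := volume.restrict Ω)]
    refine tendsto_lintegral_of_dominated_convergence' (fun x => ‖u x‖ₑ + ‖u x‖ₑ)
      (fun n => ((hu.comp_sinTrunc hΩ n).1.1.aestronglyMeasurable.sub
        hu.1.aestronglyMeasurable).enorm) (fun n => Eventually.of_forall fun x => ?_) ?_
      (Eventually.of_forall fun x => ?_)
    · exact enorm_sub_le.trans (add_le_add (enorm_sinTrunc_le n _) le_rfl)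
    · rw [lintegral_add_left' hu.1.aestronglyMeasurable.enorm]
      exact ENNReal.add_ne_top.2 ⟨hu.1.2.ne, hu.1.2.ne⟩
    · have := ((tendsto_sinTrunc (u x)).sub_const (u x)).enorm
      simpa using this
  obtain ⟨n, hn⟩ := (hlim.eventually_le_const (ENNReal.ofReal_pos.2 (half_pos hδ))).exists
  obtain ⟨ψ, hψ, hψu, hψD⟩ := exists_isTestFunction_approx_of_bounded hN hΩ (hu.comp_sinTrunc hΩ n).1
    (fun x => abs_sinTrunc_le n (u x)) ((hEn n).trans_lt hE.lt_top).ne (half_pos hδ)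
  refine ⟨ψ, hψ, ?_, hψD.trans (add_le_add (hEn n) (ENNReal.ofReal_le_ofReal (by linarith)))⟩
  refine (lintegral_enorm_sub_triangle ((hu.comp_sinTrunc hΩ n).1.1.aestronglyMeasurable.sub
    hu.1.aestronglyMeasurable).aemeasurable).trans ((add_le_add hψu hn).trans (le_of_eq ?_))
  rw [← ENNReal.ofReal_add (by linarith) (by linarith), add_halves]

/-! ### Lower semicontinuity of the relaxed energy along test functions -/

lemma IsTestFunction.contDiff_one {Ω : Set 𝔼} {ψ : 𝔼 → ℝ} (h : IsTestFunction Ω ψ) :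
    ContDiff ℝ 1 ψ := h.contDiff.of_le (by simp)

lemma IsTestFunction.eq_zero {Ω : Set 𝔼} {ψ : 𝔼 → ℝ} (h : IsTestFunction Ω ψ) {x : 𝔼}
    (hx : x ∉ Ω) : ψ x = 0 :=
  image_eq_zero_of_notMem_tsupport fun h' => hx (h.tsupport_subset h')

lemma IsTestFunction.integrable {Ω : Set 𝔼} {ψ : 𝔼 → ℝ} (h : IsTestFunction Ω ψ) :
    Integrable ψ := h.contDiff.continuous.integrable_of_hasCompactSupport h.hasCompactSupport

lemma IsTestField.tendsto_integral {Ω : Set 𝔼} {φ : 𝔼 → 𝔼} (hφ : IsTestField Ω φ)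
    {ψ : ℕ → 𝔼 → ℝ} {v : 𝔼 → ℝ} (hψ : ∀ n, IntegrableOn (ψ n) Ω) (hv : IntegrableOn v Ω)
    (h : Tendsto (fun n => ∫⁻ x in Ω, ‖ψ n x - v x‖ₑ) atTop (𝓝 0)) :
    Tendsto (fun n => ∫ x in Ω, ψ n x * divergence φ x) atTop
      (𝓝 (∫ x in Ω, v x * divergence φ x)) := by
  refine tendsto_integral_of_L1 _ (hφ.integrableOn_mul hv).aestronglyMeasurable
    (Eventually.of_forall fun n => hφ.integrableOn_mul (hψ n)) ?_
  obtain ⟨L, hL⟩ := (continuous_divergence hφ.contDiff).bounded_above_of_compact_support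
    (hasCompactSupport_divergence hφ.hasCompactSupport)
  have h1 := ENNReal.Tendsto.const_mul h (Or.inr (ENNReal.ofReal_ne_top (r := L)))
  rw [mul_zero] at h1
  refine tendsto_of_tendsto_of_tendsto_of_le_of_le tendsto_const_nhds h1 (fun n => bot_le)
    fun n => ?_
  dsimp only
  rw [← lintegral_const_mul' _ _ ENNReal.ofReal_ne_top]
  refine lintegral_mono fun x => ?_
  dsimp only
  rw [← sub_mul, enorm_mul, mul_comm, ← ofReal_norm (divergence φ x)]
  exact mul_le_mul_left (ENNReal.ofReal_le_ofReal (hL x)) _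

lemma tendsto_lintegral_enorm_mul {Ω A : Set 𝔼} (hA : A ⊆ Ω) {ψ : ℕ → 𝔼 → ℝ} {v : 𝔼 → ℝ}
    (hψ : ∀ n, IntegrableOn (ψ n) Ω) (hv : IntegrableOn v Ω)
    (h : Tendsto (fun n => ∫⁻ x in Ω, ‖ψ n x - v x‖ₑ) atTop (𝓝 0)) {ζ : 𝔼 → ℝ}
    (hζ : Continuous ζ) (hζ1 : ∀ y, ζ y ∈ Icc (0 : ℝ) 1) :
    Tendsto (fun n => ∫⁻ x in A, ‖ζ x * ψ n x‖ₑ) atTop (𝓝 (∫⁻ x in A, ‖ζ x * v x‖ₑ)) := by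
  have hζ2 : ∀ y, ‖ζ y‖ₑ ≤ 1 := fun y => by
    rw [Real.enorm_of_nonneg (hζ1 y).1]
    exact ENNReal.ofReal_le_one.2 (hζ1 y).2
  have hfin : ∫⁻ x in A, ‖ζ x * v x‖ₑ ≠ ⊤ := by
    refine ((lintegral_mono (g := fun x => ‖v x‖ₑ) fun x => ?_).trans_lt
      ((lintegral_mono_set hA).trans_lt hv.2)).ne
    rw [enorm_mul]
    exact mul_le_of_le_one_left' (hζ2 x)
  have hD : ∀ n, ∫⁻ x in A, ‖ζ x * ψ n x - ζ x * v x‖ₑ ≤ ∫⁻ x in Ω, ‖ψ n x - v x‖ₑ := fun n => by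
    refine (lintegral_mono fun x => ?_).trans (lintegral_mono_set hA)
    rw [← mul_sub, enorm_mul]
    exact mul_le_of_le_one_left' (hζ2 x)
  refine tendsto_of_le_add hfin (Eventually.of_forall fun n => ?_)
    (Eventually.of_forall fun n => ?_) h
  · exact (lintegral_enorm_le_add (hζ.aemeasurable.mul
      (hv.mono_set hA).aemeasurable)).trans (add_le_add le_rfl (hD n))
  · refine (lintegral_enorm_le_add (g := fun x => ζ x * ψ n x) (hζ.aemeasurable.mul
      ((hψ n).mono_set hA).aemeasurable)).trans (add_le_add le_rfl ?_)
    rw [lintegral_enorm_sub_comm]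
    exact hD n

lemma totalVariation_le_of_tendsto {Ω : Set 𝔼} {ψ : ℕ → 𝔼 → ℝ} {v : 𝔼 → ℝ}
    (hψ : ∀ n, IsTestFunction Ω (ψ n)) (hv : IntegrableOn v Ω)
    (h : Tendsto (fun n => ∫⁻ x in Ω, ‖ψ n x - v x‖ₑ) atTop (𝓝 0)) {a : ℝ≥0∞}
    (ha : ∀ n, ∫⁻ x in Ω, ‖fderiv ℝ (ψ n) x‖ₑ ≤ a) : totalVariation Ω v ≤ a := by
  refine iSup₂_le fun φ hφ => ?_
  refine le_of_tendsto' (ENNReal.continuous_ofReal.continuousAt.tendsto.comp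
    (hφ.tendsto_integral (fun n => (hψ n).integrable.integrableOn) hv h)) fun n => ?_
  exact (hφ.le_totalVariation (ψ n)).trans
    ((totalVariation_le_lintegral_fderiv Ω (hψ n).contDiff_one).trans (ha n))

/-- Poincaré inequality on a strip for functions vanishing on its bottom. The constant is exactly h,
because vertical lines run in a unit direction; this is what makes the boundary term in the
semicontinuity sharp. -/
lemma GraphChart.lintegral_strip_le {Ω : Set 𝔼} {x₀ : 𝔼} {ε : ℝ} (c : GraphChart Ω x₀ ε) {h : ℝ}
    {w : 𝔼 → ℝ} (hw : ContDiff ℝ 1 w) (hw0 : ∀ p, ‖p‖ < c.R → w (c.bdry p) = 0) :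
    ∫⁻ x in c.strip h, ‖w x‖ₑ ≤ ENNReal.ofReal h * ∫⁻ x in c.strip h, ‖fderiv ℝ w x‖ₑ := by
  have hm : Measurable fun x => ‖fderiv ℝ w x‖ₑ :=
    (hw.continuous_fderiv (by norm_num)).enorm.measurable
  rw [c.lintegral_strip hw.continuous.enorm.measurable.aemeasurable,
    c.lintegral_strip hm.aemeasurable, ← lintegral_const_mul' _ _ ENNReal.ofReal_ne_top]
  refine setLIntegral_mono' measurableSet_ball fun p hp => ?_
  have hp0 := hw0 p (by simpa using hp)
  calc ∫⁻ s in Ioo 0 h, ‖w (c.Λ (p, s))‖ₑ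
      ≤ ∫⁻ _ in Ioo 0 h, ∫⁻ τ in Ioo 0 h, ‖fderiv ℝ w (c.Λ (p, τ))‖ₑ := by
        refine setLIntegral_mono' measurableSet_Ioo fun s hs => ?_
        have h1 := c.enorm_sub_le_lintegral_vertical hw p hs.1.le
        rw [show w (c.Λ (p, 0)) = 0 from hp0, sub_zero] at h1
        exact h1.trans (lintegral_mono_set fun τ hτ => ⟨hτ.1, hτ.2.trans_lt hs.2⟩)
    _ = _ := by rw [setLIntegral_const, Real.volume_Ioo, sub_zero, mul_comm]

/-- The gradient on the support of φ pays for the interior term and the gradient in the layer pays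
for the strip averages. These sets are disjoint, so a single copy of the gradient mass suffices.
Derivatives falling on the partition functions leave the term with L, which vanishes with h. -/
lemma BoundaryPartition.add_sum_strip_le {Ω K : Set 𝔼} (hΩ : IsOpen Ω) {ε : ℝ}
    (P : BoundaryPartition Ω K ε) {L : ℝ≥0∞} (hLt : L ≠ ⊤) (hL : ∀ i x, ‖fderiv ℝ (P.ζ i) x‖ₑ ≤ L)
    {φ : 𝔼 → 𝔼} (hφ : IsTestField Ω φ) {h : ℝ} (hR : ∀ i, h ≤ (P.c i).R)
    (hdisj : Disjoint (layer Ω h) (tsupport φ)) {ψ : 𝔼 → ℝ} (hψ : IsTestFunction Ω ψ) :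
    ENNReal.ofReal (∫ x in Ω, ψ x * divergence φ x) +
        ∑ i, (∫⁻ x in (P.c i).strip h, ‖P.ζ i x * ψ x‖ₑ) / ENNReal.ofReal h ≤
      (∫⁻ x in Ω, ‖fderiv ℝ ψ x‖ₑ) + L * ∑ i, ∫⁻ x in (P.c i).strip h, ‖ψ x‖ₑ := by
  have hψ1 := hψ.contDiff_one
  have hm : Measurable fun x => ‖fderiv ℝ ψ x‖ₑ :=
    (hψ1.continuous_fderiv (by norm_num)).enorm.measurable
  have hstrip : ∀ i, (∫⁻ x in (P.c i).strip h, ‖P.ζ i x * ψ x‖ₑ) / ENNReal.ofReal h ≤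
      (∫⁻ x in layer Ω h, ‖P.ζ i x‖ₑ * ‖fderiv ℝ ψ x‖ₑ) +
        L * ∫⁻ x in (P.c i).strip h, ‖ψ x‖ₑ := fun i => by
    refine ENNReal.div_le_of_le_mul ?_
    rw [mul_comm]
    refine ((P.c i).lintegral_strip_le ((P.contDiff i).mul hψ1) fun p hp => ?_).trans ?_
    · have : (P.c i).bdry p ∉ Ω := fun h =>
        lt_irrefl _ (((P.c i).mem_iff p 0 hp (by simpa using (P.c i).R_pos)).1 h)
      rw [hψ.eq_zero this, mul_zero]
    refine mul_le_mul_right ?_ _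
    rw [← lintegral_const_mul' _ _ hLt]
    refine le_trans ?_ (add_le_add (lintegral_mono_set ((P.c i).strip_subset_layer (hR i))) le_rfl)
    rw [← lintegral_add_left (Measurable.fun_mul
      (P.contDiff i).continuous.enorm.measurable hm)]
    refine lintegral_mono fun x => ?_
    dsimp only
    have hLx := hL i x
    rw [fderiv_fun_mul ((P.contDiff i).differentiable (by norm_num) x)
      (hψ1.differentiable (by norm_num) x)]
    refine le_trans ?_ (add_le_add le_rfl (mul_le_mul_left hLx _))
    rw [← ofReal_norm, ← ofReal_norm, ← ofReal_norm, ← ofReal_norm, ← ofReal_norm,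
      ← ENNReal.ofReal_mul (norm_nonneg _), ← ENNReal.ofReal_mul (norm_nonneg _),
      ← ENNReal.ofReal_add (by positivity) (by positivity)]
    refine ENNReal.ofReal_le_ofReal ((norm_add_le _ _).trans (le_of_eq ?_))
    rw [norm_smul, norm_smul, mul_comm ‖ψ x‖]
  have hsum := P.sum_lintegral_le (μ := volume.restrict (layer Ω h)) hm.aemeasurable
  calc _ ≤ (∫⁻ x in tsupport φ, ‖fderiv ℝ ψ x‖ₑ) + ∑ i,
        ((∫⁻ x in layer Ω h, ‖P.ζ i x‖ₑ * ‖fderiv ℝ ψ x‖ₑ) +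
          L * ∫⁻ x in (P.c i).strip h, ‖ψ x‖ₑ) :=
        add_le_add (hφ.ofReal_le_lintegral_fderiv hψ1) (Finset.sum_le_sum fun i _ => hstrip i)
    _ ≤ (∫⁻ x in tsupport φ, ‖fderiv ℝ ψ x‖ₑ) + ((∫⁻ x in layer Ω h, ‖fderiv ℝ ψ x‖ₑ) +
          L * ∑ i, ∫⁻ x in (P.c i).strip h, ‖ψ x‖ₑ) := by
        rw [Finset.sum_add_distrib, ← Finset.mul_sum]
        gcongr
    _ ≤ _ := by
        rw [← add_assoc, ← lintegral_union (measurableSet_layer hΩ h) hdisj.symm]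
        exact add_le_add (lintegral_mono_set (union_subset hφ.tsupport_subset inter_subset_left))
          le_rfl

/-- At fixed h all terms are continuous under L¹ convergence, so n → ∞ comes first; h → 0 then
produces the traces of v. Traces themselves are not continuous in L¹, hence this order of limits. -/
lemma BoundaryPartition.totalVariation_add_sum_le (hN : 1 ≤ N) {Ω K : Set 𝔼}
    (hΩ : IsPiecewiseC1Domain Ω) {ε : ℝ} (P : BoundaryPartition Ω K ε) {ψ : ℕ → 𝔼 → ℝ} {v : 𝔼 → ℝ}
    (hψ : ∀ n, IsTestFunction Ω (ψ n)) (hv : MemBV Ω v)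
    (h : Tendsto (fun n => ∫⁻ x in Ω, ‖ψ n x - v x‖ₑ) atTop (𝓝 0)) {a : ℝ≥0∞} (hat : a ≠ ⊤)
    (ha : ∀ n, ∫⁻ x in Ω, ‖fderiv ℝ (ψ n) x‖ₑ ≤ a) :
    totalVariation Ω v + ∑ i, ∫⁻ p in ball 0 (P.c i).R,
      ‖P.ζ i ((P.c i).bdry p) * trace Ω v ((P.c i).bdry p)‖ₑ ≤ a := by
  set B := ∑ i, ∫⁻ p in ball 0 (P.c i).R,
      ‖P.ζ i ((P.c i).bdry p) * trace Ω v ((P.c i).bdry p)‖ₑ with hB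
  have hne := hΩ.ne_univ hN
  obtain ⟨L, hLt, hL⟩ : ∃ L : ℝ≥0∞, L ≠ ⊤ ∧ ∀ i x, ‖fderiv ℝ (P.ζ i) x‖ₑ ≤ L := by
    have h1 : ∀ i, ∃ L, ∀ x, ‖fderiv ℝ (P.ζ i) x‖ ≤ L := fun i =>
      ((P.hasCompactSupport i).fderiv (𝕜 := ℝ)).exists_bound_of_continuous
        ((P.contDiff i).continuous_fderiv (by norm_num))
    choose L hL using h1
    refine ⟨∑ i, ENNReal.ofReal (L i), ENNReal.sum_ne_top.2 fun i _ => ENNReal.ofReal_ne_top,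
      fun i x => ?_⟩
    rw [← ofReal_norm]
    exact (ENNReal.ofReal_le_ofReal (hL i x)).trans (Finset.single_le_sum
      (f := fun i => ENNReal.ofReal (L i)) (fun _ _ => bot_le) (Finset.mem_univ i))
  have hψi : ∀ n, IntegrableOn (ψ n) Ω := fun n => (hψ n).integrable.integrableOn
  have key : ∀ φ, IsTestField Ω φ →
      ENNReal.ofReal (∫ x in Ω, v x * divergence φ x) + B ≤ a := fun φ hφ => by
    have hR : ∀ᶠ h in 𝓝[>] (0 : ℝ), 0 < h ∧ ∀ i, h ≤ (P.c i).R := by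
      refine (eventually_mem_nhdsWithin).and (eventually_all.2 fun i => ?_)
      filter_upwards [Ioc_mem_nhdsGT (P.c i).R_pos] with h hh using hh.2
    have hdisj := eventually_layer_inter_subset hΩ.isBounded hne (isClosed_tsupport φ) isOpen_empty
      (fun x hx => by
        have := hx.1
        rw [hΩ.isOpen.frontier_eq] at this
        exact this.2 (hφ.tsupport_subset hx.2))
    have hle : ∀ᶠ h in 𝓝[>] (0 : ℝ), ENNReal.ofReal (∫ x in Ω, v x * divergence φ x) +
        ∑ i, (∫⁻ x in (P.c i).strip h, ‖P.ζ i x * v x‖ₑ) / ENNReal.ofReal h ≤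
        a + L * ∑ i, ∫⁻ x in (P.c i).strip h, ‖v x‖ₑ := by
      filter_upwards [hR, hdisj] with h₀ hh hd
      have hh0 : ENNReal.ofReal h₀ ≠ 0 := (ENNReal.ofReal_pos.2 hh.1).ne'
      refine le_of_tendsto_of_tendsto' (b := atTop)
        (f := fun n => ENNReal.ofReal (∫ x in Ω, ψ n x * divergence φ x) +
          ∑ i, (∫⁻ x in (P.c i).strip h₀, ‖P.ζ i x * ψ n x‖ₑ) / ENNReal.ofReal h₀)
        (g := fun n => a + L * ∑ i, ∫⁻ x in (P.c i).strip h₀, ‖ψ n x‖ₑ) ?_ ?_ fun n => ?_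
      · refine (ENNReal.continuous_ofReal.continuousAt.tendsto.comp
          (hφ.tendsto_integral hψi hv.1 h)).add (tendsto_finsetSum _ fun i _ => ?_)
        exact ENNReal.Tendsto.div_const (tendsto_lintegral_enorm_mul
          ((P.c i).strip_subset (hh.2 i)) hψi hv.1 h (P.contDiff i).continuous (P.mem_Icc i))
          (Or.inr hh0)
      · refine tendsto_const_nhds.add (ENNReal.Tendsto.const_mul
          (tendsto_finsetSum _ fun i _ => ?_) (Or.inr hLt))
        have := tendsto_lintegral_enorm_mul ((P.c i).strip_subset (hh.2 i)) hψi hv.1 h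
          (ζ := fun _ => 1) continuous_const (by simp)
        simpa using this
      · exact (P.add_sum_strip_le hΩ.isOpen hLt hL hφ hh.2
          (disjoint_iff_inter_eq_empty.2 (subset_empty_iff.1 hd)) (hψ n)).trans
          (add_le_add (ha n) le_rfl)
    have hlim := (tendsto_const_nhds (x := ENNReal.ofReal (∫ x in Ω, v x * divergence φ x))).add
      (tendsto_finsetSum Finset.univ fun i _ => (P.c i).tendsto_lintegral_strip_div hN hΩ hv
        (P.isTraced i v hv) (P.contDiff i).continuous (P.mem_Icc i))
    refine le_of_tendsto_of_tendsto hlim ?_ hle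
    have h1 : Tendsto (fun h => ∑ i, ∫⁻ x in (P.c i).strip h, ‖v x‖ₑ) (𝓝[>] 0) (𝓝 0) := by
      rw [← Finset.sum_const_zero (M := ℝ≥0∞) (s := (Finset.univ : Finset P.ι))]
      refine tendsto_finsetSum _ fun i _ => ?_
      refine tendsto_of_tendsto_of_tendsto_of_le_of_le' tendsto_const_nhds
        (tendsto_lintegral_layer hΩ.isOpen hne hv.1) (Eventually.of_forall fun _ => bot_le) ?_
      filter_upwards [hR] with h₀ hh
      exact lintegral_mono_set ((P.c i).strip_subset_layer (hh.2 i))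
    have h2 := ENNReal.Tendsto.const_mul h1 (Or.inr hLt)
    rw [mul_zero] at h2
    simpa using (tendsto_const_nhds (x := a)).add h2
  -- The zero field gives B ≤ a, so that the truncated subtraction a - B below is a genuine one.
  have hBa : B ≤ a := by
    have h0 : IsTestField Ω (fun _ => (0 : 𝔼)) :=
      ⟨contDiff_const, HasCompactSupport.zero, by simp [tsupport, Function.support], by simp⟩
    exact le_add_self.trans (key _ h0)
  calc totalVariation Ω v + B ≤ (a - B) + B := by
        gcongr
        exact iSup₂_le fun φ hφ => ENNReal.le_sub_of_add_le_right
          (ne_top_of_le_ne_top hat hBa) (key φ hφ)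
    _ = a := tsub_add_cancel_of_le hBa

/-- Passing from the chart integrals to the surface integral costs (1+ε)^(N-1). The left-hand side
does not depend on the partition, so ε → 0 removes the factor. -/
lemma totalVariation_add_lintegral_compact_le (hN : 1 ≤ N) {Ω K : Set 𝔼}
    (hΩ : IsPiecewiseC1Domain Ω) (hK : IsCompact K) (hKc : ∀ x ∈ K, IsC1BoundaryPoint Ω x)
    {ψ : ℕ → 𝔼 → ℝ} {v : 𝔼 → ℝ} (hψ : ∀ n, IsTestFunction Ω (ψ n)) (hv : MemBV Ω v)
    (h : Tendsto (fun n => ∫⁻ x in Ω, ‖ψ n x - v x‖ₑ) atTop (𝓝 0)) {a : ℝ≥0∞} (hat : a ≠ ⊤)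
    (ha : ∀ n, ∫⁻ x in Ω, ‖fderiv ℝ (ψ n) x‖ₑ ≤ a) :
    totalVariation Ω v + ∫⁻ x in K, ‖trace Ω v x‖ₑ ∂(surfaceMeasure Ω) ≤ a := by
  have hlim : Tendsto (fun ε : ℝ => ENNReal.ofReal (1 + ε) ^ (N - 1) * a) (𝓝[>] 0) (𝓝 a) := by
    have h2 : Continuous fun ε : ℝ => ENNReal.ofReal (1 + ε) ^ (N - 1) :=
      (ENNReal.continuous_pow _).comp (ENNReal.continuous_ofReal.comp (by fun_prop))
    have h3 := ENNReal.Tendsto.mul_const (b := a) (h2.tendsto 0) (Or.inr hat)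
    simpa using h3.mono_left nhdsWithin_le_nhds
  refine ge_of_tendsto hlim ?_
  filter_upwards [Ioc_mem_nhdsGT (zero_lt_one (α := ℝ))] with ε hε
  obtain ⟨P⟩ := nonempty_boundaryPartition hN hΩ.isOpen hK hKc hε.1 hε.2
  have htr := aemeasurable_trace hN hΩ hv
  have hc : 1 ≤ ENNReal.ofReal (1 + ε) ^ (N - 1) :=
    one_le_pow₀ (ENNReal.one_le_ofReal.2 (by linarith [hε.1]))
  refine le_trans ?_ (mul_le_mul_right (P.totalVariation_add_sum_le hN hΩ hψ hv h hat ha) _)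
  rw [mul_add, Finset.mul_sum]
  refine add_le_add (le_mul_of_one_le_left' hc) ?_
  calc ∫⁻ x in K, ‖trace Ω v x‖ₑ ∂(surfaceMeasure Ω)
      ≤ ∫⁻ x in K, ∑ i, ‖P.ζ i x * trace Ω v x‖ₑ ∂(surfaceMeasure Ω) := by
        refine setLIntegral_mono' hK.measurableSet fun x hx => ?_
        calc ‖trace Ω v x‖ₑ = ‖∑ i, P.ζ i x * trace Ω v x‖ₑ := by
              rw [← Finset.sum_mul, P.sum_eq_one x (P.subset_W hx), one_mul]
          _ ≤ _ := enorm_sum_le _ _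
    _ ≤ ∫⁻ x, ∑ i, ‖P.ζ i x * trace Ω v x‖ₑ ∂(surfaceMeasure Ω) := setLIntegral_le_lintegral _ _
    _ = ∑ i, ∫⁻ x, ‖P.ζ i x * trace Ω v x‖ₑ ∂(surfaceMeasure Ω) :=
        lintegral_finsetSum' _ fun i _ => ((P.contDiff i).continuous.aemeasurable.mul htr).enorm
    _ ≤ _ := by
        refine Finset.sum_le_sum fun i _ => ?_
        refine le_trans ?_ ((P.c i).lintegral_le_bdry fun x => ‖P.ζ i x * trace Ω v x‖ₑ)
        rw [← lintegral_indicator (P.c i).isOpen_dom.measurableSet]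
        refine lintegral_mono fun x => ?_
        by_cases hx : x ∈ (P.c i).dom
        · rw [indicator_of_mem hx]
        · rw [image_eq_zero_of_notMem_tsupport fun h' => hx (P.tsupport_subset i h'), zero_mul,
            enorm_zero]
          exact bot_le

/-- Monotone convergence along compact sets K_m of C¹ boundary points, which exhaust the boundary up
to the singular set of zero area. -/
lemma relaxedEnergy_le_of_tendsto (hN : 1 ≤ N) {Ω : Set 𝔼} (hΩ : IsPiecewiseC1Domain Ω)
    {ψ : ℕ → 𝔼 → ℝ} {v : 𝔼 → ℝ} (hψ : ∀ n, IsTestFunction Ω (ψ n)) (hv : IntegrableOn v Ω)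
    (h : Tendsto (fun n => ∫⁻ x in Ω, ‖ψ n x - v x‖ₑ) atTop (𝓝 0)) {a : ℝ≥0∞} (hat : a ≠ ⊤)
    (ha : ∀ n, ∫⁻ x in Ω, ‖fderiv ℝ (ψ n) x‖ₑ ≤ a) :
    MemBV Ω v ∧ relaxedEnergy Ω v ≤ a := by
  have hTV := totalVariation_le_of_tendsto hψ hv h ha
  have hvBV : MemBV Ω v := ⟨hv, hTV.trans_lt hat.lt_top⟩
  refine ⟨hvBV, ?_⟩
  set S := {x ∈ frontier Ω | ¬ IsC1BoundaryPoint Ω x}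
  have hS : IsClosed S := isClosed_singular hΩ.isOpen
  set K : ℕ → Set 𝔼 := fun m => frontier Ω \ thickening (1 / ((m : ℝ) + 1)) S
  have hKc : ∀ m, IsCompact (K m) := fun m =>
    (hΩ.isBounded.isCompact_closure.of_isClosed_subset isClosed_frontier
      frontier_subset_closure).diff isOpen_thickening
  have hK1 : ∀ m, ∀ x ∈ K m, IsC1BoundaryPoint Ω x := fun m x hx => by
    by_contra hxc
    exact hx.2 (self_subset_thickening (by positivity) S ⟨hx.1, hxc⟩)
  have hmono : Monotone K := fun m n hmn => sdiff_subset_sdiff_right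
    (thickening_mono (one_div_le_one_div_of_le (by positivity) (by simpa using hmn)) S)
  have hae : ∀ᵐ x ∂(surfaceMeasure Ω), x ∈ ⋃ m, K m := by
    filter_upwards [hΩ.ae_c1, ae_restrict_mem isClosed_frontier.measurableSet] with x hx hxf
    have hxS : x ∉ closure S := by
      rw [hS.closure_eq]; exact fun h => h.2 hx
    rw [closure_eq_iInter_thickening] at hxS
    simp only [mem_iInter, not_forall] at hxS
    obtain ⟨δ, hδ, hxδ⟩ := hxS
    obtain ⟨m, hm⟩ := exists_nat_one_div_lt hδ
    exact mem_iUnion.2 ⟨m, hxf, fun h' => hxδ (thickening_mono hm.le S h')⟩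
  have hint : ∫⁻ x, ‖trace Ω v x‖ₑ ∂(surfaceMeasure Ω) =
      ⨆ m, ∫⁻ x in K m, ‖trace Ω v x‖ₑ ∂(surfaceMeasure Ω) := by
    rw [← setLIntegral_iUnion_of_directed _ hmono.directed_le,
      Measure.restrict_eq_self_of_ae_mem hae]
  rw [relaxedEnergy, hint, ENNReal.add_iSup]
  exact iSup_le fun m => totalVariation_add_lintegral_compact_le hN hΩ (hKc m) (hK1 m) hψ hvBV h
    hat ha

/-! ### Compactness -/

lemma lintegral_enorm_translate_sub_le {ψ : 𝔼 → ℝ} (hψ : ContDiff ℝ 1 ψ) (t : 𝔼) :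
    ∫⁻ x, ‖ψ (x - t) - ψ x‖ₑ ≤ ‖t‖ₑ * ∫⁻ x, ‖fderiv ℝ ψ x‖ₑ := by
  have hc : Continuous fun z : 𝔼 × ℝ => ‖fderiv ℝ ψ (z.1 - z.2 • t)‖ₑ :=
    ((hψ.continuous_fderiv (by norm_num)).comp (by fun_prop)).enorm
  have hpt : ∀ x, ‖ψ (x - t) - ψ x‖ₑ ≤
      ‖t‖ₑ * ∫⁻ s in Ioc (0 : ℝ) 1, ‖fderiv ℝ ψ (x - s • t)‖ₑ := fun x => by
    have hd : ∀ s : ℝ, HasDerivAt (fun s => ψ (x - s • t)) (fderiv ℝ ψ (x - s • t) (-t)) s :=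
      fun s => by
        have h1 : HasDerivAt (fun s : ℝ => x - s • t) (-t) s := by
          simpa using ((hasDerivAt_id s).smul_const t).const_sub x
        exact ((hψ.differentiable (by norm_num) _).hasFDerivAt).comp_hasDerivAt s h1
    have hcd : Continuous fun s : ℝ => fderiv ℝ ψ (x - s • t) (-t) :=
      ((hψ.continuous_fderiv (by norm_num)).comp (by fun_prop)).clm_apply continuous_const
    have h := intervalIntegral.integral_eq_sub_of_hasDerivAt (fun s _ => hd s)
      (hcd.intervalIntegrable 0 1)
    simp only [one_smul, zero_smul, sub_zero] at h
    rw [← h, intervalIntegral.integral_of_le zero_le_one]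
    refine (enorm_integral_le_lintegral_enorm _).trans ?_
    rw [← lintegral_const_mul' _ _ enorm_ne_top]
    refine lintegral_mono fun s => ?_
    dsimp only
    rw [← ofReal_norm, ← ofReal_norm, ← ofReal_norm, ← ENNReal.ofReal_mul (norm_nonneg _)]
    refine ENNReal.ofReal_le_ofReal (((fderiv ℝ ψ (x - s • t)).le_opNorm (-t)).trans ?_)
    rw [norm_neg, mul_comm]
  refine (lintegral_mono hpt).trans ?_
  rw [lintegral_const_mul' _ _ enorm_ne_top]
  refine mul_le_mul_right ?_ _
  rw [lintegral_lintegral_swap hc.measurable.aemeasurable]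
  refine (lintegral_mono (g := fun _ => ∫⁻ x, ‖fderiv ℝ ψ x‖ₑ) fun s => ?_).trans ?_
  · exact (lintegral_sub_right_eq_self (fun x => ‖fderiv ℝ ψ x‖ₑ) (s • t)).le
  · rw [lintegral_const, Measure.restrict_apply_univ, Real.volume_Ioc, sub_zero,
      ENNReal.ofReal_one, mul_one]

/-- The gradient mass controls the L¹ modulus of continuity under translation, so mollification at
radius 1/(k+1) is uniformly close on families with bounded gradient mass. -/
lemma lintegral_mollify_sub_le (k : ℕ) {ψ : 𝔼 → ℝ} (hψ : ContDiff ℝ 1 ψ) :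
    ∫⁻ x, ‖mollify k ψ x - ψ x‖ₑ ≤
      ENNReal.ofReal (1 / ((k : ℝ) + 1)) * ∫⁻ x, ‖fderiv ℝ ψ x‖ₑ := by
  set ρ := (bump N k).normed volume
  have hρc : Continuous ρ := (bump N k).continuous_normed
  have hρ0 : ∀ t, 0 ≤ ρ t := fun t => (bump N k).nonneg_normed t
  have hρ1 : ∫⁻ t, ‖ρ t‖ₑ = 1 := by
    have h1 : ∫⁻ t, ‖ρ t‖ₑ = ∫⁻ t, ENNReal.ofReal (ρ t) :=
      lintegral_congr fun t => Real.enorm_of_nonneg (hρ0 t)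
    rw [h1, ← ofReal_integral_eq_lintegral_ofReal (bump N k).integrable_normed
      (Eventually.of_forall hρ0), (bump N k).integral_normed, ENNReal.ofReal_one]
  have hpt : ∀ x, ‖mollify k ψ x - ψ x‖ₑ ≤ ∫⁻ t, ‖ρ t‖ₑ * ‖ψ (x - t) - ψ x‖ₑ := fun x => by
    have h1 : mollify k ψ x - ψ x = ∫ t, ρ t * (ψ (x - t) - ψ x) := by
      simp_rw [mul_sub]
      rw [integral_sub (integrable_bump_mul k hψ.continuous.locallyIntegrable x)
        ((bump N k).integrable_normed.mul_const _), integral_mul_const,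
        (bump N k).integral_normed, one_mul, mollify_apply]
    rw [h1]
    refine (enorm_integral_le_lintegral_enorm _).trans (le_of_eq ?_)
    simp_rw [enorm_mul]
  have hm : Measurable fun z : 𝔼 × 𝔼 => ‖ρ z.2‖ₑ * ‖ψ (z.1 - z.2) - ψ z.1‖ₑ := by
    have h1 := hψ.continuous
    have h2 : Continuous fun z : 𝔼 × 𝔼 => ψ (z.1 - z.2) - ψ z.1 := by fun_prop
    exact (hρc.comp continuous_snd).enorm.measurable.mul h2.enorm.measurable
  refine (lintegral_mono hpt).trans ?_
  rw [lintegral_lintegral_swap hm.aemeasurable]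
  calc ∫⁻ t, ∫⁻ x, ‖ρ t‖ₑ * ‖ψ (x - t) - ψ x‖ₑ
      ≤ ∫⁻ t, ‖ρ t‖ₑ * (ENNReal.ofReal (1 / ((k : ℝ) + 1)) * ∫⁻ x, ‖fderiv ℝ ψ x‖ₑ) := by
        refine lintegral_mono fun t => ?_
        dsimp only
        rw [lintegral_const_mul' _ _ enorm_ne_top]
        by_cases ht : ρ t = 0
        · rw [ht, enorm_zero, zero_mul, zero_mul]
        refine mul_le_mul_right ((lintegral_enorm_translate_sub_le hψ t).trans ?_) _
        refine mul_le_mul_left ?_ _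
        rw [← ofReal_norm]
        refine ENNReal.ofReal_le_ofReal ?_
        have h1 : t ∈ Function.support ρ := ht
        rw [(bump N k).support_normed_eq, mem_ball_zero_iff, bump_rOut] at h1
        exact h1.le
    _ = _ := by
        rw [lintegral_mul_const _ hρc.enorm.measurable, hρ1, one_mul]

lemma mollify_eq_integral_sub (k : ℕ) (ψ : 𝔼 → ℝ) (x : 𝔼) :
    mollify k ψ x = ∫ t, (bump N k).normed volume (x - t) * ψ t := by
  rw [mollify_apply, ← integral_sub_left_eq_self _ volume x]
  simp only [sub_sub_cancel]

/-- At a fixed scale the kernel is bounded and Lipschitz, so an L¹ bound alone makes the mollified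
functions uniformly bounded and equi-Lipschitz, as Arzelà–Ascoli requires. -/
lemma exists_lipschitz_bound_mollify (k : ℕ) : ∃ C : ℝ≥0,
    ∀ ψ : EuclideanSpace ℝ (Fin N) → ℝ, Integrable ψ → ∀ A : ℝ≥0, ∫ t, ‖ψ t‖ ≤ A →
      LipschitzWith (C * A) (mollify k ψ) ∧ ∀ x, |mollify k ψ x| ≤ C * A := by
  set ρ := (bump N k).normed volume
  have hρd : ContDiff ℝ 1 ρ := (bump N k).contDiff_normed
  have hρs : HasCompactSupport ρ := (bump N k).hasCompactSupport_normed
  obtain ⟨C₁, hC₁⟩ := hρd.lipschitzWith_of_hasCompactSupport hρs (by norm_num)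
  obtain ⟨C₂, hC₂⟩ := hρd.continuous.bounded_above_of_compact_support hρs
  refine ⟨max C₁ C₂.toNNReal, fun ψ hψ A hA => ⟨LipschitzWith.of_dist_le_mul fun x y => ?_,
    fun x => ?_⟩⟩
  · have hi : ∀ x, Integrable fun t => ρ (x - t) * ψ t := fun x =>
      hψ.bdd_mul (c := C₂) (hρd.continuous.comp (by fun_prop)).aestronglyMeasurable
        (Eventually.of_forall fun t => hC₂ _)
    rw [Real.dist_eq, mollify_eq_integral_sub, mollify_eq_integral_sub,
      ← integral_sub (hi x) (hi y), ← Real.norm_eq_abs]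
    refine (norm_integral_le_of_norm_le (g := fun t => (C₁ * dist x y) * ‖ψ t‖)
      (hψ.norm.const_mul _) (Eventually.of_forall fun t => ?_)).trans ?_
    · rw [← sub_mul, norm_mul]
      refine mul_le_mul_of_nonneg_right ?_ (norm_nonneg _)
      have := hC₁.dist_le_mul (x - t) (y - t)
      rwa [dist_sub_right, Real.dist_eq, ← Real.norm_eq_abs] at this
    · rw [integral_const_mul, NNReal.coe_mul, mul_right_comm]
      refine mul_le_mul_of_nonneg_right (mul_le_mul (by exact_mod_cast le_max_left _ _) hA
        (integral_nonneg fun _ => norm_nonneg _) (NNReal.coe_nonneg _)) dist_nonneg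
  · rw [mollify_eq_integral_sub, ← Real.norm_eq_abs]
    refine (norm_integral_le_of_norm_le (g := fun t => C₂ * ‖ψ t‖)
      (hψ.norm.const_mul _) (Eventually.of_forall fun t => ?_)).trans ?_
    · rw [norm_mul]
      exact mul_le_mul_of_nonneg_right (hC₂ _) (norm_nonneg _)
    · rw [integral_const_mul]
      refine mul_le_mul ((Real.le_coe_toNNReal _).trans (by exact_mod_cast le_max_right _ _)) hA
        (integral_nonneg fun _ => norm_nonneg _) (NNReal.coe_nonneg _)

lemma exists_finite_uniform_net {K : Set 𝔼} (hK : IsCompact K) {g : ℕ → 𝔼 → ℝ} {L : ℝ≥0}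
    (hg : ∀ n, LipschitzWith L (g n)) {M : ℝ} (hM : ∀ n x, |g n x| ≤ M) {δ : ℝ} (hδ : 0 < δ) :
    ∃ F : Finset ℕ, ∀ n, ∃ m ∈ F, ∀ x ∈ K, |g n x - g m x| ≤ δ := by
  have : CompactSpace K := isCompact_iff_compactSpace.1 hK
  set G : ℕ → BoundedContinuousFunction K ℝ := fun n =>
    BoundedContinuousFunction.mkOfCompact ⟨fun x => g n x,
      (hg n).continuous.comp continuous_subtype_val⟩
  have hcpt : IsCompact (closure (range G)) := by
    refine BoundedContinuousFunction.arzela_ascoli (Icc (-M) M) isCompact_Icc _ ?_ ?_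
    · rintro _ x ⟨n, rfl⟩
      exact abs_le.1 (hM n x)
    · refine LipschitzWith.uniformEquicontinuous _ L ?_ |>.equicontinuous
      rintro ⟨_, n, rfl⟩
      exact (hg n).comp (LipschitzWith.subtype_val K) |>.weaken (by simp)
  obtain ⟨t, htG, htf, htc⟩ := Metric.finite_approx_of_totallyBounded
    (hcpt.totallyBounded.subset subset_closure) δ hδ
  have htG' : ∀ y ∈ t, ∃ n, G n = y := htG
  choose! i hi using htG'
  refine ⟨htf.toFinset.image i, fun n => ?_⟩
  obtain ⟨y, hy, hny⟩ := mem_iUnion₂.1 (htc (mem_range_self n))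
  refine ⟨i y, Finset.mem_image_of_mem i (htf.mem_toFinset.2 hy), fun x hx => ?_⟩
  rw [← hi y hy] at hny
  have := (BoundedContinuousFunction.dist_coe_le_dist (f := G n) (g := G (i y)) ⟨x, hx⟩).trans
    (mem_ball.1 hny).le
  exact this

/-- Kolmogorov–Riesz: fix a mollification scale at which all functions are moved by at most ε/4 in
L¹, take a finite uniform net of the mollified functions, and return. Since test functions extend
smoothly by zero, no regularity of the boundary is involved. -/
lemma exists_subseq_tendsto_of_bounded {Ω : Set 𝔼} (hΩo : IsOpen Ω) (hΩ : Bornology.IsBounded Ω)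
    {ψ : ℕ → 𝔼 → ℝ} (hψ : ∀ n, IsTestFunction Ω (ψ n)) {A : ℝ≥0}
    (hA : ∀ n, ∫⁻ x in Ω, ‖ψ n x‖ₑ ≤ A) (hD : ∀ n, ∫⁻ x in Ω, ‖fderiv ℝ (ψ n) x‖ₑ ≤ A) :
    ∃ κ : ℕ → ℕ, StrictMono κ ∧ ∃ v : 𝔼 → ℝ, IntegrableOn v Ω ∧
      Tendsto (fun n => ∫⁻ x in Ω, ‖ψ (κ n) x - v x‖ₑ) atTop (𝓝 0) := by
  set μ := volume.restrict Ω with hμ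
  have hψi : ∀ n, Integrable (ψ n) μ := fun n => (hψ n).integrable.integrableOn
  have hA' : ∀ n, ∫ t, ‖ψ n t‖ ≤ A := fun n => by
    rw [← setIntegral_eq_integral_of_forall_compl_eq_zero (s := Ω) fun x hx => by
      rw [(hψ n).eq_zero hx, norm_zero], integral_norm_eq_lintegral_enorm
      (hψi n).aestronglyMeasurable]
    exact ENNReal.toReal_le_of_le_ofReal A.2 (by simpa using hA n)
  have hD' : ∀ n, ∫⁻ x, ‖fderiv ℝ (ψ n) x‖ₑ ≤ A := fun n => by
    refine le_trans (le_of_eq ?_) (hD n)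
    rw [hμ, ← lintegral_indicator hΩo.measurableSet]
    refine lintegral_congr fun x => ?_
    by_cases hx : x ∈ Ω
    · rw [indicator_of_mem hx]
    · rw [indicator_of_notMem hx, image_eq_zero_of_notMem_tsupport (f := fderiv ℝ (ψ n))
        fun h => hx ((hψ n).tsupport_subset (tsupport_fderiv_subset ℝ h)), ← ofReal_norm, norm_zero,
        ENNReal.ofReal_zero]
  set f : ℕ → Lp ℝ 1 μ := fun n => (hψi n).toL1 (ψ n)
  have hed : ∀ n m, edist (f n) (f m) = ∫⁻ x in Ω, ‖ψ n x - ψ m x‖ₑ := fun n m => by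
    refine (Integrable.edist_toL1_toL1 _ _ (hψi n) (hψi m)).trans ?_
    simp_rw [edist_eq_enorm_sub]
    rfl
  have htb : TotallyBounded (range f) := by
    refine Metric.totallyBounded_iff.2 fun ε hε => ?_
    obtain ⟨k, hk⟩ : ∃ k : ℕ, 1 / ((k : ℝ) + 1) * A < ε / 4 := by
      have h1 := (tendsto_one_div_add_atTop_nhds_zero_nat (𝕜 := ℝ)).mul_const (A : ℝ)
      rw [zero_mul] at h1
      exact (h1.eventually (gt_mem_nhds (by linarith : 0 < ε / 4))).exists
    obtain ⟨C, hC⟩ := exists_lipschitz_bound_mollify (N := N) k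
    set V := (volume Ω).toReal
    obtain ⟨F, hF⟩ := exists_finite_uniform_net hΩ.isCompact_closure
      (fun n => (hC (ψ n) (hψ n).integrable A (hA' n)).1)
      (fun n => (hC (ψ n) (hψ n).integrable A (hA' n)).2)
      (show 0 < ε / (4 * (V + 1)) by positivity)
    refine ⟨f '' F, F.finite_toSet.image f, ?_⟩
    rintro _ ⟨n, rfl⟩
    obtain ⟨m, hm, hnm⟩ := hF n
    refine mem_iUnion₂.2 ⟨f m, mem_image_of_mem f hm, ?_⟩
    have hmol : ∀ n, ∫⁻ x in Ω, ‖mollify k (ψ n) x - ψ n x‖ₑ ≤ ENNReal.ofReal (ε / 4) := fun n => by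
      refine (setLIntegral_le_lintegral _ _).trans
        ((lintegral_mollify_sub_le k (hψ n).contDiff_one).trans
        ((mul_le_mul_right (hD' n) _).trans ?_))
      rw [← ENNReal.ofReal_coe_nnreal, ← ENNReal.ofReal_mul (by positivity)]
      exact ENNReal.ofReal_le_ofReal hk.le
    have hmc : ∀ n, Continuous (mollify k (ψ n)) := fun n =>
      (hC (ψ n) (hψ n).integrable A (hA' n)).1.continuous
    have hmid : ∫⁻ x in Ω, ‖mollify k (ψ n) x - mollify k (ψ m) x‖ₑ ≤ ENNReal.ofReal (ε / 4) := by
      calc _ ≤ ∫⁻ _ in Ω, ENNReal.ofReal (ε / (4 * (V + 1))) := by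
            refine setLIntegral_mono' hΩo.measurableSet fun x hx => ?_
            rw [← ofReal_norm]
            exact ENNReal.ofReal_le_ofReal (hnm x (subset_closure hx))
        _ ≤ _ := by
            rw [setLIntegral_const, ← ENNReal.ofReal_toReal hΩ.measure_lt_top.ne,
              ← ENNReal.ofReal_mul (by positivity)]
            refine ENNReal.ofReal_le_ofReal ?_
            change ε / (4 * (V + 1)) * V ≤ ε / 4
            have hV : 0 ≤ V := ENNReal.toReal_nonneg
            rw [div_mul_eq_mul_div, div_le_div_iff₀ (by positivity) (by norm_num)]
            nlinarith
    have hc : ∀ n, Continuous (ψ n) := fun n => (hψ n).contDiff.continuous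
    rw [mem_ball, ← ENNReal.ofReal_lt_ofReal_iff hε, ← edist_dist, hed]
    calc ∫⁻ x in Ω, ‖ψ n x - ψ m x‖ₑ
        ≤ (∫⁻ x in Ω, ‖ψ n x - mollify k (ψ n) x‖ₑ) +
            ∫⁻ x in Ω, ‖mollify k (ψ n) x - ψ m x‖ₑ :=
          lintegral_enorm_sub_triangle ((hmc n).sub (hc m)).aemeasurable
      _ ≤ ENNReal.ofReal (ε / 4) + (ENNReal.ofReal (ε / 4) + ENNReal.ofReal (ε / 4)) := by
          refine add_le_add ?_ ((lintegral_enorm_sub_triangle (g := mollify k (ψ m))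
            ((hmc m).sub (hc m)).aemeasurable).trans (add_le_add hmid (hmol m)))
          rw [lintegral_enorm_sub_comm]
          exact hmol n
      _ < ENNReal.ofReal ε := by
          rw [← ENNReal.ofReal_add (by linarith) (by linarith),
            ← ENNReal.ofReal_add (by linarith) (by linarith)]
          exact (ENNReal.ofReal_lt_ofReal_iff hε).2 (by linarith)
  have hcl : IsCompact (closure (range f)) :=
    htb.closure.isCompact_of_isClosed isClosed_closure
  obtain ⟨V, -, κ, hκ, hlim⟩ := hcl.tendsto_subseq fun n => subset_closure (mem_range_self n)
  refine ⟨κ, hκ, V, L1.integrable_coeFn V, ?_⟩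
  have h1 := tendsto_iff_edist_tendsto_0.1 hlim
  refine h1.congr fun n => ?_
  have h2 : edist (f (κ n)) V =
      edist ((hψi (κ n)).toL1 (ψ (κ n))) ((L1.integrable_coeFn V).toL1 V) := by
    rw [Integrable.toL1_coeFn]
  refine h2.trans ((Integrable.edist_toL1_toL1 _ _ _ _).trans ?_)
  simp_rw [edist_eq_enorm_sub]

/-! ### The first eigenvalue -/

lemma integral_abs_eq_toReal {Ω : Set 𝔼} {u : 𝔼 → ℝ} (hu : IntegrableOn u Ω) :
    ∫ x in Ω, |u x| = (∫⁻ x in Ω, ‖u x‖ₑ).toReal := by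
  simp_rw [← Real.norm_eq_abs]
  exact integral_norm_eq_lintegral_enorm hu.aestronglyMeasurable

lemma lintegral_enorm_eq_ofReal {Ω : Set 𝔼} {u : 𝔼 → ℝ} (hu : IntegrableOn u Ω) :
    ∫⁻ x in Ω, ‖u x‖ₑ = ENNReal.ofReal (∫ x in Ω, |u x|) := by
  rw [integral_abs_eq_toReal hu, ENNReal.ofReal_toReal hu.2.ne]

lemma MemBV.const_mul {Ω : Set 𝔼} {u : 𝔼 → ℝ} (hu : MemBV Ω u) (t : ℝ) :
    MemBV Ω fun x => t * u x :=
  ⟨hu.1.const_mul t, (totalVariation_const_mul Ω t u).trans_lt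
    (ENNReal.mul_lt_top ENNReal.ofReal_lt_top hu.2)⟩

lemma relaxedEnergy_const_mul_le (hN : 1 ≤ N) {Ω : Set 𝔼} (hΩ : IsPiecewiseC1Domain Ω) {u : 𝔼 → ℝ}
    (hu : MemBV Ω u) (t : ℝ) :
    relaxedEnergy Ω (fun x => t * u x) ≤ ENNReal.ofReal |t| * relaxedEnergy Ω u := by
  rw [relaxedEnergy, relaxedEnergy, mul_add, ← lintegral_const_mul' _ _ ENNReal.ofReal_ne_top]
  refine add_le_add (totalVariation_const_mul Ω t u) (lintegral_mono_ae ?_)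
  filter_upwards [ae_hasTrace hN hΩ hu, ae_restrict_mem isClosed_frontier.measurableSet]
    with x hx hxf
  rw [(hx.const_mul t).trace_eq hΩ.isOpen (hu.const_mul t).1 (frontier_subset_closure hxf),
    enorm_mul, Real.enorm_eq_ofReal_abs t]

/-- Normalize u to unit mass and use homogeneity of the energy; for zero mass the left-hand side is
0. -/
lemma firstEigenvalue_mul_le (hN : 1 ≤ N) {Ω : Set 𝔼} (hΩ : IsPiecewiseC1Domain Ω) {u : 𝔼 → ℝ}
    (hu : MemBV Ω u) : firstEigenvalue Ω * ∫⁻ x in Ω, ‖u x‖ₑ ≤ relaxedEnergy Ω u := by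
  rw [lintegral_enorm_eq_ofReal hu.1]
  set s := ∫ x in Ω, |u x| with hs
  rcases (integral_nonneg fun x => abs_nonneg (u x) : 0 ≤ s).eq_or_lt with h0 | h0
  · have hs0 : s = 0 := h0.symm
    rw [hs0, ENNReal.ofReal_zero, mul_zero]
    exact bot_le
  have h1 : ∫ x in Ω, |s⁻¹ * u x| = 1 := by
    have h2 : ∀ x, |s⁻¹ * u x| = s⁻¹ * |u x| := fun x => by
      rw [abs_mul, abs_of_pos (inv_pos.2 h0)]
    rw [integral_congr_ae (Eventually.of_forall h2), integral_const_mul, ← hs, inv_mul_cancel₀ h0.ne']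
  have h2 : firstEigenvalue Ω ≤ ENNReal.ofReal |s⁻¹| * relaxedEnergy Ω u :=
    (iInf₂_le_of_le _ (hu.const_mul s⁻¹) (iInf_le _ h1)).trans
      (relaxedEnergy_const_mul_le hN hΩ hu s⁻¹)
  refine (mul_le_mul_left h2 _).trans (le_of_eq ?_)
  rw [mul_right_comm, ← ENNReal.ofReal_mul (abs_nonneg _), abs_of_pos (inv_pos.2 h0),
    inv_mul_cancel₀ h0.ne', ENNReal.ofReal_one, one_mul]

lemma IsTestFunction.lintegral_fderiv_ne_top {Ω : Set 𝔼} {ψ : 𝔼 → ℝ} (h : IsTestFunction Ω ψ) :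
    ∫⁻ x in Ω, ‖fderiv ℝ ψ x‖ₑ ≠ ⊤ :=
  (((h.contDiff_one.continuous_fderiv (by norm_num)).integrable_of_hasCompactSupport
    (h.hasCompactSupport.fderiv (𝕜 := ℝ))).integrableOn (s := Ω)).2.ne

lemma IsTestFunction.memBV {Ω : Set 𝔼} {ψ : 𝔼 → ℝ} (h : IsTestFunction Ω ψ) : MemBV Ω ψ :=
  ⟨h.integrable.integrableOn, (totalVariation_le_lintegral_fderiv Ω h.contDiff_one).trans_lt
    h.lintegral_fderiv_ne_top.lt_top⟩

lemma IsTestFunction.trace_eq_zero {Ω : Set 𝔼} (hΩ : IsOpen Ω) {ψ : 𝔼 → ℝ}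
    (h : IsTestFunction Ω ψ) {x : 𝔼} (hx : x ∈ frontier Ω) : trace Ω ψ x = 0 := by
  have hxΩ : x ∉ tsupport ψ := fun hx' => by
    rw [hΩ.frontier_eq] at hx
    exact hx.2 (h.tsupport_subset hx')
  refine HasTrace.trace_eq hΩ h.integrable.integrableOn (frontier_subset_closure hx) ?_
  obtain ⟨δ, hδ, hδψ⟩ := Metric.eventually_nhds_iff.1 (notMem_tsupport_iff_eventuallyEq.1 hxΩ)
  refine tendsto_const_nhds.congr' ?_
  filter_upwards [Ioo_mem_nhdsGT hδ] with r hr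
  have : ∫⁻ y in Ω ∩ ball x r, ‖ψ y - 0‖ₑ = ∫⁻ _ in Ω ∩ ball x r, 0 := by
    refine setLIntegral_congr_fun (hΩ.measurableSet.inter measurableSet_ball) fun y hy => ?_
    rw [show ψ y = 0 from hδψ ((mem_ball.1 hy.2).trans hr.2), sub_zero, enorm_zero]
  rw [this, lintegral_zero, ENNReal.zero_div]

lemma IsTestFunction.relaxedEnergy_le {Ω : Set 𝔼} (hΩ : IsOpen Ω) {ψ : 𝔼 → ℝ}
    (h : IsTestFunction Ω ψ) : relaxedEnergy Ω ψ ≤ ∫⁻ x in Ω, ‖fderiv ℝ ψ x‖ₑ := by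
  have h0 : ∫⁻ x, ‖trace Ω ψ x‖ₑ ∂(surfaceMeasure Ω) = 0 := by
    rw [surfaceMeasure, setLIntegral_congr_fun isClosed_frontier.measurableSet
      (g := fun _ => 0) fun x hx => by dsimp only; rw [h.trace_eq_zero hΩ hx, enorm_zero],
      lintegral_zero]
  rw [relaxedEnergy, h0, add_zero]
  exact totalVariation_le_lintegral_fderiv Ω h.contDiff_one

/-- A smooth cutoff equal to 1 at one point of Ω has finite energy and positive mass, which is
incompatible with the homogeneous inequality if the infimum is ⊤. -/
lemma firstEigenvalue_lt_top (hN : 1 ≤ N) {Ω : Set 𝔼} (hΩ : IsPiecewiseC1Domain Ω) :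
    firstEigenvalue Ω < ⊤ := by
  obtain ⟨x, hx⟩ := hΩ.isConnected.nonempty
  obtain ⟨ψ, hψ, hψc, hψΩ, hψ1, -⟩ := exists_contDiff_cutoff isCompact_singleton hΩ.isOpen
    (singleton_subset_iff.2 hx)
  have ht : IsTestFunction Ω ψ := ⟨hψ, hψc, hψΩ⟩
  have h1 := (firstEigenvalue_mul_le hN hΩ ht.memBV).trans_lt
    ((ht.relaxedEnergy_le hΩ.isOpen).trans_lt ht.lintegral_fderiv_ne_top.lt_top)
  refine lt_top_iff_ne_top.2 fun htop => ?_
  rw [htop, ENNReal.top_mul] at h1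
  · exact lt_irrefl _ h1
  · intro h0
    rw [lintegral_eq_zero_iff ht.contDiff.continuous.enorm.measurable] at h0
    have h2 := (Measure.eqOn_open_of_ae_eq (f := fun x => ‖ψ x‖ₑ) (g := fun _ => 0) h0 hΩ.isOpen
      ht.contDiff.continuous.enorm.continuousOn continuousOn_const) hx
    simp [hψ1 x rfl] at h2

lemma tendsto_lintegral_enorm_of_L1 {Ω : Set 𝔼} {u : ℕ → 𝔼 → ℝ} {v : 𝔼 → ℝ}
    (hu : ∀ n, IntegrableOn (u n) Ω) (hv : IntegrableOn v Ω)
    (h : Tendsto (fun n => ∫⁻ x in Ω, ‖u n x - v x‖ₑ) atTop (𝓝 0)) :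
    Tendsto (fun n => ∫⁻ x in Ω, ‖u n x‖ₑ) atTop (𝓝 (∫⁻ x in Ω, ‖v x‖ₑ)) := by
  simpa using tendsto_lintegral_enorm_mul Subset.rfl hu hv h (ζ := fun _ => 1) continuous_const
    (by simp)

/-- Each u_n is replaced by a test function within 1/(n+1) in L¹ and with at most 1/(n+1) extra
energy. Compactness and semicontinuity for test functions then apply, and the limit is shared by the
original sequence. -/
lemma exists_subseq_tendsto_firstEigenvalue (hN : 2 ≤ N) {Ω : Set 𝔼} (hΩ : IsPiecewiseC1Domain Ω)
    {u : ℕ → 𝔼 → ℝ} (hu : ∀ n, MemBV Ω (u n)) (hE : ∀ n, relaxedEnergy Ω (u n) ≤ firstEigenvalue Ω)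
    {B : ℝ≥0∞} (hB : B ≠ ⊤) (huB : ∀ n, ∫⁻ x in Ω, ‖u n x‖ₑ ≤ B)
    (h1 : Tendsto (fun n => ∫⁻ x in Ω, ‖u n x‖ₑ) atTop (𝓝 1)) :
    ∃ κ : ℕ → ℕ, StrictMono κ ∧ ∃ v, MemBV Ω v ∧ TightTendsto Ω (fun n => u (κ n)) v ∧
      ∫ x in Ω, |v x| = 1 ∧ relaxedEnergy Ω v = firstEigenvalue Ω := by
  have hN1 : 1 ≤ N := by omega
  have hΛ := firstEigenvalue_lt_top hN1 hΩ
  set Λ := firstEigenvalue Ω with hΛdef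
  set δ : ℕ → ℝ := fun n => 1 / ((n : ℝ) + 1) with hδ
  have hδ0 : ∀ n, 0 < δ n := fun n => by positivity
  have hδ1 : ∀ n, ENNReal.ofReal (δ n) ≤ 1 := fun n => ENNReal.ofReal_le_one.2
    (div_le_one_of_le₀ (by linarith [n.cast_nonneg (α := ℝ)]) (by positivity))
  have hδlim : Tendsto (fun n => ENNReal.ofReal (δ n)) atTop (𝓝 0) := by
    have h2 := (ENNReal.continuous_ofReal.tendsto 0).comp
      (tendsto_one_div_add_atTop_nhds_zero_nat (𝕜 := ℝ))
    rw [ENNReal.ofReal_zero] at h2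
    exact h2
  choose ψ hψ hψu hψD using fun n =>
    exists_isTestFunction_approx hN hΩ (hu n) ((hE n).trans_lt hΛ).ne (hδ0 n)
  have hψD' : ∀ n, ∫⁻ x in Ω, ‖fderiv ℝ (ψ n) x‖ₑ ≤ Λ + ENNReal.ofReal (δ n) := fun n =>
    (hψD n).trans (add_le_add (hE n) le_rfl)
  have hAt : B + 1 + (Λ + 1) ≠ ⊤ := by
    simp [hB, hΛ.ne]
  obtain ⟨κ, hκ, v, hv, hlim⟩ := exists_subseq_tendsto_of_bounded hΩ.isOpen hΩ.isBounded hψ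
    (A := (B + 1 + (Λ + 1)).toNNReal) (fun n => by
      rw [ENNReal.coe_toNNReal hAt]
      exact (lintegral_enorm_le_add (hu n).1.aemeasurable).trans
        ((add_le_add (huB n) ((hψu n).trans (hδ1 n))).trans le_self_add))
    (fun n => by
      rw [ENNReal.coe_toNNReal hAt]
      exact ((hψD' n).trans (add_le_add le_rfl (hδ1 n))).trans le_add_self)
  have hκδ := hδlim.comp hκ.tendsto_atTop
  have hulim : Tendsto (fun n => ∫⁻ x in Ω, ‖u (κ n) x - v x‖ₑ) atTop (𝓝 0) := by
    refine tendsto_of_tendsto_of_tendsto_of_le_of_le tendsto_const_nhds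
      (by simpa using hκδ.add hlim) (fun n => bot_le) fun n => ?_
    refine (lintegral_enorm_sub_triangle (g := ψ (κ n))
      ((hψ (κ n)).integrable.integrableOn.sub hv).aemeasurable).trans (add_le_add ?_ le_rfl)
    rw [lintegral_enorm_sub_comm]
    exact hψu (κ n)
  -- Semicontinuity is stated for a uniform gradient bound, so it is applied to tails, with bound Λ
  -- + e for arbitrary e > 0.
  have hvE : MemBV Ω v ∧ relaxedEnergy Ω v ≤ Λ := by
    have key : ∀ e : ℝ≥0, 0 < e → MemBV Ω v ∧ relaxedEnergy Ω v ≤ Λ + e := fun e he => by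
      obtain ⟨m, hm⟩ := eventually_atTop.1
        (hκδ.eventually_le_const (ENNReal.coe_pos.2 he))
      exact relaxedEnergy_le_of_tendsto hN1 hΩ (fun n => hψ (κ (n + m))) hv
        (hlim.comp (tendsto_add_atTop_nat m)) (ENNReal.add_ne_top.2 ⟨hΛ.ne, ENNReal.coe_ne_top⟩)
        fun n => (hψD' _).trans (add_le_add le_rfl (hm (n + m) (Nat.le_add_left m n)))
    exact ⟨(key 1 one_pos).1, ENNReal.le_of_forall_pos_le_add fun e he _ => (key e he).2⟩
  have hnorm : ∫⁻ x in Ω, ‖v x‖ₑ = 1 := tendsto_nhds_unique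
    (tendsto_lintegral_enorm_of_L1 (fun n => (hu (κ n)).1) hv hulim) (h1.comp hκ.tendsto_atTop)
  have hEv : relaxedEnergy Ω v = Λ := le_antisymm hvE.2 (by
    have := firstEigenvalue_mul_le hN1 hΩ hvE.1
    rwa [hnorm, mul_one] at this)
  refine ⟨κ, hκ, v, hvE.1, ⟨hulim, ?_⟩, ?_, hEv⟩
  · rw [hEv]
    have h2 := ENNReal.Tendsto.const_mul (h1.comp hκ.tendsto_atTop) (Or.inr hΛ.ne)
    rw [mul_one] at h2
    -- Convergence of energies comes from the squeeze Λ‖u_n‖₁ ≤ E(u_n) ≤ Λ.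
    exact tendsto_of_tendsto_of_tendsto_of_le_of_le h2 tendsto_const_nhds
      (fun n => firstEigenvalue_mul_le hN1 hΩ (hu (κ n))) fun n => hE (κ n)
  · rw [integral_abs_eq_toReal hv, hnorm, ENNReal.toReal_one]

/-! ### Bounds for penalized minimizers -/

lemma IsPenalizedMinimizer.add_penalty_le {Ω : Set 𝔼} {n : ℕ} {u : 𝔼 → ℝ}
    (hu : IsPenalizedMinimizer Ω n u) : relaxedEnergy Ω u + penalty Ω n u ≤ firstEigenvalue Ω := by
  refine le_iInf₂ fun v hv => le_iInf fun hv1 => (hu.2 v hv).trans (le_of_eq ?_)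
  rw [penalty, hv1, sub_self]
  simp

lemma IsPenalizedMinimizer.sq_le {Ω : Set 𝔼} (hΛ : firstEigenvalue Ω ≠ ⊤) {n : ℕ} {u : 𝔼 → ℝ}
    (hu : IsPenalizedMinimizer Ω n u) :
    n * ((∫ x in Ω, |u x|) - 1) ^ 2 ≤ (firstEigenvalue Ω).toReal := by
  have h := le_add_self.trans hu.add_penalty_le
  exact (ENNReal.ofReal_le_iff_le_toReal hΛ).1 h

lemma ae_nonneg_of_tendsto {Ω : Set 𝔼} {u : ℕ → 𝔼 → ℝ} {v : 𝔼 → ℝ} (hv : IntegrableOn v Ω)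
    (h : Tendsto (fun n => ∫⁻ x in Ω, ‖u n x - v x‖ₑ) atTop (𝓝 0))
    (hu : ∀ n, ∀ᵐ x ∂(volume.restrict Ω), 0 ≤ u n x) : ∀ᵐ x ∂(volume.restrict Ω), 0 ≤ v x := by
  have h0 : ∫⁻ x in Ω, ENNReal.ofReal (-v x) = 0 := by
    refine le_antisymm (ge_of_tendsto' h fun n => lintegral_mono_ae ?_) bot_le
    filter_upwards [hu n] with x hx
    rw [Real.enorm_eq_ofReal_abs]
    -- Where u_n ≥ 0, the negative part of v is at most |u_n - v|.
    exact ENNReal.ofReal_le_ofReal (by linarith [le_abs_self (u n x - v x)])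
  have hm : AEMeasurable (fun x => -v x) (volume.restrict Ω) := hv.aemeasurable.neg
  rw [lintegral_eq_zero_iff' hm.ennreal_ofReal] at h0
  filter_upwards [h0] with x hx
  have := ENNReal.ofReal_eq_zero.1 hx
  linarith

/-! ### The penalized infima -/

lemma enorm_gradient (ψ : 𝔼 → ℝ) (x : 𝔼) : ‖gradient ψ x‖ₑ = ‖fderiv ℝ ψ x‖ₑ := by
  rw [← ofReal_norm, ← ofReal_norm]
  simp [gradient]

lemma IsTestFunction.continuous_gradient {Ω : Set 𝔼} {ψ : 𝔼 → ℝ} (h : IsTestFunction Ω ψ) :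
    Continuous (gradient ψ) :=
  (InnerProductSpace.toDual ℝ 𝔼).symm.continuous.comp
    (h.contDiff_one.continuous_fderiv (by norm_num))

lemma IsTestFunction.integrable_gradient {Ω : Set 𝔼} {ψ : 𝔼 → ℝ} (h : IsTestFunction Ω ψ) :
    Integrable (gradient ψ) := by
  refine h.continuous_gradient.integrable_of_hasCompactSupport
    ((h.hasCompactSupport.fderiv (𝕜 := ℝ)).mono fun x hx h0 => hx ?_)
  rw [gradient, show fderiv ℝ ψ x = 0 from h0, map_zero]

lemma IsTestFunction.integrable_smul_gradient {Ω : Set 𝔼} {ψ φ : 𝔼 → ℝ} (h : IsTestFunction Ω ψ)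
    (hφ : IsTestFunction Ω φ) : Integrable fun x => ψ x • gradient φ x :=
  (h.contDiff.continuous.smul hφ.continuous_gradient).integrable_of_hasCompactSupport
    (h.hasCompactSupport.mono fun x hx h0 => hx <| by
      change ψ x • gradient φ x = 0
      rw [show ψ x = 0 from h0, zero_smul])

lemma IsTestFunction.integral_smul_gradient {Ω : Set 𝔼} {ψ φ : 𝔼 → ℝ} (h : IsTestFunction Ω ψ)
    (hφ : IsTestFunction Ω φ) : ∫ x in Ω, ψ x • gradient φ x = -∫ x in Ω, φ x • gradient ψ x := by
  rw [setIntegral_eq_integral_of_forall_compl_eq_zero fun x hx => by rw [h.eq_zero hx, zero_smul],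
    setIntegral_eq_integral_of_forall_compl_eq_zero fun x hx => by rw [hφ.eq_zero hx, zero_smul]]
  refine ext_inner_left ℝ fun e => ?_
  rw [inner_neg_right, ← integral_inner (h.integrable_smul_gradient hφ),
    ← integral_inner (hφ.integrable_smul_gradient h)]
  have hg : ∀ (f : 𝔼 → ℝ) x, inner ℝ e (gradient f x) = fderiv ℝ f x e := fun f x => by
    rw [real_inner_comm]; simp [gradient]
  simp_rw [inner_smul_right, hg]
  have hi : ∀ {f g : 𝔼 → ℝ}, IsTestFunction Ω f → IsTestFunction Ω g →
      Integrable fun x => f x * fderiv ℝ g x e := fun {f g} hf hg =>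
    (hf.contDiff.continuous.mul ((hg.contDiff_one.continuous_fderiv (by norm_num)).clm_apply
      continuous_const)).integrable_of_hasCompactSupport
      (hf.hasCompactSupport.mono fun x hx h0 => hx <| by
        change f x * _ = _
        rw [show f x = 0 from h0, zero_mul])
  rw [integral_mul_fderiv_eq_neg_fderiv_mul_of_integrable (v := e)
    ((hi hφ h).congr (Eventually.of_forall fun x => mul_comm _ _)) (hi h hφ)
    ((h.contDiff.continuous.mul hφ.contDiff.continuous).integrable_of_hasCompactSupport
      (h.hasCompactSupport.mono fun x hx h0 => hx <| by
        change ψ x * _ = _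
        rw [show ψ x = 0 from h0, zero_mul]))
    (fun x _ => h.contDiff_one.differentiable (by norm_num) x)
    (fun x _ => hφ.contDiff_one.differentiable (by norm_num) x)]
  congr 1
  exact integral_congr_ae (Eventually.of_forall fun x => mul_comm _ _)

lemma IsTestFunction.memW110 {Ω : Set 𝔼} {ψ : 𝔼 → ℝ} (h : IsTestFunction Ω ψ) :
    MemW110 Ω ψ (gradient ψ) :=
  ⟨h.integrable.integrableOn, h.integrable_gradient.integrableOn,
    fun _ hφ => h.integral_smul_gradient hφ, fun _ => ψ, fun _ => h, by simp, by simp⟩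

/-- For test functions the trace vanishes and the energy is at most the gradient mass; the
inequality then passes to W^{1,1} limits, so the trace of u itself is never needed. -/
lemma firstEigenvalue_mul_le_of_memW110 (hN : 1 ≤ N) {Ω : Set 𝔼} (hΩ : IsPiecewiseC1Domain Ω)
    {u : 𝔼 → ℝ} {G : 𝔼 → 𝔼} (h : MemW110 Ω u G) :
    firstEigenvalue Ω * ∫⁻ x in Ω, ‖u x‖ₑ ≤ ∫⁻ x in Ω, ‖G x‖ₑ := by
  obtain ⟨ψ, hψ, hψu, hψG⟩ := h.approx
  have h1 := tendsto_lintegral_enorm_of_L1 (fun n => (hψ n).integrable.integrableOn) h.integrable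
    hψu
  have h2 := ENNReal.Tendsto.const_mul h1 (Or.inr (firstEigenvalue_lt_top hN hΩ).ne)
  have h3 : Tendsto (fun k => (∫⁻ x in Ω, ‖G x‖ₑ) + ∫⁻ x in Ω, ‖gradient (ψ k) x - G x‖ₑ) atTop
      (𝓝 (∫⁻ x in Ω, ‖G x‖ₑ)) := by
    simpa using (tendsto_const_nhds (x := ∫⁻ x in Ω, ‖G x‖ₑ)).add hψG
  refine le_of_tendsto_of_tendsto' h2 h3 fun k => ?_
  refine (firstEigenvalue_mul_le hN hΩ (hψ k).memBV).trans
    (((hψ k).relaxedEnergy_le hΩ.isOpen).trans ?_)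
  simp_rw [← enorm_gradient]
  exact lintegral_enorm_le_add h.integrable_grad.aemeasurable

/-- An almost optimal v of unit mass is approximated by a test function. Its mass differs from 1 by
at most δ, so the penalty is at most nδ², made small by letting δ depend on n. -/
lemma penalizedInf_le (hN : 2 ≤ N) {Ω : Set 𝔼} (hΩ : IsPiecewiseC1Domain Ω) (n : ℕ) :
    penalizedInf Ω n ≤ firstEigenvalue Ω := by
  refine ENNReal.le_of_forall_pos_le_add fun e he hΛ => ?_
  have he2 : (0 : ℝ) < e / 2 := by positivity
  have hlt : firstEigenvalue Ω < firstEigenvalue Ω + ENNReal.ofReal (e / 2) :=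
    ENNReal.lt_add_right hΛ.ne (ENNReal.ofReal_pos.2 he2).ne'
  obtain ⟨v, hlt⟩ := iInf_lt_iff.1 hlt
  obtain ⟨hv, hlt⟩ := iInf_lt_iff.1 hlt
  obtain ⟨hv1, hlt⟩ := iInf_lt_iff.1 hlt
  -- With δ ≤ 1 one has δ + nδ² ≤ (n+1)δ ≤ e/2.
  set δ : ℝ := min 1 (e / 2 / (n + 1)) with hδ
  have hδ0 : 0 < δ := lt_min one_pos (by positivity)
  have hδe : δ + n * δ ^ 2 ≤ e / 2 := by
    have h1 : δ ≤ 1 := min_le_left _ _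
    have h2 : δ * (n + 1) ≤ e / 2 := (le_div_iff₀ (by positivity)).1 (min_le_right _ _)
    have h3 : (n : ℝ) * δ ^ 2 ≤ n * δ := by
      refine mul_le_mul_of_nonneg_left ?_ n.cast_nonneg
      nlinarith
    linarith
  obtain ⟨ψ, hψ, hψv, hψD⟩ := exists_isTestFunction_approx hN hΩ hv hlt.ne_top hδ0
  have habs : |(∫ x in Ω, |ψ x|) - 1| ≤ δ := by
    have h1 : ∫⁻ x in Ω, ‖v x‖ₑ = 1 := by
      rw [lintegral_enorm_eq_ofReal hv.1, hv1, ENNReal.ofReal_one]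
    have hψi : IntegrableOn ψ Ω := hψ.integrable.integrableOn
    have h2 := lintegral_enorm_le_add (f := ψ) hv.1.aemeasurable
    have h3 := lintegral_enorm_le_add (f := v) hψi.aemeasurable
    rw [lintegral_enorm_sub_comm] at h3
    rw [h1, lintegral_enorm_eq_ofReal hψi] at h2 h3
    have h2' := h2.trans (add_le_add le_rfl hψv)
    have h3' := h3.trans (add_le_add le_rfl hψv)
    rw [← ENNReal.ofReal_one, ← ENNReal.ofReal_add zero_le_one hδ0.le,
      ENNReal.ofReal_le_ofReal_iff (by linarith)] at h2'
    have h0 : 0 ≤ ∫ x in Ω, |ψ x| := integral_nonneg fun _ => abs_nonneg _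
    rw [← ENNReal.ofReal_one, ← ENNReal.ofReal_add h0 hδ0.le,
      ENNReal.ofReal_le_ofReal_iff (by linarith)] at h3'
    exact abs_le.2 ⟨by linarith, by linarith⟩
  have hpen : penalty Ω n ψ ≤ ENNReal.ofReal (n * δ ^ 2) := by
    refine ENNReal.ofReal_le_ofReal (mul_le_mul_of_nonneg_left ?_ n.cast_nonneg)
    rw [← sq_abs]
    gcongr
  calc penalizedInf Ω n ≤ (∫⁻ x in Ω, ‖gradient ψ x‖ₑ) + penalty Ω n ψ :=
        iInf₂_le_of_le ψ (gradient ψ) (iInf_le _ hψ.memW110)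
    _ ≤ (relaxedEnergy Ω v + ENNReal.ofReal δ) + ENNReal.ofReal (n * δ ^ 2) := by
        simp_rw [enorm_gradient]
        exact add_le_add hψD hpen
    _ ≤ (firstEigenvalue Ω + ENNReal.ofReal (e / 2)) + ENNReal.ofReal (e / 2) := by
        rw [add_assoc, ← ENNReal.ofReal_add hδ0.le (by positivity)]
        exact add_le_add hlt.le (ENNReal.ofReal_le_ofReal hδe)
    _ = firstEigenvalue Ω + e := by
        rw [add_assoc, ← ENNReal.ofReal_add he2.le he2.le, add_halves, ENNReal.ofReal_coe_nnreal]

/-- With s the mass of u, the functional is at least Λs + n(s-1)², whose minimum over real s is Λ -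
Λ²/(4n); completing the square shows it. -/
lemma le_penalizedInf (hN : 1 ≤ N) {Ω : Set 𝔼} (hΩ : IsPiecewiseC1Domain Ω) {n : ℕ} (hn : 1 ≤ n) :
    ENNReal.ofReal ((firstEigenvalue Ω).toReal - (firstEigenvalue Ω).toReal ^ 2 / (4 * n)) ≤
      penalizedInf Ω n := by
  refine le_iInf₂ fun u G => le_iInf fun h => ?_
  have h1 := firstEigenvalue_mul_le_of_memW110 hN hΩ h
  refine le_trans ?_ (add_le_add h1 le_rfl)
  rw [lintegral_enorm_eq_ofReal h.integrable, penalty,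
    ← ENNReal.ofReal_toReal (firstEigenvalue_lt_top hN hΩ).ne,
    ENNReal.toReal_ofReal ENNReal.toReal_nonneg, ← ENNReal.ofReal_mul ENNReal.toReal_nonneg,
    ← ENNReal.ofReal_add (mul_nonneg ENNReal.toReal_nonneg
      (integral_nonneg fun _ => abs_nonneg _)) (by positivity)]
  refine ENNReal.ofReal_le_ofReal ?_
  set s := ∫ x in Ω, |u x|
  set Λ := (firstEigenvalue Ω).toReal
  have hn0 : (0 : ℝ) < n := by exact_mod_cast hn
  have h2 : Λ * s + n * (s - 1) ^ 2 - (Λ - Λ ^ 2 / (4 * n)) =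
      (2 * n * (s - 1) + Λ) ^ 2 / (4 * n) := by
    field_simp
    ring
  have h3 : 0 ≤ (2 * n * (s - 1) + Λ) ^ 2 / (4 * n) := by positivity
  linarith

lemma tendsto_penalizedInf (hN : 2 ≤ N) {Ω : Set 𝔼} (hΩ : IsPiecewiseC1Domain Ω) :
    Tendsto (fun n : ℕ => penalizedInf Ω n) atTop (𝓝 (firstEigenvalue Ω)) := by
  have hN1 : 1 ≤ N := by omega
  have hΛ := firstEigenvalue_lt_top hN1 hΩ
  set Λ := (firstEigenvalue Ω).toReal with hΛd
  have h1 : Tendsto (fun n : ℕ => Λ - Λ ^ 2 / (4 * (n : ℝ))) atTop (𝓝 Λ) := by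
    have h2 : Tendsto (fun n : ℕ => Λ ^ 2 / 4 * (n : ℝ)⁻¹) atTop (𝓝 0) := by
      simpa using (tendsto_inv_atTop_nhds_zero_nat (𝕜 := ℝ)).const_mul (Λ ^ 2 / 4)
    have h3 := h2.const_sub Λ
    rw [sub_zero] at h3
    refine h3.congr fun n => ?_
    rw [← div_eq_mul_inv, div_div]
  have h4 := (ENNReal.continuous_ofReal.tendsto Λ).comp h1
  rw [hΛd, ENNReal.ofReal_toReal hΛ.ne, ← hΛd] at h4
  refine tendsto_of_tendsto_of_tendsto_of_le_of_le' h4 tendsto_const_nhds ?_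
    (Eventually.of_forall fun n => penalizedInf_le hN hΩ n)
  filter_upwards [eventually_ge_atTop 1] with n hn using le_penalizedInf hN1 hΩ hn

/-! ### Convergence of penalized minimizers -/

lemma exists_subseq_minimizers (hN : 2 ≤ N) {Ω : Set 𝔼} (hΩ : IsPiecewiseC1Domain Ω)
    {u : ℕ → 𝔼 → ℝ} (hu : ∀ n : ℕ, 1 ≤ n → IsPenalizedMinimizer Ω n (u n)) :
    ∃ κ : ℕ → ℕ, StrictMono κ ∧ (∀ k, 1 ≤ κ k) ∧ ∃ v, MemBV Ω v ∧
      TightTendsto Ω (fun k => u (κ k)) v ∧ ∫ x in Ω, |v x| = 1 ∧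
      relaxedEnergy Ω v = firstEigenvalue Ω := by
  have hΛ := firstEigenvalue_lt_top (by omega) hΩ
  set Λ := (firstEigenvalue Ω).toReal
  -- Minimality is assumed only from index 1 on, hence the shift, undone in the final subsequence.
  set s : ℕ → ℝ := fun n => ∫ x in Ω, |u (n + 1) x|
  have hsq : ∀ n, ((n + 1 : ℕ) : ℝ) * (s n - 1) ^ 2 ≤ Λ := fun n =>
    (hu (n + 1) (by omega)).sq_le hΛ.ne
  have hs : ∀ n, ∫⁻ x in Ω, ‖u (n + 1) x‖ₑ = ENNReal.ofReal (s n) := fun n =>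
    lintegral_enorm_eq_ofReal (hu (n + 1) (by omega)).1.1
  have hslim : Tendsto s atTop (𝓝 1) := by
    have h1 : Tendsto (fun n => (s n - 1) ^ 2) atTop (𝓝 0) := by
      have h2 := (tendsto_one_div_add_atTop_nhds_zero_nat (𝕜 := ℝ)).mul_const Λ
      rw [zero_mul] at h2
      refine tendsto_of_tendsto_of_tendsto_of_le_of_le tendsto_const_nhds h2
        (fun n => sq_nonneg _) fun n => ?_
      have h3 := hsq n
      push_cast at h3
      dsimp only
      rw [one_div_mul_eq_div, le_div_iff₀ (by positivity), mul_comm]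
      exact h3
    have h4 : Tendsto (fun n => |s n - 1|) atTop (𝓝 0) := by
      have h2 := (Real.continuous_sqrt.tendsto 0).comp h1
      rw [Real.sqrt_zero] at h2
      exact h2.congr fun n => Real.sqrt_sq_eq_abs _
    have h5 := ((tendsto_zero_iff_abs_tendsto_zero _).2 h4).add_const 1
    simpa using h5
  obtain ⟨κ, hκ, v, h⟩ := exists_subseq_tendsto_firstEigenvalue hN hΩ
    (u := fun n => u (n + 1)) (fun n => (hu (n + 1) (by omega)).1)
    (fun n => le_self_add.trans (hu (n + 1) (by omega)).add_penalty_le)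
    -- From (s - 1)² ≤ Λ and s - 1 ≤ 1 + (s - 1)² one gets s ≤ 2 + Λ.
    (B := ENNReal.ofReal (2 + Λ)) ENNReal.ofReal_ne_top
    (fun n => by
      rw [hs]
      refine ENNReal.ofReal_le_ofReal ?_
      have h1 := hsq n
      push_cast at h1
      nlinarith [sq_nonneg (s n - 1), sq_nonneg (s n - 2),
        mul_nonneg (n.cast_nonneg (α := ℝ)) (sq_nonneg (s n - 1))])
    (by
      simp_rw [hs]
      have h2 := (ENNReal.continuous_ofReal.tendsto 1).comp hslim
      rw [ENNReal.ofReal_one] at h2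
      exact h2)
  exact ⟨fun k => κ k + 1, fun a b hab => Nat.succ_lt_succ (hκ hab), fun k => Nat.le_add_left 1 (κ k), v, h⟩

end BVEigen

end

theorem theorem4p2 (N : ℕ) (hN : 2 ≤ N) (Ω : Set (EuclideanSpace ℝ (Fin N)))
    (hΩ : BVEigen.IsPiecewiseC1Domain Ω) :
    (∀ u : ℕ → EuclideanSpace ℝ (Fin N) → ℝ,
      (∀ n : ℕ, 1 ≤ n → BVEigen.IsPenalizedMinimizer Ω n (u n)) →
      ∃ κ : ℕ → ℕ, StrictMono κ ∧ ∃ v : EuclideanSpace ℝ (Fin N) → ℝ,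
        BVEigen.MemBV Ω v ∧
        BVEigen.TightTendsto Ω (fun k => u (κ k)) v ∧
        ((∀ n : ℕ, 1 ≤ n → ∀ᵐ x ∂(volume.restrict Ω), 0 ≤ u n x) →
          ∀ᵐ x ∂(volume.restrict Ω), 0 ≤ v x) ∧
        ¬ (∀ᵐ x ∂(volume.restrict Ω), v x = 0) ∧
        ∫ x in Ω, |v x| = 1 ∧
        BVEigen.relaxedEnergy Ω v = BVEigen.firstEigenvalue Ω) ∧
    BVEigen.firstEigenvalue Ω < ⊤ ∧
    Tendsto (fun n : ℕ => BVEigen.penalizedInf Ω n) atTop (𝓝 (BVEigen.firstEigenvalue Ω)) := by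
  refine ⟨fun u hu => ?_, BVEigen.firstEigenvalue_lt_top (by omega) hΩ,
    BVEigen.tendsto_penalizedInf hN hΩ⟩
  obtain ⟨κ, hκ, hκ1, v, hv, ht, h1, hE⟩ := BVEigen.exists_subseq_minimizers hN hΩ hu
  refine ⟨κ, hκ, v, hv, ht, fun hnn => ?_, fun h0 => ?_, h1, hE⟩
  · exact BVEigen.ae_nonneg_of_tendsto hv.1 ht.1 fun k => hnn (κ k) (hκ1 k)
  · have h2 : ∫ x in Ω, |v x| = ∫ _ in Ω, (0 : ℝ) :=
      integral_congr_ae (h0.mono fun x hx => by simp [hx])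
    rw [integral_zero, h1] at h2
    exact one_ne_zero h2
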